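/- **Theorem (type soundness of the surface language).** Let $\mathcal L$ be an infinite set of location names, and fix a local language as described below. If $\vdash C:\tau\triangleright\rho$ in the empty context, $\Omega\subset\mathcal L$ is finite with $\mathrm{NL}(\rho)\subseteq\Omega$, and $\langle C,\Omega\rangle\Longrightarrow^{*}\langle C',\Omega'\rangle$, then either $C'$ is a value or there are $R,C'',\Omega''$ with $\langle C',\Omega'\rangle\overset{R}{\Longrightarrow}\langle C'',\Omega''\rangle$. **Locations.** $\ell::=\alpha\mid L$ with $L\in\mathcal L$; location sets $\rho::=\varnothing\mid\{\ell\}\mid\alpha\mid\top\mid\rho\cup\rho$, up to the semilattice laws of $\cup$. $\ell\in\rho$ iff $\{\ell\}$ or $\top$ is a component of $\rho$; $\rho\subseteq\rho'$ iff $\top$ is a component of $\rho'$ or every component of $\rho$ is one of $\rho'$; $\rho\cap\rho'=\varnothing$ iff no $\ell$ is in both. $\rho\setminus\alpha$ removes the component $\alpha$ resp. $\{\alpha\}$. $\mathrm{NL}(\rho)$ is the set of $L\in\mathcal L$ such that $\{L\}$ is a component of $\rho$ (so $\mathrm{NL}(\top)=\varnothing$). $\rho$ is *live in* $\Omega$ if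 $\rho$ has no variables and $\mathrm{NL}(\rho)\subseteq\Omega$. **Local language.** Types $t$ and expressions $e$ with capture-avoiding simultaneous substitution, values, a small-step relation $\to$, well-formedness $\Gamma\vdash t$, and typing $\Gamma;\Delta\vdash e:t$, where: values do not step and stay values when values are substituted for variables; $\to$ is confluent; variables are typable, typing and well-formedness respect well-formed substitutions, preservation holds in every context and progress holds for closed expressions. A predicate $\mathrm{isSum}(s,t_1,t_2)$, stable under substitution, and a partial function $\mathrm{getCase}$ satisfy: on closed values of type $s$ it is defined; and whenever it is defined on a value of type $s$ it gives $\mathrm{inl}$ of a value of type $t_1$ or $\mathrm{inr}$ of a value of type $t_2$ in the same context. There are types $\mathsf{loc}_\rho,\mathsf{locset}_\rho$, well-formed for well-kinded $\rho$ and commuting with substitution. Every $L$ has a representation $\ulcorner L\urcorner$; each one is a closed value of type $\mathsf{loc}_{\{L\}}$. Closed values of type $\mathsf{loc}_\rho$ (resp. $\mathsf{locset}_\rho$) represent a unique location (resp. finite set of locations), and anything of that type, in any context, only represents elements (resp. subsets) of $\rho$. **Syntax.** Kinds $\kappa::=*_{\mathsf{loc}}\mid*_{\mathsf{locset}}\mid*_{\mathsf{finlocset}}\mid*_e\mid*_\rho$.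 Program types $$\tau::=\alpha\mid t@\rho\mid\tau_1\xrightarrow{\rho}\tau_2\mid\tau_1\times\tau_2\mid\tau_1+_\rho\tau_2\mid\mu\alpha{::}*_\rho.\tau\mid\forall\alpha{::}\kappa[\rho].\tau .$$ Choreographies ($a$ is a location, location set, local type or program type; $d$ is one of two selection labels): $$\begin{aligned}C::={}&X\mid\rho.e\mid\mathsf{fun}_\rho\,F(X):=C\mid C_1@_\rho C_2\mid\mathsf{tfun}\,F(\alpha{::}\kappa):=C\mid C@_\rho a\mid\mathsf{fold}_\rho C\mid\mathsf{unfold}_\rho C\mid(C_1,C_2)_\rho\mid\mathsf{fst}_\rho C\mid\mathsf{snd}_\rho C\mid\mathsf{inl}_\rho C\mid\mathsf{inr}_\rho C\\&\mid\mathsf{case}_\rho\,C\,(X.C_1)(Y.C_2)\mid\mathsf{localcase}_\rho\,C\,(x.C_1)(y.C_2)\mid\mathsf{let}\ \rho.x{:}t:=C_1\ \mathsf{in}\ C_2\mid\mathsf{let}\ \rho.\alpha{::}\kappa:=C_1\ \mathsf{in}\ C_2\\&\mid C\leadsto_\ell\rho\mid\ell[d]\leadsto\rho;C\mid\mathsf{fork}(\alpha,x)\,\mathsf{at}\,\ell\,\mathsf{in}\,C\mid\mathsf{killafter}\,L\,C.\end{aligned}$$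 In $\mathsf{let}\ \rho.\alpha{::}\kappa$, $\kappa$ is $*_{\mathsf{loc}}$, $*_{\mathsf{locset}}$ or $*_{\mathsf{finlocset}}$. Values: $\rho.v$ with $v$ a local value, $\mathsf{fun}$, $\mathsf{tfun}$, and pairs, $\mathsf{inl}$, $\mathsf{inr}$, $\mathsf{fold}$ of values. **Kinding.** A location set has kind $*_{\mathsf{locset}}$ if its variables are in scope, and $*_{\mathsf{finlocset}}$ if moreover $\top$ does not occur and its set variables have kind $*_{\mathsf{finlocset}}$. $\tau::*_\rho$ is given by: a variable has its declared kind; $t@\rho::*_\rho$; if $\tau_i::*_{\rho_i}$ then $\tau_1\xrightarrow{\rho}\tau_2::*_{\rho_1\cup\rho_2\cup\rho}$, $\tau_1\times\tau_2::*_{\rho_1\cup\rho_2}$, and $\tau_1+_\rho\tau_2::*_\rho$ provided $\rho_1\cup\rho_2\subseteq\rho$; $\mu\alpha{::}*_\rho.\tau::*_\rho$ if $\tau::*_{\rho'}$ with $\rho'\subseteq\rho$; if $\tau::*_{\rho'}$ under $\alpha{::}\kappa$ then $\forall\alpha{::}\kappa[\rho].\tau$ has kind $*_\top$ when $\kappa$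 is a kind of locations or location sets, and $*_{\rho\cup\rho'}$ otherwise. All location sets and local types in $\tau$ are well-formed. Write $|\tau|$ for the $\rho$ with $\tau::*_\rho$. **Typing** $\Gamma\vdash C:\tau\triangleright\rho$ ("$\rho$ participates"). $\Gamma|_\rho$ keeps the local variables $\rho'.x{:}t$ with $\rho\subseteq\rho'$. All annotations and types are well-kinded. $C_i$ has participants $\rho_i$ and $C$ has $\rho_0$. - $X:\tau\triangleright\varnothing$ for $X{:}\tau$ in $\Gamma$. If $\Gamma|_\rho\vdash e:t$ then $\rho.e:t@\rho\triangleright\varnothing$ for $e$ a value, and $\triangleright\rho$ otherwise. - If $C:\tau_2\triangleright\rho$ under $F{:}\tau_1\xrightarrow{\rho}\tau_2,X{:}\tau_1$ then $\mathsf{fun}_{\rho'}F(X){:=}C:\tau_1\xrightarrow{\rho}\tau_2\triangleright\varnothing$, and if $C_1:\tau_1\xrightarrow{\rho}\tau_2$, $C_2:\tau_1$ then $C_1@_{\rho'}C_2:\tau_2\triangleright\rho_1\cup\rho_2\cup\rho'$, where $\rho'=|\tau_1|\cup|\tau_2|\cup\rho$. - If $C:\tau\triangleright\rho$ under $F{:}\forall\alpha{::}\kappa[\rho].\tau,\alpha{::}\kappa$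 then $\mathsf{tfun}\,F(\alpha{::}\kappa){:=}C:\forall\alpha{::}\kappa[\rho].\tau\triangleright\varnothing$. If $C:\forall\alpha{::}\kappa[\rho].\tau$ and $a::\kappa$ then $C@_{\rho'}a:\tau[a/\alpha]\triangleright\rho_0\cup\rho'$ with $\rho'=|\tau[a/\alpha]|\cup\rho[a/\alpha]$. - $\mathsf{fold}_\rho C:\mu\alpha{::}*_\rho.\tau\triangleright\rho_0$ and $\mathsf{unfold}_\rho C:\tau[\mu\alpha{::}*_\rho.\tau/\alpha]\triangleright\rho_0\cup\rho$, for $C$ of the other type. $(C_1,C_2)_\rho:\tau_1\times\tau_2\triangleright\rho_1\cup\rho_2$, and $\mathsf{fst}_\rho C,\mathsf{snd}_\rho C:\tau_1,\tau_2\triangleright\rho_0\cup\rho$, with $\rho=|\tau_1|\cup|\tau_2|$. $\mathsf{inl}_\rho C,\mathsf{inr}_\rho C:\tau_1+_\rho\tau_2\triangleright\rho_0$. $\mathsf{case}_\rho$ on $\tau_1+_\rho\tau_2$ has the common type of its branches, $\triangleright\rho_0\cup\rho_1\cup\rho_2\cup\rho$. - $\mathsf{localcase}_\rho$ on $C:s@\rho'$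 with $\mathrm{isSum}(s,t_1,t_2)$, $\rho\subseteq\rho'$ and branches under $\rho.x{:}t_1$, $\rho.y{:}t_2$ has the same participants as $\mathsf{case}_\rho$. $\mathsf{let}\ \rho.x{:}t:=C_1\ \mathsf{in}\ C_2:\tau\triangleright\rho_1\cup\rho_2\cup\rho$ if $C_1:t@\rho'$, $\rho\subseteq\rho'$, $C_2:\tau$ under $\rho.x{:}t$. - $\mathsf{let}\ \rho.\alpha{::}\kappa:=C_1\ \mathsf{in}\ C_2:\tau\triangleright\rho_1\cup(\rho_2\setminus\alpha)\cup\rho$ if $C_1:\mathsf{loc}_{\rho''}@\rho'$ (for $\kappa=*_{\mathsf{loc}}$) or $\mathsf{locset}_{\rho''}@\rho'$ (otherwise), $\rho''\subseteq\rho\subseteq\rho'$, $\rho::*_{\mathsf{finlocset}}$, $C_2:\tau$ under $\alpha{::}\kappa$, and $\tau$ is well-kinded without $\alpha$. - $C\leadsto_\ell\rho:t@(\rho'\cup\rho)\triangleright\rho_0\cup\{\ell\}\cup\rho$ if $C:t@\rho'$ and $\ell\in\rho'$. $\ell[d]\leadsto\rho;C:\tau\triangleright\{\ell\}\cup\rho\cup\rho_0$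 if $C:\tau$. $\mathsf{fork}(\alpha,x)\,\mathsf{at}\,\ell\,\mathsf{in}\,C:\tau\triangleright\{\ell\}\cup(\rho_0\setminus\alpha)$ if $C:\tau$ under $\alpha{::}*_{\mathsf{loc}},\{\alpha,\ell\}.x{:}\mathsf{loc}_{\{\alpha\}}$ and $\tau$ is well-kinded without $\alpha$. There is no rule for $\mathsf{killafter}$. **Steps.** Steps $\langle C,\Omega\rangle\overset{R}{\Longrightarrow}\langle C',\Omega'\rangle$ on configurations with finite $\Omega$ are labelled by the redex $R$; $\mathrm{rloc}(R)$ denotes the locations acting in it. $\mathrm{cloc}(C)$ collects the annotations of the actions occurring in $C$: it is $\varnothing$ on $X$, $\mathsf{fun}$ and $\mathsf{tfun}$; it is $\rho$ on $\rho.e$; on every other form it is the union over the subterms (without the type variable bound there), together with $\rho$ for application, type application, $\mathsf{unfold}$, $\mathsf{fst}$, $\mathsf{snd}$, $\mathsf{case}$, $\mathsf{localcase}$ and $\mathsf{let}$, with $\{\ell\}\cup\rho$ for sends and selections, $\{\ell\}$ for $\mathsf{fork}$, and $\{L\}$ for $\mathsf{killafter}\,L$. - *Reductions* (with the acting set live in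 $\Omega$; it is the $\rho$ of the construct being reduced unless stated): $\rho.e\Rightarrow\rho.e'$ if $e\to e'$; $f@_\rho V\Rightarrow C[f/F,V/X]$ for $f=\mathsf{fun}_\rho F(X):=C$; likewise for type application; $\mathsf{unfold}_\rho(\mathsf{fold}_\rho V)\Rightarrow V$; the projections of $(V_1,V_2)_\rho$; $\mathsf{case}_\rho$ on $\mathsf{inl}_\rho V$ and $\mathsf{inr}_\rho V$; $\mathsf{localcase}_\rho$ on $\rho'.v$ by $\mathrm{getCase}(v)$ and $\mathsf{let}\ \rho.x{:}t:=\rho'.v$ by substitution of $v$, if $\rho\subseteq\rho'$; $\mathsf{let}\ \rho.\alpha{::}\kappa:=\rho'.v$ with $\rho\subseteq\rho'$ by substitution of what the value $v$ represents; $\rho_1.v\leadsto_L\rho_2\Rightarrow(\rho_1\cup\rho_2).v$ if $L\in\rho_1$, acting set $\{L\}\cup\rho_2$; $L[d]\leadsto\rho;C\Rightarrow C$, acting set $\{L\}\cup\rho$. For $L\in\Omega$, $L'\notin\Omega$: $\langle\mathsf{fork}(\alpha,x)\,\mathsf{at}\,L\,\mathsf{in}\,C,\Omega\rangle\Rightarrow\langle\mathsf{killafter}\,L'\,C[L'/\alpha,\ulcorner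 L'\urcorner/x],\Omega\cup\{L'\}\rangle$, acting set $\{L\}$. For $L\in\Omega$: $\langle\mathsf{killafter}\,L\,C,\Omega\rangle\Rightarrow\langle C,\Omega\setminus\{L\}\rangle$ if $C$ is a value or $L\notin\mathrm{cloc}(C)$, acting set $\{L\}$. - *Contexts:* steps are closed under the frames $\eta@_\rho C$, $V@_\rho\eta$, $\eta@_\rho a$, $(\eta,C)_\rho$, $(V,\eta)_\rho$, $\mathsf{killafter}\,L\,\eta$, and $\eta$ as the argument of $\mathsf{fold},\mathsf{unfold},\mathsf{fst},\mathsf{snd},\mathsf{inl},\mathsf{inr},\mathsf{case},\mathsf{localcase}$, both $\mathsf{let}$s and send. - *Out-of-order steps:* $C_2$ may step in $C_1@_\rho C_2$ and $(C_1,C_2)_\rho$ if $\mathrm{rloc}(R)\cap\mathrm{cloc}(C_1)=\varnothing$; $C_2$ may step in both $\mathsf{let}$s if $\mathrm{rloc}(R)\cap(\mathrm{cloc}(C_1)\cup\rho)=\varnothing$; both branches of $\mathsf{case}_\rho$ or $\mathsf{localcase}_\rho$ on $C$ may step together, with the same $R$ and $\Omega'$, if $\mathrm{rloc}(R)\cap(\mathrm{cloc}(C)\cup\rho)=\varnothing$;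 the continuation of $\ell[d]\leadsto\rho$ may step if $\mathrm{rloc}(R)\cap(\{\ell\}\cup\rho)=\varnothing$; the body of $\mathsf{fork}$ at $\ell$ may step if $\ell\notin\mathrm{rloc}(R)$. -/

import Mathlib

universe u v w

namespace LambdaFork

/-! ## Binding

All syntax is in de Bruijn style.  There are six independent index spaces, one for each
sort of variable: location variables, location-set variables, local-type variables,
program-type variables, local-program variables and choreography variables. -/

/-- The sorts of variables. -/
inductive BSort
  | loc | set | ty | prog | lv | pv
deriving DecidableEq

/-- A renaming acts on each index space separately. -/
abbrev Ren := BSort → ℕ → ℕ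

/-- Weakening by one fresh variable of sort `s`. -/
def Ren.shift (s : BSort) : Ren := fun s' i => if s' = s then i + 1 else i

/-- Close the gap left by a variable of sort `s` that goes out of scope. -/
def Ren.lower (s : BSort) : Ren := fun s' i => if s' = s then i - 1 else i

/-- Push a renaming under a binder of sort `s`. -/
def Ren.up (s : BSort) (r : Ren) : Ren := fun s' i =>
  if s' = s then (match i with
    | 0 => 0
    | j + 1 => r s' j + 1)
  else r s' i

/-- Put `a` at index `0` of the family `f`. -/
def cons {α : Type*} (a : α) (f : ℕ → α) : ℕ → α
  | 0 => a
  | i + 1 => f i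

/-- `cons a f` when the sorts agree, and `f` otherwise. -/
def consIf {α : Type*} (s s' : BSort) (a : α) (f : ℕ → α) : ℕ → α :=
  if s = s' then cons a f else f

/-! ## Locations and location sets -/

/-- Locations `ℓ`: location variables and concrete location names. -/
inductive Loc (L : Type u) : Type u
  | var (i : ℕ)
  | const (a : L)
deriving DecidableEq

/-- The components of a location set: `{ℓ}`, a location-set variable, or `⊤`. -/
inductive Atom (L : Type u) : Type u
  | loc (ℓ : Loc L)
  | var (i : ℕ)
  | top
deriving DecidableEq

/-- Location sets `ρ ::= ∅ | {ℓ} | α | ⊤ | ρ ∪ ρ`, up to associativity, commutativity,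
idempotence and unit of `∪`. -/
abbrev LocSet (L : Type u) := Finset (Atom L)

section LocSets

variable {L : Type u} [DecidableEq L]

def Loc.subst (f : ℕ → Loc L) : Loc L → Loc L
  | .var i => f i
  | .const a => .const a

def Loc.rename (r : Ren) : Loc L → Loc L := Loc.subst fun i => .var (r .loc i)

def Atom.subst (f : ℕ → Loc L) (g : ℕ → LocSet L) : Atom L → LocSet L
  | .loc ℓ => {.loc (ℓ.subst f)}
  | .var i => g i
  | .top => {.top}

namespace LocSet

/-- The singleton `{ℓ}`. -/
def single (ℓ : Loc L) : LocSet L := {.loc ℓ}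

/-- The set `⊤` of all locations. -/
def all : LocSet L := {.top}

/-- A concrete finite set of locations. -/
def ofFinset (s : Finset L) : LocSet L := s.image fun a => .loc (.const a)

def subst (f : ℕ → Loc L) (g : ℕ → LocSet L) (ρ : LocSet L) : LocSet L :=
  ρ.biUnion (Atom.subst f g)

def rename (r : Ren) : LocSet L → LocSet L :=
  subst (fun i => .var (r .loc i)) (fun i => {.var (r .set i)})

/-- `ρ ∖ α`, where `α` is variable `0` of sort `s`, seen outside the scope of `α`. -/
def drop (s : BSort) (ρ : LocSet L) : LocSet L :=
  match s with
  | .loc => rename (Ren.lower .loc) (ρ.erase (.loc (.var 0)))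
  | .set => rename (Ren.lower .set) (ρ.erase (.var 0))
  | _ => ρ

/-- `ℓ ∈ ρ` necessarily, that is, under every instantiation of the variables. -/
def Mem (ℓ : Loc L) (ρ : LocSet L) : Prop := Atom.loc ℓ ∈ ρ ∨ Atom.top ∈ ρ

/-- `ρ₁ ⊆ ρ₂` necessarily, that is, under every instantiation of the variables. -/
def Sub (ρ₁ ρ₂ : LocSet L) : Prop := Atom.top ∈ ρ₂ ∨ ρ₁ ⊆ ρ₂

instance (ρ₁ ρ₂ : LocSet L) : Decidable (Sub ρ₁ ρ₂) :=
  inferInstanceAs (Decidable (_ ∨ _))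

/-- `ρ₁ ∩ ρ₂ = ∅`. -/
def Disj (ρ₁ ρ₂ : LocSet L) : Prop := ∀ ℓ : Loc L, ¬ (Mem ℓ ρ₁ ∧ Mem ℓ ρ₂)

/-- The concrete locations named by a location set; in particular `NL ⊤ = ∅`. -/
def NL (ρ : LocSet L) : Set L := {a | Atom.loc (.const a) ∈ ρ}

/-- `ρ[⊤ ↦ Ω] ⊆ Ω`: the set `ρ` has no variables, and every location that it names is
in `Ω`. -/
def Live (Ω : Finset L) (ρ : LocSet L) : Prop :=
  ∀ x ∈ ρ, x = .top ∨ ∃ a ∈ Ω, x = .loc (.const a)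

end LocSet

end LocSets

/-! ## Kinds and the local language -/

/-- The two kinds of location sets: all of them (`*_locset`), and the finite ones, which do
not involve `⊤` (`*_finlocset`). -/
inductive SetKind
  | any | fin
deriving DecidableEq

/-- The part of a kinding context that is visible to the local language: how many location
and local-type variables are in scope, and the location-set variables with their kinds. -/
structure LCtx where
  loc : ℕ
  set : List SetKind
  ty : ℕ

def LCtx.empty : LCtx := ⟨0, [], 0⟩

/-- A well-kinded location. -/
def LocOk {L : Type u} (Γ : LCtx) : Loc L → Prop
  | .var i => i < Γ.loc
  | .const _ => True

/-- A well-kinded location set of kind `k`. -/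
def SetOk {L : Type u} (Γ : LCtx) (k : SetKind) (ρ : LocSet L) : Prop :=
  ∀ x ∈ ρ, match x with
    | .loc ℓ => LocOk Γ ℓ
    | .var i => Γ.set[i]? = some .fin ∨ (k = .any ∧ Γ.set[i]? = some .any)
    | .top => k = .any

/-- Simultaneous substitutions for location, location-set and local-type variables. -/
structure LSub (L : Type u) (Ty : Type v) where
  loc : ℕ → Loc L
  set : ℕ → LocSet L
  ty : ℕ → Ty

namespace LSub

variable {L : Type u} {Ty : Type v}

/-- The renaming `r` as a substitution. -/
def ofRen (tvar : ℕ → Ty) (r : Ren) : LSub L Ty where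
  loc i := .var (r .loc i)
  set i := {.var (r .set i)}
  ty i := tvar (r .ty i)

/-- The substitution that first performs `σ₁` and then `σ₂`. -/
def comp [DecidableEq L] (tySubst : LSub L Ty → Ty → Ty) (σ₁ σ₂ : LSub L Ty) :
    LSub L Ty where
  loc i := (σ₁.loc i).subst σ₂.loc
  set i := (σ₁.set i).subst σ₂.loc σ₂.set
  ty i := tySubst σ₂ (σ₁.ty i)

/-- `σ` maps the variables of `Γ` to well-kinded objects over `Γ'`. -/
structure Ok (WfTy : LCtx → Ty → Prop) (Γ Γ' : LCtx) (σ : LSub L Ty) : Prop where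
  loc : ∀ i < Γ.loc, LocOk Γ' (σ.loc i)
  set : ∀ i k, Γ.set[i]? = some k → SetOk Γ' k (σ.set i)
  ty : ∀ i < Γ.ty, WfTy Γ' (σ.ty i)

end LSub

/-- A local language over the location names `L`: types and expressions with substitution,
values and a small-step semantics, a kinding and a typing judgement, types that can be read
as sums, and first-class representations of locations and of location sets. -/
structure LocalLang (L : Type u) [DecidableEq L] where
  -- types
  Ty : Type v
  tvar : ℕ → Ty
  tySubst : LSub L Ty → Ty → Ty
  tySubst_tvar : ∀ σ i, tySubst σ (tvar i) = σ.ty i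
  tySubst_id : ∀ t, tySubst (LSub.ofRen tvar fun _ i => i) t = t
  tySubst_comp : ∀ σ₁ σ₂ t,
    tySubst σ₂ (tySubst σ₁ t) = tySubst (LSub.comp tySubst σ₁ σ₂) t
  -- expressions
  Exp : Type w
  evar : ℕ → Exp
  expSubst : LSub L Ty → (ℕ → Exp) → Exp → Exp
  expSubst_evar : ∀ σ θ i, expSubst σ θ (evar i) = θ i
  expSubst_id : ∀ e, expSubst (LSub.ofRen tvar fun _ i => i) evar e = e
  expSubst_comp : ∀ σ₁ σ₂ θ₁ θ₂ e, expSubst σ₂ θ₂ (expSubst σ₁ θ₁ e) =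
    expSubst (LSub.comp tySubst σ₁ σ₂) (fun i => expSubst σ₂ θ₂ (θ₁ i)) e
  -- values and steps
  Val : Exp → Prop
  Step : Exp → Exp → Prop
  val_not_step : ∀ e e', Val e → ¬ Step e e'
  confluent : ∀ e₁ e₂ e₃, Relation.ReflTransGen Step e₁ e₂ → Relation.ReflTransGen Step e₁ e₃ →
    ∃ e₄, Relation.ReflTransGen Step e₂ e₄ ∧ Relation.ReflTransGen Step e₃ e₄
  -- values stay values when variables are replaced by values or variables
  val_subst : ∀ e σ θ, Val e → (∀ i, Val (θ i) ∨ ∃ j, θ i = evar j) → Val (expSubst σ θ e)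
  -- well-formed types
  WfTy : LCtx → Ty → Prop
  wfTy_tvar : ∀ Γ i, i < Γ.ty → WfTy Γ (tvar i)
  wfTy_subst : ∀ Γ Γ' σ t, LSub.Ok WfTy Γ Γ' σ → WfTy Γ t → WfTy Γ' (tySubst σ t)
  -- typing
  Typed : LCtx → (ℕ → Option Ty) → Exp → Ty → Prop
  typed_evar : ∀ Γ Δ i t, Δ i = some t → Typed Γ Δ (evar i) t
  typed_subst : ∀ Γ Γ' Δ Δ' σ θ e t, LSub.Ok WfTy Γ Γ' σ →
    (∀ i s, Δ i = some s → Typed Γ' Δ' (θ i) (tySubst σ s)) →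
    Typed Γ Δ e t → Typed Γ' Δ' (expSubst σ θ e) (tySubst σ t)
  preservation : ∀ Γ Δ e e' t, Typed Γ Δ e t → Step e e' → Typed Γ Δ e' t
  progress : ∀ e t, Typed LCtx.empty (fun _ => none) e t → Val e ∨ ∃ e', Step e e'
  -- sums: `IsSum s t₁ t₂` says that values of type `s` can be read as a `t₁` or a `t₂`
  IsSum : Ty → Ty → Ty → Prop
  isSum_subst : ∀ σ s t₁ t₂, IsSum s t₁ t₂ →
    IsSum (tySubst σ s) (tySubst σ t₁) (tySubst σ t₂)
  getCase : Exp → Option (Exp ⊕ Exp)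
  getCase_total : ∀ v s t₁ t₂, IsSum s t₁ t₂ → Val v →
    Typed LCtx.empty (fun _ => none) v s → ∃ c, getCase v = some c
  getCase_inl : ∀ Γ Δ v v₁ s t₁ t₂, IsSum s t₁ t₂ → Val v → Typed Γ Δ v s →
    getCase v = some (.inl v₁) → Val v₁ ∧ Typed Γ Δ v₁ t₁
  getCase_inr : ∀ Γ Δ v v₂ s t₁ t₂, IsSum s t₁ t₂ → Val v → Typed Γ Δ v s →
    getCase v = some (.inr v₂) → Val v₂ ∧ Typed Γ Δ v₂ t₂
  -- representations of locations: `RepLoc v a` says that `v` represents `a`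
  locTy : LocSet L → Ty
  wfTy_locTy : ∀ Γ ρ, SetOk Γ .any ρ → WfTy Γ (locTy ρ)
  locTy_subst : ∀ σ ρ, tySubst σ (locTy ρ) = locTy (ρ.subst σ.loc σ.set)
  RepLoc : Exp → L → Prop
  repLoc_unique : ∀ v a b, RepLoc v a → RepLoc v b → a = b
  repLoc_exists : ∀ a, ∃ v, RepLoc v a
  repLoc_val : ∀ v a, RepLoc v a → Val v
  repLoc_typed : ∀ v a, RepLoc v a →
    Typed LCtx.empty (fun _ => none) v (locTy (LocSet.single (.const a)))
  repLoc_total : ∀ v ρ, Val v → Typed LCtx.empty (fun _ => none) v (locTy ρ) →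
    ∃ a, RepLoc v a
  repLoc_sound : ∀ Γ Δ v a ρ, Typed Γ Δ v (locTy ρ) → RepLoc v a → LocSet.Mem (.const a) ρ
  -- representations of location sets
  locsetTy : LocSet L → Ty
  wfTy_locsetTy : ∀ Γ ρ, SetOk Γ .any ρ → WfTy Γ (locsetTy ρ)
  locsetTy_subst : ∀ σ ρ, tySubst σ (locsetTy ρ) = locsetTy (ρ.subst σ.loc σ.set)
  RepSet : Exp → Finset L → Prop
  repSet_unique : ∀ v s s', RepSet v s → RepSet v s' → s = s'
  repSet_total : ∀ v ρ, Val v → Typed LCtx.empty (fun _ => none) v (locsetTy ρ) →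
    ∃ s, RepSet v s
  repSet_sound : ∀ Γ Δ v s ρ, Typed Γ Δ v (locsetTy ρ) → RepSet v s →
    ∀ a ∈ s, LocSet.Mem (.const a) ρ

section Language

variable {L : Type u} [DecidableEq L]

def LocalLang.tyRename (M : LocalLang.{u, v, w} L) (r : Ren) : M.Ty → M.Ty :=
  M.tySubst (LSub.ofRen M.tvar r)

def LocalLang.expRename (M : LocalLang.{u, v, w} L) (r : Ren) : M.Exp → M.Exp :=
  M.expSubst (LSub.ofRen M.tvar r) fun i => M.evar (r .lv i)

/-- Kinds: locations, location sets, local types `*_e`, and program types `*_ρ` that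
involve (at most) the locations `ρ`. -/
inductive Kind (L : Type u) : Type u
  | loc
  | set (k : SetKind)
  | lty
  | prog (ρ : LocSet L)

namespace Kind

/-- The sort of the variables of a kind. -/
def sort : Kind L → BSort
  | .loc => .loc
  | .set _ => .set
  | .lty => .ty
  | .prog _ => .prog

def subst (f : ℕ → Loc L) (g : ℕ → LocSet L) : Kind L → Kind L
  | .prog ρ => .prog (ρ.subst f g)
  | .loc => .loc
  | .set k => .set k
  | .lty => .lty

def rename (r : Ren) : Kind L → Kind L :=
  subst (fun i => .var (r .loc i)) (fun i => {.var (r .set i)})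

end Kind

/-! ## Program types -/

/-- Program types. -/
inductive CTy (M : LocalLang.{u, v, w} L) : Type (max u v)
  /-- a program-type variable -/
  | var (i : ℕ)
  /-- `t @ ρ` -/
  | located (t : M.Ty) (ρ : LocSet L)
  /-- `τ₁ →[ρ] τ₂`, where `ρ` are the participants of the body -/
  | arrow (τ₁ : CTy M) (ρ : LocSet L) (τ₂ : CTy M)
  | prod (τ₁ τ₂ : CTy M)
  /-- `τ₁ +_ρ τ₂` -/
  | sum (ρ : LocSet L) (τ₁ τ₂ : CTy M)
  /-- `μ α :: *_ρ. τ`; the variable is bound in `τ` -/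
  | mu (ρ : LocSet L) (τ : CTy M)
  /-- `∀ α :: κ [ρ]. τ`; the variable is bound in `ρ` and in `τ` -/
  | all (κ : Kind L) (ρ : LocSet L) (τ : CTy M)

variable {M : LocalLang.{u, v, w} L}

def CTy.rename : Ren → CTy M → CTy M
  | r, .var i => .var (r .prog i)
  | r, .located t ρ => .located (M.tyRename r t) (ρ.rename r)
  | r, .arrow τ₁ ρ τ₂ => .arrow (τ₁.rename r) (ρ.rename r) (τ₂.rename r)
  | r, .prod τ₁ τ₂ => .prod (τ₁.rename r) (τ₂.rename r)
  | r, .sum ρ τ₁ τ₂ => .sum (ρ.rename r) (τ₁.rename r) (τ₂.rename r)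
  | r, .mu ρ τ => .mu (ρ.rename r) (τ.rename (Ren.up .prog r))
  | r, .all κ ρ τ =>
    .all (κ.rename r) (ρ.rename (Ren.up κ.sort r)) (τ.rename (Ren.up κ.sort r))

/-- Simultaneous substitutions for all four sorts of type-level variables. -/
structure TSub (M : LocalLang.{u, v, w} L) extends LSub L M.Ty where
  prog : ℕ → CTy M

namespace TSub

def id : TSub M := { LSub.ofRen M.tvar (fun _ i => i) with prog := CTy.var }

/-- Push a substitution under a binder of sort `s`. -/
def up (s : BSort) (σ : TSub M) : TSub M where
  loc := consIf s .loc (.var 0) fun i => (σ.loc i).rename (Ren.shift s)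
  set := consIf s .set {.var 0} fun i => (σ.set i).rename (Ren.shift s)
  ty := consIf s .ty (M.tvar 0) fun i => M.tyRename (Ren.shift s) (σ.ty i)
  prog := consIf s .prog (.var 0) fun i => (σ.prog i).rename (Ren.shift s)

end TSub

def CTy.subst : TSub M → CTy M → CTy M
  | σ, .var i => σ.prog i
  | σ, .located t ρ => .located (M.tySubst σ.toLSub t) (ρ.subst σ.loc σ.set)
  | σ, .arrow τ₁ ρ τ₂ => .arrow (τ₁.subst σ) (ρ.subst σ.loc σ.set) (τ₂.subst σ)
  | σ, .prod τ₁ τ₂ => .prod (τ₁.subst σ) (τ₂.subst σ)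
  | σ, .sum ρ τ₁ τ₂ => .sum (ρ.subst σ.loc σ.set) (τ₁.subst σ) (τ₂.subst σ)
  | σ, .mu ρ τ => .mu (ρ.subst σ.loc σ.set) (τ.subst (σ.up .prog))
  | σ, .all κ ρ τ => .all (κ.subst σ.loc σ.set)
      (ρ.subst (σ.up κ.sort).loc (σ.up κ.sort).set) (τ.subst (σ.up κ.sort))

/-- Type-level arguments: locations, location sets, local types and program types. -/
inductive TArg (M : LocalLang.{u, v, w} L) : Type (max u v)
  | loc (ℓ : Loc L)
  | set (ρ : LocSet L)
  | ty (t : M.Ty)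
  | prog (τ : CTy M)

namespace TArg

def subst (σ : TSub M) : TArg M → TArg M
  | .loc ℓ => .loc (ℓ.subst σ.loc)
  | .set ρ => .set (ρ.subst σ.loc σ.set)
  | .ty t => .ty (M.tySubst σ.toLSub t)
  | .prog τ => .prog (τ.subst σ)

def rename (r : Ren) : TArg M → TArg M
  | .loc ℓ => .loc (ℓ.rename r)
  | .set ρ => .set (ρ.rename r)
  | .ty t => .ty (M.tyRename r t)
  | .prog τ => .prog (τ.rename r)

/-- The substitution that replaces variable `0` of the sort of `a` by `a`. -/
def inst : TArg M → TSub M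
  | .loc ℓ => { (TSub.id : TSub M) with loc := cons ℓ Loc.var }
  | .set ρ => { (TSub.id : TSub M) with set := cons ρ fun i => {.var i} }
  | .ty t => { (TSub.id : TSub M) with ty := cons t M.tvar }
  | .prog τ => { (TSub.id : TSub M) with prog := cons τ CTy.var }

end TArg

/-! ## Kinding -/

/-- Kinding contexts. A program-type variable `α :: *_ρ` is recorded by its `ρ`. -/
structure KCtx (L : Type u) extends LCtx where
  prog : List (LocSet L)

namespace KCtx

/-- Bring a type-level variable of kind `κ` into scope. -/
def bind (κ : Kind L) (Γ : KCtx L) : KCtx L :=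
  let pr := Γ.prog.map (LocSet.rename (Ren.shift κ.sort))
  match κ with
  | .loc => { Γ with loc := Γ.loc + 1, prog := pr }
  | .set k => { Γ with set := k :: Γ.set, prog := pr }
  | .lty => { Γ with ty := Γ.ty + 1, prog := pr }
  | .prog ρ => { Γ with prog := ρ :: pr }

end KCtx

/-- Well-formed kinds. -/
def KindOk (Γ : KCtx L) : Kind L → Prop
  | .prog ρ => SetOk Γ.toLCtx .any ρ
  | _ => True

/-- `Kinded Γ τ ρ` is the judgement `Γ ⊢ τ :: *_ρ`; it determines `ρ` from `Γ` and `τ`. -/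
inductive Kinded : KCtx L → CTy M → LocSet L → Prop
  | var {Γ : KCtx L} {i : ℕ} {ρ : LocSet L} (h : Γ.prog[i]? = some ρ) : Kinded Γ (.var i) ρ
  | located {Γ : KCtx L} {t : M.Ty} {ρ : LocSet L} (ht : M.WfTy Γ.toLCtx t)
      (hρ : SetOk Γ.toLCtx .any ρ) : Kinded Γ (.located t ρ) ρ
  | arrow {Γ : KCtx L} {τ₁ τ₂ : CTy M} {ρ₁ ρ₂ ρ : LocSet L} (h₁ : Kinded Γ τ₁ ρ₁)
      (h₂ : Kinded Γ τ₂ ρ₂) (hρ : SetOk Γ.toLCtx .any ρ) :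
      Kinded Γ (.arrow τ₁ ρ τ₂) (ρ₁ ∪ ρ₂ ∪ ρ)
  | prod {Γ : KCtx L} {τ₁ τ₂ : CTy M} {ρ₁ ρ₂ : LocSet L} (h₁ : Kinded Γ τ₁ ρ₁)
      (h₂ : Kinded Γ τ₂ ρ₂) : Kinded Γ (.prod τ₁ τ₂) (ρ₁ ∪ ρ₂)
  | sum {Γ : KCtx L} {τ₁ τ₂ : CTy M} {ρ₁ ρ₂ ρ : LocSet L} (h₁ : Kinded Γ τ₁ ρ₁)
      (h₂ : Kinded Γ τ₂ ρ₂) (hρ : SetOk Γ.toLCtx .any ρ) (hs : LocSet.Sub (ρ₁ ∪ ρ₂) ρ) :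
      Kinded Γ (.sum ρ τ₁ τ₂) ρ
  | mu {Γ : KCtx L} {τ : CTy M} {ρ ρ' : LocSet L} (hρ : SetOk Γ.toLCtx .any ρ)
      (h : Kinded (Γ.bind (.prog ρ)) τ ρ') (hs : LocSet.Sub ρ' ρ) : Kinded Γ (.mu ρ τ) ρ
  | allLoc {Γ : KCtx L} {κ : Kind L} {τ : CTy M} {ρ ρ' : LocSet L}
      (hκ : κ.sort = .loc ∨ κ.sort = .set) (h : Kinded (Γ.bind κ) τ ρ')
      (hρ : SetOk (Γ.bind κ).toLCtx .any ρ) : Kinded Γ (.all κ ρ τ) LocSet.all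
  | all {Γ : KCtx L} {κ : Kind L} {τ : CTy M} {ρ ρ' : LocSet L} (hκ : KindOk Γ κ)
      (hs : κ.sort = .ty ∨ κ.sort = .prog) (h : Kinded (Γ.bind κ) τ ρ')
      (hρ : SetOk (Γ.bind κ).toLCtx .any ρ) : Kinded Γ (.all κ ρ τ) (ρ ∪ ρ')

/-- `Γ ⊢ a :: κ` for a type-level argument `a`. -/
inductive TArgOk (Γ : KCtx L) : TArg M → Kind L → Prop
  | loc {ℓ : Loc L} (h : LocOk Γ.toLCtx ℓ) : TArgOk Γ (.loc ℓ) .loc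
  | set {k : SetKind} {ρ : LocSet L} (h : SetOk Γ.toLCtx k ρ) : TArgOk Γ (.set ρ) (.set k)
  | ty {t : M.Ty} (h : M.WfTy Γ.toLCtx t) : TArgOk Γ (.ty t) .lty
  | prog {τ : CTy M} {ρ : LocSet L} (h : Kinded Γ τ ρ) : TArgOk Γ (.prog τ) (.prog ρ)

/-! ## Choreographies -/

/-- Choreographies. -/
inductive Chor (M : LocalLang.{u, v, w} L) : Type (max u v w)
  /-- a choreography variable -/
  | var (i : ℕ)
  /-- `ρ.e` -/
  | done (ρ : LocSet L) (e : M.Exp)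
  /-- `fun_ρ F(X) := C`; in `C`, variable `0` is `X` and variable `1` is `F` -/
  | func (ρ : LocSet L) (C : Chor M)
  /-- `C₁ @_ρ C₂` -/
  | app (ρ : LocSet L) (C₁ C₂ : Chor M)
  /-- `tfun F(α :: κ) := C`, binding the choreography variable `F` and `α` -/
  | tfun (κ : Kind L) (C : Chor M)
  /-- `C @_ρ a` -/
  | tapp (ρ : LocSet L) (C : Chor M) (a : TArg M)
  | fold (ρ : LocSet L) (C : Chor M)
  | unfold (ρ : LocSet L) (C : Chor M)
  | pair (ρ : LocSet L) (C₁ C₂ : Chor M)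
  | fst (ρ : LocSet L) (C : Chor M)
  | snd (ρ : LocSet L) (C : Chor M)
  | inl (ρ : LocSet L) (C : Chor M)
  | inr (ρ : LocSet L) (C : Chor M)
  /-- `case_ρ C of inl X ⇒ C₁ | inr Y ⇒ C₂` -/
  | case (ρ : LocSet L) (C C₁ C₂ : Chor M)
  /-- `localcase_ρ C of inl x ⇒ C₁ | inr y ⇒ C₂`, where `x` and `y` are local variables -/
  | localCase (ρ : LocSet L) (C C₁ C₂ : Chor M)
  /-- `let ρ.x : t := C₁ in C₂` -/
  | letIn (ρ : LocSet L) (t : M.Ty) (C₁ C₂ : Chor M)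
  /-- `let ρ.α :: *_loc := C₁ in C₂` -/
  | letLoc (ρ : LocSet L) (C₁ C₂ : Chor M)
  /-- `let ρ.α :: κ := C₁ in C₂` for a kind `κ` of location sets -/
  | letSet (ρ : LocSet L) (k : SetKind) (C₁ C₂ : Chor M)
  /-- `C ⇝[ℓ] ρ` -/
  | send (C : Chor M) (ℓ : Loc L) (ρ : LocSet L)
  /-- `ℓ[d] ⇝ ρ ; C` -/
  | sync (ℓ : Loc L) (d : Bool) (ρ : LocSet L) (C : Chor M)
  /-- `fork (α, x) at ℓ in C`, binding a location variable and a local variable -/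
  | fork (ℓ : Loc L) (C : Chor M)
  /-- `kill-after L do C` -/
  | killAfter (a : L) (C : Chor M)

namespace Chor

def rename : Ren → Chor M → Chor M
  | r, .var i => .var (r .pv i)
  | r, .done ρ e => .done (ρ.rename r) (M.expRename r e)
  | r, .func ρ C => .func (ρ.rename r) (C.rename (Ren.up .pv (Ren.up .pv r)))
  | r, .app ρ C₁ C₂ => .app (ρ.rename r) (C₁.rename r) (C₂.rename r)
  | r, .tfun κ C => .tfun (κ.rename r) (C.rename (Ren.up κ.sort (Ren.up .pv r)))
  | r, .tapp ρ C a => .tapp (ρ.rename r) (C.rename r) (a.rename r)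
  | r, .fold ρ C => .fold (ρ.rename r) (C.rename r)
  | r, .unfold ρ C => .unfold (ρ.rename r) (C.rename r)
  | r, .pair ρ C₁ C₂ => .pair (ρ.rename r) (C₁.rename r) (C₂.rename r)
  | r, .fst ρ C => .fst (ρ.rename r) (C.rename r)
  | r, .snd ρ C => .snd (ρ.rename r) (C.rename r)
  | r, .inl ρ C => .inl (ρ.rename r) (C.rename r)
  | r, .inr ρ C => .inr (ρ.rename r) (C.rename r)
  | r, .case ρ C C₁ C₂ => .case (ρ.rename r) (C.rename r) (C₁.rename (Ren.up .pv r))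
      (C₂.rename (Ren.up .pv r))
  | r, .localCase ρ C C₁ C₂ => .localCase (ρ.rename r) (C.rename r)
      (C₁.rename (Ren.up .lv r)) (C₂.rename (Ren.up .lv r))
  | r, .letIn ρ t C₁ C₂ => .letIn (ρ.rename r) (M.tyRename r t) (C₁.rename r)
      (C₂.rename (Ren.up .lv r))
  | r, .letLoc ρ C₁ C₂ => .letLoc (ρ.rename r) (C₁.rename r) (C₂.rename (Ren.up .loc r))
  | r, .letSet ρ k C₁ C₂ => .letSet (ρ.rename r) k (C₁.rename r)
      (C₂.rename (Ren.up .set r))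
  | r, .send C ℓ ρ => .send (C.rename r) (ℓ.rename r) (ρ.rename r)
  | r, .sync ℓ d ρ C => .sync (ℓ.rename r) d (ρ.rename r) (C.rename r)
  | r, .fork ℓ C => .fork (ℓ.rename r) (C.rename (Ren.up .loc (Ren.up .lv r)))
  | r, .killAfter a C => .killAfter a (C.rename r)

end Chor

/-- Simultaneous substitutions for all variables. -/
structure Sub (M : LocalLang.{u, v, w} L) extends TSub M where
  lv : ℕ → M.Exp
  pv : ℕ → Chor M

namespace Sub

def id : Sub M := { (TSub.id : TSub M) with lv := M.evar, pv := Chor.var }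

/-- Push a substitution under a binder of sort `s`. -/
def up (s : BSort) (σ : Sub M) : Sub M where
  toTSub := σ.toTSub.up s
  lv := consIf s .lv (M.evar 0) fun i => M.expRename (Ren.shift s) (σ.lv i)
  pv := consIf s .pv (.var 0) fun i => (σ.pv i).rename (Ren.shift s)

/-- Replace the local variable `0` by `e`. -/
def local₁ (e : M.Exp) : Sub M := { (Sub.id : Sub M) with lv := cons e M.evar }

/-- Replace the choreography variable `0` by `C`. -/
def chor₁ (C : Chor M) : Sub M := { (Sub.id : Sub M) with pv := cons C Chor.var }

/-- Replace the choreography variables `0` and `1` by `C₀` and `C₁`. -/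
def chor₂ (C₀ C₁ : Chor M) : Sub M :=
  { (Sub.id : Sub M) with pv := cons C₀ (cons C₁ Chor.var) }

/-- Replace the type-level variable `0` of the sort of `a` by `a`. -/
def tinst (a : TArg M) : Sub M := { (Sub.id : Sub M) with toTSub := a.inst }

end Sub

namespace Chor

def subst : Sub M → Chor M → Chor M
  | σ, .var i => σ.pv i
  | σ, .done ρ e => .done (ρ.subst σ.loc σ.set) (M.expSubst σ.toLSub σ.lv e)
  | σ, .func ρ C => .func (ρ.subst σ.loc σ.set) (C.subst ((σ.up .pv).up .pv))
  | σ, .app ρ C₁ C₂ => .app (ρ.subst σ.loc σ.set) (C₁.subst σ) (C₂.subst σ)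
  | σ, .tfun κ C => .tfun (κ.subst σ.loc σ.set) (C.subst ((σ.up .pv).up κ.sort))
  | σ, .tapp ρ C a => .tapp (ρ.subst σ.loc σ.set) (C.subst σ) (a.subst σ.toTSub)
  | σ, .fold ρ C => .fold (ρ.subst σ.loc σ.set) (C.subst σ)
  | σ, .unfold ρ C => .unfold (ρ.subst σ.loc σ.set) (C.subst σ)
  | σ, .pair ρ C₁ C₂ => .pair (ρ.subst σ.loc σ.set) (C₁.subst σ) (C₂.subst σ)
  | σ, .fst ρ C => .fst (ρ.subst σ.loc σ.set) (C.subst σ)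
  | σ, .snd ρ C => .snd (ρ.subst σ.loc σ.set) (C.subst σ)
  | σ, .inl ρ C => .inl (ρ.subst σ.loc σ.set) (C.subst σ)
  | σ, .inr ρ C => .inr (ρ.subst σ.loc σ.set) (C.subst σ)
  | σ, .case ρ C C₁ C₂ => .case (ρ.subst σ.loc σ.set) (C.subst σ) (C₁.subst (σ.up .pv))
      (C₂.subst (σ.up .pv))
  | σ, .localCase ρ C C₁ C₂ => .localCase (ρ.subst σ.loc σ.set) (C.subst σ)
      (C₁.subst (σ.up .lv)) (C₂.subst (σ.up .lv))
  | σ, .letIn ρ t C₁ C₂ => .letIn (ρ.subst σ.loc σ.set) (M.tySubst σ.toLSub t)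
      (C₁.subst σ) (C₂.subst (σ.up .lv))
  | σ, .letLoc ρ C₁ C₂ => .letLoc (ρ.subst σ.loc σ.set) (C₁.subst σ)
      (C₂.subst (σ.up .loc))
  | σ, .letSet ρ k C₁ C₂ => .letSet (ρ.subst σ.loc σ.set) k (C₁.subst σ)
      (C₂.subst (σ.up .set))
  | σ, .send C ℓ ρ => .send (C.subst σ) (ℓ.subst σ.loc) (ρ.subst σ.loc σ.set)
  | σ, .sync ℓ d ρ C => .sync (ℓ.subst σ.loc) d (ρ.subst σ.loc σ.set) (C.subst σ)
  | σ, .fork ℓ C => .fork (ℓ.subst σ.loc) (C.subst ((σ.up .lv).up .loc))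
  | σ, .killAfter a C => .killAfter a (C.subst σ)

/-- The substitution `C[α ↦ a, x ↦ v]` in the body of a `fork`. -/
def substFork (a : L) (v : M.Exp) (C : Chor M) : Chor M :=
  C.subst { (Sub.id : Sub M) with
    toTSub := (TArg.loc (.const a)).inst, lv := cons v M.evar }

/-- Choreography values. -/
inductive Value : Chor M → Prop
  | done {ρ : LocSet L} {e : M.Exp} (h : M.Val e) : Value (.done ρ e)
  | func {ρ : LocSet L} {C : Chor M} : Value (.func ρ C)
  | tfun {κ : Kind L} {C : Chor M} : Value (.tfun κ C)
  | pair {ρ : LocSet L} {C₁ C₂ : Chor M} (h₁ : Value C₁) (h₂ : Value C₂) :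
      Value (.pair ρ C₁ C₂)
  | inl {ρ : LocSet L} {C : Chor M} (h : Value C) : Value (.inl ρ C)
  | inr {ρ : LocSet L} {C : Chor M} (h : Value C) : Value (.inr ρ C)
  | fold {ρ : LocSet L} {C : Chor M} (h : Value C) : Value (.fold ρ C)

/-- The blocked locations of a choreography. -/
def cloc : Chor M → LocSet L
  | .var _ => ∅
  | .done ρ _ => ρ
  | .func _ _ => ∅
  | .app ρ C₁ C₂ => C₁.cloc ∪ C₂.cloc ∪ ρ
  | .tfun _ _ => ∅
  | .tapp ρ C _ => C.cloc ∪ ρ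
  | .fold _ C => C.cloc
  | .unfold ρ C => C.cloc ∪ ρ
  | .pair _ C₁ C₂ => C₁.cloc ∪ C₂.cloc
  | .fst ρ C => C.cloc ∪ ρ
  | .snd ρ C => C.cloc ∪ ρ
  | .inl _ C => C.cloc
  | .inr _ C => C.cloc
  | .case ρ C C₁ C₂ => C.cloc ∪ C₁.cloc ∪ C₂.cloc ∪ ρ
  | .localCase ρ C C₁ C₂ => C.cloc ∪ C₁.cloc ∪ C₂.cloc ∪ ρ
  | .letIn ρ _ C₁ C₂ => C₁.cloc ∪ C₂.cloc ∪ ρ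
  | .letLoc ρ C₁ C₂ => C₁.cloc ∪ C₂.cloc.drop .loc ∪ ρ
  | .letSet ρ _ C₁ C₂ => C₁.cloc ∪ C₂.cloc.drop .set ∪ ρ
  | .send C ℓ ρ => C.cloc ∪ LocSet.single ℓ ∪ ρ
  | .sync ℓ _ ρ C => LocSet.single ℓ ∪ ρ ∪ C.cloc
  | .fork ℓ C => LocSet.single ℓ ∪ C.cloc.drop .loc
  | .killAfter a C => LocSet.single (.const a) ∪ C.cloc

end Chor

/-! ## The type system of the surface language -/

/-- Typing contexts: type-level variables, local variables `ρ.x : t`, and choreography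
variables `X : τ`. -/
structure Ctx (M : LocalLang.{u, v, w} L) where
  kinds : KCtx L
  lv : List (LocSet L × M.Ty)
  pv : List (CTy M)

namespace Ctx

def empty : Ctx M := ⟨⟨LCtx.empty, []⟩, [], []⟩

/-- Add a type-level variable of kind `κ`. -/
def bindTy (κ : Kind L) (Γ : Ctx M) : Ctx M where
  kinds := Γ.kinds.bind κ
  lv := Γ.lv.map fun p => (p.1.rename (Ren.shift κ.sort), M.tyRename (Ren.shift κ.sort) p.2)
  pv := Γ.pv.map (CTy.rename (Ren.shift κ.sort))

/-- Add a local variable `ρ.x : t`. -/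
def bindLv (ρ : LocSet L) (t : M.Ty) (Γ : Ctx M) : Ctx M := { Γ with lv := (ρ, t) :: Γ.lv }

/-- Add a choreography variable `X : τ`. -/
def bindPv (τ : CTy M) (Γ : Ctx M) : Ctx M := { Γ with pv := τ :: Γ.pv }

/-- The local variables that are available to all of `ρ`. -/
def proj (Γ : Ctx M) (ρ : LocSet L) (i : ℕ) : Option M.Ty :=
  match Γ.lv[i]? with
  | some (ρ', t) => if LocSet.Sub ρ ρ' then some t else none
  | none => none

/-- The part of the context that the local language sees. -/
abbrev lctx (Γ : Ctx M) : LCtx := Γ.kinds.toLCtx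

end Ctx

/-- `HasType Γ C τ ρ` is the judgement `Γ ⊢ C : τ ▷ ρ`: the choreography `C` has type `τ`,
and `ρ` are its participants. -/
inductive HasType : Ctx M → Chor M → CTy M → LocSet L → Prop
  | var {Γ : Ctx M} {i : ℕ} {τ : CTy M} (h : Γ.pv[i]? = some τ) : HasType Γ (.var i) τ ∅
  | doneVal {Γ : Ctx M} {ρ : LocSet L} {e : M.Exp} {t : M.Ty} (hρ : SetOk Γ.lctx .any ρ)
      (h : M.Typed Γ.lctx (Γ.proj ρ) e t) (hv : M.Val e) :
      HasType Γ (.done ρ e) (.located t ρ) ∅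
  | done {Γ : Ctx M} {ρ : LocSet L} {e : M.Exp} {t : M.Ty} (hρ : SetOk Γ.lctx .any ρ)
      (h : M.Typed Γ.lctx (Γ.proj ρ) e t) (hv : ¬ M.Val e) :
      HasType Γ (.done ρ e) (.located t ρ) ρ
  | func {Γ : Ctx M} {C : Chor M} {τ₁ τ₂ : CTy M} {ρ₁ ρ₂ ρ : LocSet L}
      (h₁ : Kinded Γ.kinds τ₁ ρ₁) (h₂ : Kinded Γ.kinds τ₂ ρ₂) (hρ : SetOk Γ.lctx .any ρ)
      (h : HasType ((Γ.bindPv (.arrow τ₁ ρ τ₂)).bindPv τ₁) C τ₂ ρ) :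
      HasType Γ (.func (ρ₁ ∪ ρ₂ ∪ ρ) C) (.arrow τ₁ ρ τ₂) ∅
  | app {Γ : Ctx M} {C₁ C₂ : Chor M} {τ₁ τ₂ : CTy M} {ρ ρ₁ ρ₂ ρt₁ ρt₂ : LocSet L}
      (h₁ : HasType Γ C₁ (.arrow τ₁ ρ τ₂) ρ₁) (h₂ : HasType Γ C₂ τ₁ ρ₂)
      (ht₁ : Kinded Γ.kinds τ₁ ρt₁) (ht₂ : Kinded Γ.kinds τ₂ ρt₂) :
      HasType Γ (.app (ρt₁ ∪ ρt₂ ∪ ρ) C₁ C₂) τ₂ (ρ₁ ∪ ρ₂ ∪ (ρt₁ ∪ ρt₂ ∪ ρ))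
  | tfun {Γ : Ctx M} {κ : Kind L} {C : Chor M} {τ : CTy M} {ρ ρt : LocSet L}
      (ht : Kinded Γ.kinds (.all κ ρ τ) ρt)
      (h : HasType ((Γ.bindPv (.all κ ρ τ)).bindTy κ) C τ ρ) :
      HasType Γ (.tfun κ C) (.all κ ρ τ) ∅
  | tapp {Γ : Ctx M} {κ : Kind L} {C : Chor M} {a : TArg M} {τ : CTy M}
      {ρ ρ₁ ρt : LocSet L} (h : HasType Γ C (.all κ ρ τ) ρ₁) (ha : TArgOk Γ.kinds a κ)
      (ht : Kinded Γ.kinds (τ.subst a.inst) ρt) :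
      HasType Γ (.tapp (ρt ∪ ρ.subst a.inst.loc a.inst.set) C a) (τ.subst a.inst)
        (ρ₁ ∪ (ρt ∪ ρ.subst a.inst.loc a.inst.set))
  | fold {Γ : Ctx M} {C : Chor M} {τ : CTy M} {ρ ρ₀ : LocSet L}
      (ht : Kinded Γ.kinds (.mu ρ τ) ρ)
      (h : HasType Γ C (τ.subst (TArg.prog (.mu ρ τ)).inst) ρ₀) :
      HasType Γ (.fold ρ C) (.mu ρ τ) ρ₀
  | unfold {Γ : Ctx M} {C : Chor M} {τ : CTy M} {ρ ρ₀ : LocSet L}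
      (ht : Kinded Γ.kinds (.mu ρ τ) ρ) (h : HasType Γ C (.mu ρ τ) ρ₀) :
      HasType Γ (.unfold ρ C) (τ.subst (TArg.prog (.mu ρ τ)).inst) (ρ₀ ∪ ρ)
  | pair {Γ : Ctx M} {C₁ C₂ : Chor M} {τ₁ τ₂ : CTy M} {ρ₁ ρ₂ ρt₁ ρt₂ : LocSet L}
      (h₁ : HasType Γ C₁ τ₁ ρ₁) (h₂ : HasType Γ C₂ τ₂ ρ₂)
      (ht₁ : Kinded Γ.kinds τ₁ ρt₁) (ht₂ : Kinded Γ.kinds τ₂ ρt₂) :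
      HasType Γ (.pair (ρt₁ ∪ ρt₂) C₁ C₂) (.prod τ₁ τ₂) (ρ₁ ∪ ρ₂)
  | fst {Γ : Ctx M} {C : Chor M} {τ₁ τ₂ : CTy M} {ρ₀ ρt₁ ρt₂ : LocSet L}
      (h : HasType Γ C (.prod τ₁ τ₂) ρ₀)
      (ht₁ : Kinded Γ.kinds τ₁ ρt₁) (ht₂ : Kinded Γ.kinds τ₂ ρt₂) :
      HasType Γ (.fst (ρt₁ ∪ ρt₂) C) τ₁ (ρ₀ ∪ (ρt₁ ∪ ρt₂))
  | snd {Γ : Ctx M} {C : Chor M} {τ₁ τ₂ : CTy M} {ρ₀ ρt₁ ρt₂ : LocSet L}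
      (h : HasType Γ C (.prod τ₁ τ₂) ρ₀)
      (ht₁ : Kinded Γ.kinds τ₁ ρt₁) (ht₂ : Kinded Γ.kinds τ₂ ρt₂) :
      HasType Γ (.snd (ρt₁ ∪ ρt₂) C) τ₂ (ρ₀ ∪ (ρt₁ ∪ ρt₂))
  | inl {Γ : Ctx M} {C : Chor M} {τ₁ τ₂ : CTy M} {ρ ρ₀ : LocSet L}
      (ht : Kinded Γ.kinds (.sum ρ τ₁ τ₂) ρ) (h : HasType Γ C τ₁ ρ₀) :
      HasType Γ (.inl ρ C) (.sum ρ τ₁ τ₂) ρ₀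
  | inr {Γ : Ctx M} {C : Chor M} {τ₁ τ₂ : CTy M} {ρ ρ₀ : LocSet L}
      (ht : Kinded Γ.kinds (.sum ρ τ₁ τ₂) ρ) (h : HasType Γ C τ₂ ρ₀) :
      HasType Γ (.inr ρ C) (.sum ρ τ₁ τ₂) ρ₀
  | case {Γ : Ctx M} {C C₁ C₂ : Chor M} {τ₁ τ₂ τ : CTy M} {ρ ρ₀ ρ₁ ρ₂ : LocSet L}
      (ht : Kinded Γ.kinds (.sum ρ τ₁ τ₂) ρ) (h : HasType Γ C (.sum ρ τ₁ τ₂) ρ₀)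
      (h₁ : HasType (Γ.bindPv τ₁) C₁ τ ρ₁) (h₂ : HasType (Γ.bindPv τ₂) C₂ τ ρ₂) :
      HasType Γ (.case ρ C C₁ C₂) τ (ρ₀ ∪ ρ₁ ∪ ρ₂ ∪ ρ)
  | localCase {Γ : Ctx M} {C C₁ C₂ : Chor M} {s t₁ t₂ : M.Ty} {τ : CTy M}
      {ρ ρ' ρ₀ ρ₁ ρ₂ : LocSet L} (h : HasType Γ C (.located s ρ') ρ₀)
      (hs : M.IsSum s t₁ t₂) (hρ : SetOk Γ.lctx .any ρ) (hsub : LocSet.Sub ρ ρ')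
      (h₁ : HasType (Γ.bindLv ρ t₁) C₁ τ ρ₁) (h₂ : HasType (Γ.bindLv ρ t₂) C₂ τ ρ₂) :
      HasType Γ (.localCase ρ C C₁ C₂) τ (ρ₀ ∪ ρ₁ ∪ ρ₂ ∪ ρ)
  | letIn {Γ : Ctx M} {C₁ C₂ : Chor M} {t : M.Ty} {τ : CTy M} {ρ ρ' ρ₁ ρ₂ : LocSet L}
      (h₁ : HasType Γ C₁ (.located t ρ') ρ₁) (hρ : SetOk Γ.lctx .any ρ)
      (hsub : LocSet.Sub ρ ρ') (h₂ : HasType (Γ.bindLv ρ t) C₂ τ ρ₂) :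
      HasType Γ (.letIn ρ t C₁ C₂) τ (ρ₁ ∪ ρ₂ ∪ ρ)
  | letLoc {Γ : Ctx M} {C₁ C₂ : Chor M} {τ : CTy M} {ρ ρ' ρ'' ρt ρ₁ ρ₂ : LocSet L}
      (h₁ : HasType Γ C₁ (.located (M.locTy ρ'') ρ') ρ₁) (hρ : SetOk Γ.lctx .fin ρ)
      (hsub : LocSet.Sub ρ'' ρ) (hsub' : LocSet.Sub ρ ρ') (ht : Kinded Γ.kinds τ ρt)
      (h₂ : HasType (Γ.bindTy .loc) C₂ (τ.rename (Ren.shift .loc)) ρ₂) :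
      HasType Γ (.letLoc ρ C₁ C₂) τ (ρ₁ ∪ ρ₂.drop .loc ∪ ρ)
  | letSet {Γ : Ctx M} {k : SetKind} {C₁ C₂ : Chor M} {τ : CTy M}
      {ρ ρ' ρ'' ρt ρ₁ ρ₂ : LocSet L} (h₁ : HasType Γ C₁ (.located (M.locsetTy ρ'') ρ') ρ₁)
      (hρ : SetOk Γ.lctx .fin ρ) (hsub : LocSet.Sub ρ'' ρ) (hsub' : LocSet.Sub ρ ρ')
      (ht : Kinded Γ.kinds τ ρt)
      (h₂ : HasType (Γ.bindTy (.set k)) C₂ (τ.rename (Ren.shift .set)) ρ₂) :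
      HasType Γ (.letSet ρ k C₁ C₂) τ (ρ₁ ∪ ρ₂.drop .set ∪ ρ)
  | send {Γ : Ctx M} {C : Chor M} {ℓ : Loc L} {t : M.Ty} {ρ ρ₀ ρ₁ : LocSet L}
      (h : HasType Γ C (.located t ρ₁) ρ₀) (hℓ : LocOk Γ.lctx ℓ) (hm : LocSet.Mem ℓ ρ₁)
      (hρ : SetOk Γ.lctx .any ρ) :
      HasType Γ (.send C ℓ ρ) (.located t (ρ₁ ∪ ρ)) (ρ₀ ∪ LocSet.single ℓ ∪ ρ)
  | sync {Γ : Ctx M} {C : Chor M} {ℓ : Loc L} {d : Bool} {τ : CTy M} {ρ ρ₀ : LocSet L}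
      (hℓ : LocOk Γ.lctx ℓ) (hρ : SetOk Γ.lctx .any ρ) (h : HasType Γ C τ ρ₀) :
      HasType Γ (.sync ℓ d ρ C) τ (LocSet.single ℓ ∪ ρ ∪ ρ₀)
  | fork {Γ : Ctx M} {C : Chor M} {ℓ : Loc L} {τ : CTy M} {ρ ρt : LocSet L}
      (hℓ : LocOk Γ.lctx ℓ) (ht : Kinded Γ.kinds τ ρt)
      (h : HasType ((Γ.bindTy .loc).bindLv
          (LocSet.single (.var 0) ∪ LocSet.single (ℓ.rename (Ren.shift .loc)))
          (M.locTy (LocSet.single (.var 0)))) C (τ.rename (Ren.shift .loc)) ρ) :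
      HasType Γ (.fork ℓ C) τ (LocSet.single ℓ ∪ ρ.drop .loc)

/-! ## Operational semantics -/

/-- Redices, which label the steps. In a fork `C` is the choreography that the new thread
runs. -/
inductive Redex (M : LocalLang.{u, v, w} L) : Type (max u v w)
  | done (ρ : LocSet L) (e₁ e₂ : M.Exp)
  | func (R : Redex M)
  | arg (R : Redex M)
  | app (ρ : LocSet L)
  | tapp (ρ : LocSet L)
  | unfoldFold (ρ : LocSet L)
  | pairL (R : Redex M)
  | pairR (R : Redex M)
  | fstPair (ρ : LocSet L)
  | sndPair (ρ : LocSet L)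
  | caseInl (ρ : LocSet L)
  | caseInr (ρ : LocSet L)
  | letV (ρ : LocSet L) (v : M.Exp)
  | tyLet (ρ : LocSet L) (a : TArg M)
  | sendV (a : L) (m : M.Exp ⊕ Bool) (ρ : LocSet L)
  | fork (a b : L) (C : Chor M)
  | kill (a : L)

namespace Redex

/-- The locations that take part in a redex. -/
def rloc : Redex M → LocSet L
  | .done ρ _ _ => ρ
  | .func R => R.rloc
  | .arg R => R.rloc
  | .app ρ => ρ
  | .tapp ρ => ρ
  | .unfoldFold ρ => ρ
  | .pairL R => R.rloc
  | .pairR R => R.rloc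
  | .fstPair ρ => ρ
  | .sndPair ρ => ρ
  | .caseInl ρ => ρ
  | .caseInr ρ => ρ
  | .letV ρ _ => ρ
  | .tyLet ρ _ => ρ
  | .sendV a _ ρ => LocSet.single (.const a) ∪ ρ
  | .fork a _ _ => LocSet.single (.const a)
  | .kill a => LocSet.single (.const a)

def rename (r : Ren) : Redex M → Redex M
  | .done ρ e₁ e₂ => .done (ρ.rename r) (M.expRename r e₁) (M.expRename r e₂)
  | .func R => .func (R.rename r)
  | .arg R => .arg (R.rename r)
  | .app ρ => .app (ρ.rename r)
  | .tapp ρ => .tapp (ρ.rename r)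
  | .unfoldFold ρ => .unfoldFold (ρ.rename r)
  | .pairL R => .pairL (R.rename r)
  | .pairR R => .pairR (R.rename r)
  | .fstPair ρ => .fstPair (ρ.rename r)
  | .sndPair ρ => .sndPair (ρ.rename r)
  | .caseInl ρ => .caseInl (ρ.rename r)
  | .caseInr ρ => .caseInr (ρ.rename r)
  | .letV ρ v => .letV (ρ.rename r) (M.expRename r v)
  | .tyLet ρ a => .tyLet (ρ.rename r) (a.rename r)
  | .sendV a (.inl v) ρ => .sendV a (.inl (M.expRename r v)) (ρ.rename r)
  | .sendV a (.inr d) ρ => .sendV a (.inr d) (ρ.rename r)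
  | .fork a b C => .fork a b (C.rename r)
  | .kill a => .kill a

/-- The label of a step in the scope of a variable of sort `s`, seen outside that scope. -/
def lower (s : BSort) (R : Redex M) : Redex M := R.rename (Ren.lower s)

end Redex

/-- One layer of an evaluation context. -/
inductive Frame (M : LocalLang.{u, v, w} L) : Type (max u v w)
  | appL (ρ : LocSet L) (C₂ : Chor M)
  | appR (ρ : LocSet L) (V : Chor M)
  | tapp (ρ : LocSet L) (a : TArg M)
  | fold (ρ : LocSet L)
  | unfold (ρ : LocSet L)
  | pairL (ρ : LocSet L) (C₂ : Chor M)
  | pairR (ρ : LocSet L) (V : Chor M)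
  | fst (ρ : LocSet L)
  | snd (ρ : LocSet L)
  | inl (ρ : LocSet L)
  | inr (ρ : LocSet L)
  | case (ρ : LocSet L) (C₁ C₂ : Chor M)
  | localCase (ρ : LocSet L) (C₁ C₂ : Chor M)
  | letIn (ρ : LocSet L) (t : M.Ty) (C₂ : Chor M)
  | letLoc (ρ : LocSet L) (C₂ : Chor M)
  | letSet (ρ : LocSet L) (k : SetKind) (C₂ : Chor M)
  | send (ℓ : Loc L) (ρ : LocSet L)
  | killAfter (a : L)

namespace Frame

/-- Fill the hole. -/
def plug : Frame M → Chor M → Chor M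
  | .appL ρ C₂, C => .app ρ C C₂
  | .appR ρ V, C => .app ρ V C
  | .tapp ρ a, C => .tapp ρ C a
  | .fold ρ, C => .fold ρ C
  | .unfold ρ, C => .unfold ρ C
  | .pairL ρ C₂, C => .pair ρ C C₂
  | .pairR ρ V, C => .pair ρ V C
  | .fst ρ, C => .fst ρ C
  | .snd ρ, C => .snd ρ C
  | .inl ρ, C => .inl ρ C
  | .inr ρ, C => .inr ρ C
  | .case ρ C₁ C₂, C => .case ρ C C₁ C₂
  | .localCase ρ C₁ C₂, C => .localCase ρ C C₁ C₂
  | .letIn ρ t C₂, C => .letIn ρ t C C₂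
  | .letLoc ρ C₂, C => .letLoc ρ C C₂
  | .letSet ρ k C₂, C => .letSet ρ k C C₂
  | .send ℓ ρ, C => .send C ℓ ρ
  | .killAfter a, C => .killAfter a C

/-- The left component of `V C` and of `(V, C)` has to be a value. -/
def Ok : Frame M → Prop
  | .appR _ V => V.Value
  | .pairR _ V => V.Value
  | _ => True

/-- The label of a step in the hole, seen outside the frame. -/
def label : Frame M → Redex M → Redex M
  | .appL _ _, R => .func R
  | .appR _ _, R => .arg R
  | .pairL _ _, R => .pairL R
  | .pairR _ _, R => .pairR R
  | _, R => R

end Frame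

/-- Configurations `⟨C, Ω⟩`: a choreography and the finite set of live threads. -/
abbrev Config (M : LocalLang.{u, v, w} L) := Chor M × Finset L

open LocSet (Live Disj Mem) in
/-- The labelled step relation `⟨C, Ω⟩ ⟶[R] ⟨C', Ω'⟩`. -/
inductive Step : Config M → Redex M → Config M → Prop
  -- evaluation contexts
  | ctx {η : Frame M} {C C' : Chor M} {Ω Ω' : Finset L} {R : Redex M} (hη : η.Ok)
      (h : Step (C, Ω) R (C', Ω')) : Step (η.plug C, Ω) (η.label R) (η.plug C', Ω')
  -- reductions
  | done {ρ : LocSet L} {e e' : M.Exp} {Ω : Finset L} (hρ : Live Ω ρ) (h : M.Step e e') :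
      Step (.done ρ e, Ω) (.done ρ e e') (.done ρ e', Ω)
  | app {ρ : LocSet L} {C V : Chor M} {Ω : Finset L} (hρ : Live Ω ρ) (hV : V.Value) :
      Step (.app ρ (.func ρ C) V, Ω) (.app ρ) (C.subst (Sub.chor₂ V (.func ρ C)), Ω)
  | tapp {ρ : LocSet L} {κ : Kind L} {C : Chor M} {a : TArg M} {Ω : Finset L}
      (hρ : Live Ω ρ) :
      Step (.tapp ρ (.tfun κ C) a, Ω) (.tapp ρ)
        ((C.subst (Sub.tinst a)).subst (Sub.chor₁ (.tfun κ C)), Ω)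
  | unfoldFold {ρ : LocSet L} {V : Chor M} {Ω : Finset L} (hρ : Live Ω ρ) (hV : V.Value) :
      Step (.unfold ρ (.fold ρ V), Ω) (.unfoldFold ρ) (V, Ω)
  | fstPair {ρ : LocSet L} {V₁ V₂ : Chor M} {Ω : Finset L} (hρ : Live Ω ρ)
      (h₁ : V₁.Value) (h₂ : V₂.Value) :
      Step (.fst ρ (.pair ρ V₁ V₂), Ω) (.fstPair ρ) (V₁, Ω)
  | sndPair {ρ : LocSet L} {V₁ V₂ : Chor M} {Ω : Finset L} (hρ : Live Ω ρ)
      (h₁ : V₁.Value) (h₂ : V₂.Value) :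
      Step (.snd ρ (.pair ρ V₁ V₂), Ω) (.sndPair ρ) (V₂, Ω)
  | caseInl {ρ : LocSet L} {V C₁ C₂ : Chor M} {Ω : Finset L} (hρ : Live Ω ρ)
      (hV : V.Value) :
      Step (.case ρ (.inl ρ V) C₁ C₂, Ω) (.caseInl ρ) (C₁.subst (Sub.chor₁ V), Ω)
  | caseInr {ρ : LocSet L} {V C₁ C₂ : Chor M} {Ω : Finset L} (hρ : Live Ω ρ)
      (hV : V.Value) :
      Step (.case ρ (.inr ρ V) C₁ C₂, Ω) (.caseInr ρ) (C₂.subst (Sub.chor₁ V), Ω)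
  | localCaseInl {ρ ρ' : LocSet L} {v v₁ : M.Exp} {C₁ C₂ : Chor M} {Ω : Finset L}
      (hρ : Live Ω ρ) (hsub : LocSet.Sub ρ ρ') (hv : M.Val v)
      (hc : M.getCase v = some (.inl v₁)) :
      Step (.localCase ρ (.done ρ' v) C₁ C₂, Ω) (.caseInl ρ) (C₁.subst (Sub.local₁ v₁), Ω)
  | localCaseInr {ρ ρ' : LocSet L} {v v₂ : M.Exp} {C₁ C₂ : Chor M} {Ω : Finset L}
      (hρ : Live Ω ρ) (hsub : LocSet.Sub ρ ρ') (hv : M.Val v)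
      (hc : M.getCase v = some (.inr v₂)) :
      Step (.localCase ρ (.done ρ' v) C₁ C₂, Ω) (.caseInr ρ) (C₂.subst (Sub.local₁ v₂), Ω)
  | letV {ρ ρ' : LocSet L} {t : M.Ty} {v : M.Exp} {C : Chor M} {Ω : Finset L}
      (hρ : Live Ω ρ) (hsub : LocSet.Sub ρ ρ') (hv : M.Val v) :
      Step (.letIn ρ t (.done ρ' v) C, Ω) (.letV ρ v) (C.subst (Sub.local₁ v), Ω)
  | letLocV {ρ ρ' : LocSet L} {v : M.Exp} {a : L} {C : Chor M} {Ω : Finset L}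
      (hρ : Live Ω ρ) (hsub : LocSet.Sub ρ ρ') (hv : M.Val v) (hr : M.RepLoc v a) :
      Step (.letLoc ρ (.done ρ' v) C, Ω) (.tyLet ρ (.loc (.const a)))
        (C.subst (Sub.tinst (.loc (.const a))), Ω)
  | letSetV {ρ ρ' : LocSet L} {k : SetKind} {v : M.Exp} {s : Finset L} {C : Chor M}
      {Ω : Finset L} (hρ : Live Ω ρ) (hsub : LocSet.Sub ρ ρ') (hv : M.Val v)
      (hr : M.RepSet v s) :
      Step (.letSet ρ k (.done ρ' v) C, Ω) (.tyLet ρ (.set (LocSet.ofFinset s)))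
        (C.subst (Sub.tinst (.set (LocSet.ofFinset s))), Ω)
  | sendV {ρ₁ ρ₂ : LocSet L} {a : L} {v : M.Exp} {Ω : Finset L} (ha : a ∈ Ω)
      (hρ : Live Ω ρ₂) (hm : Mem (.const a) ρ₁) (hv : M.Val v) :
      Step (.send (.done ρ₁ v) (.const a) ρ₂, Ω) (.sendV a (.inl v) ρ₂)
        (.done (ρ₁ ∪ ρ₂) v, Ω)
  | sync {ρ : LocSet L} {a : L} {d : Bool} {C : Chor M} {Ω : Finset L} (ha : a ∈ Ω)
      (hρ : Live Ω ρ) : Step (.sync (.const a) d ρ C, Ω) (.sendV a (.inr d) ρ) (C, Ω)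
  | fork {a b : L} {v : M.Exp} {C : Chor M} {Ω : Finset L} (ha : a ∈ Ω) (hb : b ∉ Ω)
      (hr : M.RepLoc v b) :
      Step (.fork (.const a) C, Ω) (.fork a b (C.substFork b v))
        (.killAfter b (C.substFork b v), insert b Ω)
  | kill {a : L} {V : Chor M} {Ω : Finset L} (ha : a ∈ Ω) (hV : V.Value) :
      Step (.killAfter a V, Ω) (.kill a) (V, Ω.erase a)
  -- out-of-order steps
  | appI {ρ : LocSet L} {C₁ C₂ C₂' : Chor M} {Ω Ω' : Finset L} {R : Redex M}
      (h : Step (C₂, Ω) R (C₂', Ω')) (hd : Disj R.rloc C₁.cloc) :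
      Step (.app ρ C₁ C₂, Ω) (.arg R) (.app ρ C₁ C₂', Ω')
  | pairI {ρ : LocSet L} {C₁ C₂ C₂' : Chor M} {Ω Ω' : Finset L} {R : Redex M}
      (h : Step (C₂, Ω) R (C₂', Ω')) (hd : Disj R.rloc C₁.cloc) :
      Step (.pair ρ C₁ C₂, Ω) (.pairR R) (.pair ρ C₁ C₂', Ω')
  | caseI {ρ : LocSet L} {C C₁ C₁' C₂ C₂' : Chor M} {Ω Ω' : Finset L} {R : Redex M}
      (h₁ : Step (C₁, Ω) R (C₁', Ω')) (h₂ : Step (C₂, Ω) R (C₂', Ω'))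
      (hd : Disj R.rloc (C.cloc ∪ ρ)) :
      Step (.case ρ C C₁ C₂, Ω) (R.lower .pv) (.case ρ C C₁' C₂', Ω')
  | localCaseI {ρ : LocSet L} {C C₁ C₁' C₂ C₂' : Chor M} {Ω Ω' : Finset L} {R : Redex M}
      (h₁ : Step (C₁, Ω) R (C₁', Ω')) (h₂ : Step (C₂, Ω) R (C₂', Ω'))
      (hd : Disj R.rloc (C.cloc ∪ ρ)) :
      Step (.localCase ρ C C₁ C₂, Ω) (R.lower .lv) (.localCase ρ C C₁' C₂', Ω')
  | letI {ρ : LocSet L} {t : M.Ty} {C₁ C₂ C₂' : Chor M} {Ω Ω' : Finset L} {R : Redex M}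
      (h : Step (C₂, Ω) R (C₂', Ω')) (hd : Disj R.rloc (C₁.cloc ∪ ρ)) :
      Step (.letIn ρ t C₁ C₂, Ω) (R.lower .lv) (.letIn ρ t C₁ C₂', Ω')
  | letLocI {ρ : LocSet L} {C₁ C₂ C₂' : Chor M} {Ω Ω' : Finset L} {R : Redex M}
      (h : Step (C₂, Ω) R (C₂', Ω'))
      (hd : Disj R.rloc ((C₁.cloc ∪ ρ).rename (Ren.shift .loc))) :
      Step (.letLoc ρ C₁ C₂, Ω) (R.lower .loc) (.letLoc ρ C₁ C₂', Ω')
  | letSetI {ρ : LocSet L} {k : SetKind} {C₁ C₂ C₂' : Chor M} {Ω Ω' : Finset L}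
      {R : Redex M} (h : Step (C₂, Ω) R (C₂', Ω'))
      (hd : Disj R.rloc ((C₁.cloc ∪ ρ).rename (Ren.shift .set))) :
      Step (.letSet ρ k C₁ C₂, Ω) (R.lower .set) (.letSet ρ k C₁ C₂', Ω')
  | syncI {ℓ : Loc L} {d : Bool} {ρ : LocSet L} {C C' : Chor M} {Ω Ω' : Finset L}
      {R : Redex M} (h : Step (C, Ω) R (C', Ω'))
      (hd : Disj R.rloc (LocSet.single ℓ ∪ ρ)) :
      Step (.sync ℓ d ρ C, Ω) R (.sync ℓ d ρ C', Ω')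
  | forkI {ℓ : Loc L} {C C' : Chor M} {Ω Ω' : Finset L} {R : Redex M}
      (h : Step (C, Ω) R (C', Ω')) (hd : ¬ Mem (ℓ.rename (Ren.shift .loc)) R.rloc) :
      Step (.fork ℓ C, Ω) ((R.lower .lv).lower .loc) (.fork ℓ C', Ω')
  | killI {a : L} {C : Chor M} {Ω : Finset L} (ha : a ∈ Ω) (hd : ¬ Mem (.const a) C.cloc) :
      Step (.killAfter a C, Ω) (.kill a) (C, Ω.erase a)

/-- Reduction in any finite number of steps. -/
def Steps : Config M → Config M → Prop :=
  Relation.ReflTransGen fun c c' => ∃ R, Step c R c'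

end Language

end LambdaFork

/-!
Type soundness is proved by an invariant of configurations `⟨C, Ω⟩` (`Config.Sound`) that steps
preserve and that implies progress. The typing judgement of the surface language cannot serve as
the invariant itself: it has no rule for `killAfter`, and it asks the body of a function to have
exactly the participants in its type, although substituting a value for a local variable may turn
an expression into a value and thereby remove participants. The invariant separates three concerns.

* `RunType`: a typing judgement without participants, in which the body of a function may have
  fewer participants than its type says. It is stable under substitution (`RunType.subst`) and
  under steps (`Step.runType`). Out-of-order steps happen under binders, so this is needed for open
  choreographies. The delicate case is a send, which moves a value to locations that may not know
  the local variables occurring in it; but a step that crosses the binder of such a variable must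
  not involve any location that knows the variable, so the value sent is closed.
* `Chor.Within`: the participants `Chor.parts` and the running threads `Chor.kills` are live. A
  reduction never adds participants, since the annotation of an eliminated construct contains
  the latent participants that it releases, and since the location names that instantiate a
  variable belong to the location set of the binder, or are a fresh thread.
* `Chor.Lin`: a running thread is not a participant outside of its `killAfter`. Hence the
  end of a thread takes away no location that is needed elsewhere. Threads are spawned with
  names that are not live, so they are different from all participants and running threads.

`Step.evolves` shows that steps respect the last two. For progress (`RunType.progress`) the kind
of a program type is unique, so the annotations of a value and of its eliminator agree, and the
acting locations of the next reduction are among the participants, hence live.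
-/

set_option linter.unusedSectionVars false

namespace LambdaFork

/-! ### Substitution in locations, location sets and program types -/

section Algebra

variable {L : Type u} [DecidableEq L] {M : LocalLang.{u, v, w} L}

theorem consIf_self {α : Type*} (s : BSort) (a : α) (f : ℕ → α) : consIf s s a f = cons a f :=
  if_pos rfl

theorem consIf_of_ne {α : Type*} {s s' : BSort} (h : s ≠ s') (a : α) (f : ℕ → α) :
    consIf s s' a f = f := if_neg h

theorem Loc.subst_subst (f g : ℕ → Loc L) (ℓ : Loc L) :
    (ℓ.subst f).subst g = ℓ.subst fun i => (f i).subst g := by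
  cases ℓ <;> rfl

theorem Loc.subst_var (ℓ : Loc L) : ℓ.subst Loc.var = ℓ := by cases ℓ <;> rfl

namespace LocSet

theorem subst_union (f : ℕ → Loc L) (g : ℕ → LocSet L) (ρ ρ' : LocSet L) :
    (ρ ∪ ρ').subst f g = ρ.subst f g ∪ ρ'.subst f g := Finset.union_biUnion

theorem subst_singleton (f : ℕ → Loc L) (g : ℕ → LocSet L) (x : Atom L) :
    subst f g {x} = x.subst f g := Finset.singleton_biUnion

theorem subst_single (f : ℕ → Loc L) (g : ℕ → LocSet L) (ℓ : Loc L) :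
    (single ℓ).subst f g = single (ℓ.subst f) := Finset.singleton_biUnion

theorem subst_all (f : ℕ → Loc L) (g : ℕ → LocSet L) : (all : LocSet L).subst f g = all :=
  Finset.singleton_biUnion

theorem subst_subst (f f' : ℕ → Loc L) (g g' : ℕ → LocSet L) (ρ : LocSet L) :
    (ρ.subst f g).subst f' g' =
      ρ.subst (fun i => (f i).subst f') (fun i => (g i).subst f' g') := by
  unfold subst
  rw [Finset.biUnion_biUnion]
  refine Finset.biUnion_congr rfl fun x _ => ?_
  cases x with
  | loc ℓ => simp [Atom.subst, Loc.subst_subst]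
  | var i => rfl
  | top => simp [Atom.subst]

theorem subst_var (ρ : LocSet L) : ρ.subst Loc.var (fun i => {.var i}) = ρ := by
  unfold subst
  conv_rhs => rw [← Finset.biUnion_singleton_eq_self (s := ρ)]
  refine Finset.biUnion_congr rfl fun x _ => ?_
  cases x <;> simp [Atom.subst, Loc.subst_var]

theorem subst_mono (f : ℕ → Loc L) (g : ℕ → LocSet L) {ρ ρ' : LocSet L} (h : ρ ⊆ ρ') :
    ρ.subst f g ⊆ ρ'.subst f g := Finset.biUnion_subset_biUnion_of_subset_left _ h

theorem mem_subst {f : ℕ → Loc L} {g : ℕ → LocSet L} {ρ : LocSet L} {x : Atom L} :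
    x ∈ ρ.subst f g ↔ ∃ y ∈ ρ, x ∈ y.subst f g := Finset.mem_biUnion

theorem top_mem_subst (f : ℕ → Loc L) (g : ℕ → LocSet L) {ρ : LocSet L}
    (h : Atom.top ∈ ρ) : Atom.top ∈ ρ.subst f g :=
  mem_subst.2 ⟨_, h, by simp [Atom.subst]⟩

theorem Sub.refl (ρ : LocSet L) : Sub ρ ρ := .inr (Finset.Subset.refl _)

theorem Sub.trans {ρ₁ ρ₂ ρ₃ : LocSet L} (h : Sub ρ₁ ρ₂) (h' : Sub ρ₂ ρ₃) : Sub ρ₁ ρ₃ := by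
  rcases h' with h' | h'
  · exact .inl h'
  · exact h.imp (fun h => h' h) fun h => h.trans h'

theorem Sub.subst {ρ ρ' : LocSet L} (h : Sub ρ ρ') (f : ℕ → Loc L) (g : ℕ → LocSet L) :
    Sub (ρ.subst f g) (ρ'.subst f g) :=
  h.imp (top_mem_subst f g) (subst_mono f g)

theorem Mem.of_sub {ℓ : Loc L} {ρ ρ' : LocSet L} (hm : Mem ℓ ρ) (h : Sub ρ ρ') : Mem ℓ ρ' := by
  rcases h with h | h
  · exact .inr h
  · exact hm.imp (fun h' => h h') (fun h' => h h')

theorem Mem.subst {ℓ : Loc L} {ρ : LocSet L} (h : Mem ℓ ρ) (f : ℕ → Loc L)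
    (g : ℕ → LocSet L) : Mem (ℓ.subst f) (ρ.subst f g) :=
  h.imp (fun h => mem_subst.2 ⟨_, h, by simp [Atom.subst]⟩) (top_mem_subst f g)

theorem rename_eq_self {r : Ren} (hl : r .loc = fun i => i) (hs : r .set = fun i => i)
    (ρ : LocSet L) : ρ.rename r = ρ := by
  simp only [rename, hl, hs]
  exact subst_var ρ

end LocSet

theorem Kind.sort_subst (f : ℕ → Loc L) (g : ℕ → LocSet L) (κ : Kind L) :
    (κ.subst f g).sort = κ.sort := by cases κ <;> rfl

namespace LSub

@[ext]
theorem ext' {Ty : Type v} {σ σ' : LSub L Ty} (h₁ : ∀ i, σ.loc i = σ'.loc i)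
    (h₂ : ∀ i, σ.set i = σ'.set i) (h₃ : ∀ i, σ.ty i = σ'.ty i) : σ = σ' := by
  cases σ; cases σ'
  simp only [mk.injEq]
  exact ⟨funext h₁, funext h₂, funext h₃⟩

/-- Push a substitution for the variables that the local language sees under a binder. -/
def up (M : LocalLang.{u, v, w} L) (s : BSort) (σ : LSub L M.Ty) : LSub L M.Ty where
  loc := consIf s .loc (.var 0) fun i => (σ.loc i).rename (Ren.shift s)
  set := consIf s .set {.var 0} fun i => (σ.set i).rename (Ren.shift s)
  ty := consIf s .ty (M.tvar 0) fun i => M.tyRename (Ren.shift s) (σ.ty i)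

/-- Substitutions and weakening commute. -/
theorem shift_comp_up (s : BSort) (σ : LSub L M.Ty) :
    LSub.comp M.tySubst (LSub.ofRen M.tvar (Ren.shift s)) (σ.up M s) =
      LSub.comp M.tySubst σ (LSub.ofRen M.tvar (Ren.shift s)) := by
  ext1 i
  · by_cases h : s = .loc
    · subst h; simp [comp, ofRen, up, consIf_self, Loc.subst, Ren.shift, cons, Loc.rename]
    · simp [comp, ofRen, up, consIf_of_ne h, Loc.subst, Ren.shift, Ne.symm h, Loc.rename]
  · by_cases h : s = .set
    · subst h
      simp [comp, ofRen, up, consIf_self, LocSet.subst_singleton, Atom.subst, Ren.shift, cons,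
        LocSet.rename]
    · simp [comp, ofRen, up, consIf_of_ne h, LocSet.subst_singleton, Atom.subst, Ren.shift,
        Ne.symm h, LocSet.rename]
  · by_cases h : s = .ty
    · subst h
      simp [comp, ofRen, up, consIf_self, M.tySubst_tvar, Ren.shift, cons, LocalLang.tyRename]
    · simp [comp, ofRen, up, consIf_of_ne h, M.tySubst_tvar, Ren.shift, Ne.symm h,
        LocalLang.tyRename]

theorem comp_up (s : BSort) (σ₁ σ₂ : LSub L M.Ty) :
    (LSub.comp M.tySubst σ₁ σ₂).up M s = LSub.comp M.tySubst (σ₁.up M s) (σ₂.up M s) := by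
  have key := shift_comp_up (M := M) s σ₂
  have kl := congrArg LSub.loc key
  have ks := congrArg LSub.set key
  simp only [comp] at kl ks
  ext1 i
  · have this : ∀ i, ((σ₁.loc i).subst σ₂.loc).rename (Ren.shift s) =
        ((σ₁.loc i).rename (Ren.shift s)).subst (σ₂.up M s).loc := fun i => by
      simp only [Loc.rename, Loc.subst_subst]; exact (congrArg (Loc.subst · (σ₁.loc i)) kl).symm
    by_cases h : s = .loc
    · subst h
      cases i with
      | zero => simp [comp, up, consIf_self, cons, Loc.subst]
      | succ i => simpa [comp, up, consIf_self, cons] using this i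
    · simpa [comp, up, consIf_of_ne h] using this i
  · have this : ∀ i, ((σ₁.set i).subst σ₂.loc σ₂.set).rename (Ren.shift s) =
        ((σ₁.set i).rename (Ren.shift s)).subst (σ₂.up M s).loc (σ₂.up M s).set := fun i => by
      simp only [LocSet.rename, LocSet.subst_subst]
      exact (congrArg₂ (LocSet.subst · · (σ₁.set i)) kl ks).symm
    by_cases h : s = .set
    · subst h
      cases i with
      | zero => simp [comp, up, consIf_self, cons, LocSet.subst_singleton, Atom.subst]
      | succ i => simpa [comp, up, consIf_self, cons] using this i
    · simpa [comp, up, consIf_of_ne h] using this i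
  · have this : ∀ i, M.tyRename (Ren.shift s) (M.tySubst σ₂ (σ₁.ty i)) =
        M.tySubst (σ₂.up M s) (M.tyRename (Ren.shift s) (σ₁.ty i)) := fun i => by
      simp only [LocalLang.tyRename, M.tySubst_comp, key]
    by_cases h : s = .ty
    · subst h
      cases i with
      | zero => simp [comp, up, consIf_self, cons, M.tySubst_tvar]
      | succ i => simpa [comp, up, consIf_self, cons] using this i
    · simpa [comp, up, consIf_of_ne h] using this i

theorem up_ofRen (s : BSort) (r : Ren) :
    (LSub.ofRen M.tvar r).up M s = LSub.ofRen (L := L) M.tvar (Ren.up s r) := by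
  ext1 i
  · by_cases h : s = .loc
    · subst h
      cases i <;> simp [ofRen, up, consIf_self, cons, Ren.up, Loc.rename, Loc.subst, Ren.shift]
    · simp [ofRen, up, consIf_of_ne h, Ren.up, Loc.rename, Loc.subst, Ren.shift, Ne.symm h]
  · by_cases h : s = .set
    · subst h
      cases i <;> simp [ofRen, up, consIf_self, cons, Ren.up, LocSet.rename,
        LocSet.subst_singleton, Atom.subst, Ren.shift]
    · simp [ofRen, up, consIf_of_ne h, Ren.up, LocSet.rename, LocSet.subst_singleton,
        Atom.subst, Ren.shift, Ne.symm h]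
  · by_cases h : s = .ty
    · subst h
      cases i <;> simp [ofRen, up, consIf_self, cons, Ren.up, LocalLang.tyRename,
        M.tySubst_tvar, Ren.shift]
    · simp [ofRen, up, consIf_of_ne h, Ren.up, LocalLang.tyRename, M.tySubst_tvar, Ren.shift,
        Ne.symm h]

end LSub

theorem LocalLang.tyRename_eq_self {r : Ren} (hl : r .loc = fun i => i)
    (hs : r .set = fun i => i) (ht : r .ty = fun i => i) (t : M.Ty) : M.tyRename r t = t := by
  have : LSub.ofRen (L := L) M.tvar r = LSub.ofRen M.tvar fun _ i => i := by
    simp [LSub.ofRen, hl, hs, ht]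
  rw [LocalLang.tyRename, this, M.tySubst_id]

namespace TSub

theorem ext' {σ σ' : TSub M} (h₁ : σ.toLSub = σ'.toLSub) (h₂ : ∀ i, σ.prog i = σ'.prog i) :
    σ = σ' := by
  cases σ; cases σ'
  simp only [mk.injEq]
  exact ⟨h₁, funext h₂⟩

/-- The renaming `r` as a substitution. -/
def ofRen (r : Ren) : TSub M := { LSub.ofRen M.tvar r with prog := fun i => .var (r .prog i) }

/-- The substitution that first performs `σ₁` and then `σ₂`. -/
def comp (σ₁ σ₂ : TSub M) : TSub M :=
  { LSub.comp M.tySubst σ₁.toLSub σ₂.toLSub with prog := fun i => (σ₁.prog i).subst σ₂ }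

theorem up_ofRen (s : BSort) (r : Ren) :
    (ofRen r : TSub M).up s = ofRen (Ren.up s r) := by
  refine ext' (LSub.up_ofRen s r) fun i => ?_
  by_cases h : s = .prog
  · subst h; cases i <;> simp [ofRen, up, consIf_self, cons, Ren.up, CTy.rename, Ren.shift]
  · simp [ofRen, up, consIf_of_ne h, Ren.up, CTy.rename, Ren.shift, Ne.symm h]

end TSub

namespace CTy

theorem rename_eq_subst (r : Ren) (τ : CTy M) : τ.rename r = τ.subst (TSub.ofRen r) := by
  induction τ generalizing r with
  | var i => rfl
  | located t ρ => rfl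
  | arrow τ₁ ρ τ₂ h₁ h₂ => simp only [rename, subst, h₁, h₂]; rfl
  | prod τ₁ τ₂ h₁ h₂ => simp only [rename, subst, h₁, h₂]
  | sum ρ τ₁ τ₂ h₁ h₂ => simp only [rename, subst, h₁, h₂]; rfl
  | mu ρ τ h => simp only [rename, subst, h, TSub.up_ofRen]; rfl
  | all κ ρ τ h => simp only [rename, subst, h, TSub.up_ofRen]; rfl

/-- Substitutions compose, provided that their composition commutes with going under
binders. -/
theorem subst_subst_of_up (P : TSub M → TSub M → Prop)
    (hP : ∀ s σ₁ σ₂, P σ₁ σ₂ → P (σ₁.up s) (σ₂.up s) ∧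
      (σ₁.up s).comp (σ₂.up s) = (σ₁.comp σ₂).up s)
    {σ₁ σ₂ : TSub M} (h : P σ₁ σ₂) (τ : CTy M) :
    (τ.subst σ₁).subst σ₂ = τ.subst (σ₁.comp σ₂) := by
  induction τ generalizing σ₁ σ₂ with
  | var i => rfl
  | located t ρ =>
    simp only [subst, M.tySubst_comp, LocSet.subst_subst]; rfl
  | arrow τ₁ ρ τ₂ h₁ h₂ => simp only [subst, h₁ h, h₂ h, LocSet.subst_subst]; rfl
  | prod τ₁ τ₂ h₁ h₂ => simp only [subst, h₁ h, h₂ h]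
  | sum ρ τ₁ τ₂ h₁ h₂ => simp only [subst, h₁ h, h₂ h, LocSet.subst_subst]; rfl
  | mu ρ τ ih =>
    obtain ⟨h', e⟩ := hP .prog _ _ h
    simp only [subst, ih h', e, LocSet.subst_subst]; rfl
  | all κ ρ τ ih =>
    obtain ⟨h', e⟩ := hP κ.sort _ _ h
    have eκ : (κ.subst σ₁.loc σ₁.set).subst σ₂.loc σ₂.set =
        κ.subst (σ₁.comp σ₂).loc (σ₁.comp σ₂).set := by
      cases κ <;> simp only [Kind.subst, LocSet.subst_subst]; rfl
    simp only [subst, Kind.sort_subst, ih h', ← e, LocSet.subst_subst, eκ]; rfl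

end CTy

namespace TSub

theorem comp_up_of (s : BSort) (σ₁ σ₂ : TSub M)
    (h : ∀ i, ((σ₁.prog i).rename (Ren.shift s)).subst (σ₂.up s) =
      ((σ₁.prog i).subst σ₂).rename (Ren.shift s)) :
    (σ₁.up s).comp (σ₂.up s) = (σ₁.comp σ₂).up s := by
  refine ext' (LSub.comp_up s σ₁.toLSub σ₂.toLSub).symm fun i => ?_
  by_cases hs : s = .prog
  · subst hs
    cases i with
    | zero => simp [comp, up, consIf_self, cons, CTy.subst]
    | succ i => simpa [comp, up, consIf_self, cons] using h i
  · simpa [comp, up, consIf_of_ne hs] using h i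

theorem shift_comp_up (s : BSort) (σ : TSub M) :
    (ofRen (Ren.shift s)).comp (σ.up s) = σ.comp (ofRen (Ren.shift s)) := by
  refine ext' (LSub.shift_comp_up s σ.toLSub) fun i => ?_
  by_cases h : s = .prog
  · subst h; simp [comp, ofRen, up, consIf_self, CTy.subst, Ren.shift, cons,
      CTy.rename_eq_subst]
  · simp [comp, ofRen, up, consIf_of_ne h, CTy.subst, Ren.shift, Ne.symm h,
      CTy.rename_eq_subst]

end TSub

namespace CTy

theorem rename_subst (r : Ren) (σ : TSub M) (τ : CTy M) :
    (τ.rename r).subst σ = τ.subst ((TSub.ofRen r).comp σ) := by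
  rw [rename_eq_subst]
  refine subst_subst_of_up (fun σ₁ _ => ∃ r, σ₁ = TSub.ofRen r) ?_ ⟨r, rfl⟩ τ
  rintro s _ σ₂ ⟨r, rfl⟩
  refine ⟨⟨_, TSub.up_ofRen s r⟩, TSub.comp_up_of s _ _ fun i => ?_⟩
  have := congrFun (congrArg TSub.prog (TSub.shift_comp_up s σ₂)) (r .prog i)
  simpa [TSub.comp, TSub.ofRen, CTy.subst, CTy.rename, CTy.rename_eq_subst] using this

theorem subst_rename (r : Ren) (σ : TSub M) (τ : CTy M) :
    (τ.subst σ).rename r = τ.subst (σ.comp (TSub.ofRen r)) := by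
  rw [rename_eq_subst]
  refine subst_subst_of_up (fun _ σ₂ => ∃ r, σ₂ = TSub.ofRen r) ?_ ⟨r, rfl⟩ τ
  rintro s σ₁ _ ⟨r, rfl⟩
  refine ⟨⟨_, TSub.up_ofRen s r⟩, TSub.comp_up_of s _ _ fun i => ?_⟩
  rw [← rename_eq_subst, rename_subst, TSub.shift_comp_up, rename_eq_subst, rename_eq_subst,
    ← rename_eq_subst r, rename_subst]

theorem subst_shift (s : BSort) (σ : TSub M) (τ : CTy M) :
    (τ.rename (Ren.shift s)).subst (σ.up s) = (τ.subst σ).rename (Ren.shift s) := by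
  rw [rename_subst, subst_rename, TSub.shift_comp_up]

theorem subst_subst (σ₁ σ₂ : TSub M) (τ : CTy M) :
    (τ.subst σ₁).subst σ₂ = τ.subst (σ₁.comp σ₂) :=
  subst_subst_of_up (fun _ _ => True)
    (fun s σ₁ σ₂ _ => ⟨trivial, TSub.comp_up_of s σ₁ σ₂ fun _ => subst_shift s σ₂ _⟩) trivial τ

theorem rename_rename (r r' : Ren) (τ : CTy M) :
    (τ.rename r).rename r' = τ.rename fun s i => r' s (r s i) := by
  rw [rename_eq_subst r', rename_subst, rename_eq_subst]
  congr 1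
  refine TSub.ext' ?_ fun i => rfl
  ext1 i
  · rfl
  · simp [TSub.comp, TSub.ofRen, LSub.comp, LSub.ofRen, LocSet.subst_singleton, Atom.subst]
  · simp [TSub.comp, TSub.ofRen, LSub.comp, LSub.ofRen, M.tySubst_tvar]

end CTy

theorem TSub.id_eq_ofRen : (TSub.id : TSub M) = TSub.ofRen fun _ i => i := rfl

theorem TSub.up_id (s : BSort) : (TSub.id : TSub M).up s = TSub.id := by
  rw [id_eq_ofRen, up_ofRen]
  congr 1
  funext s' i
  by_cases h : s' = s
  · cases i <;> simp [Ren.up, h]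
  · simp [Ren.up, h]

theorem CTy.subst_id (τ : CTy M) : τ.subst TSub.id = τ := by
  induction τ with
  | var i => rfl
  | located t ρ =>
    simp only [subst]
    exact congrArg₂ _ (M.tySubst_id t) (LocSet.subst_var ρ)
  | arrow τ₁ ρ τ₂ h₁ h₂ =>
    simp only [subst, h₁, h₂]; exact congrArg (CTy.arrow τ₁ · τ₂) (LocSet.subst_var ρ)
  | prod τ₁ τ₂ h₁ h₂ => simp only [subst, h₁, h₂]
  | sum ρ τ₁ τ₂ h₁ h₂ =>
    simp only [subst, h₁, h₂]; exact congrArg (CTy.sum · τ₁ τ₂) (LocSet.subst_var ρ)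
  | mu ρ τ h =>
    simp only [subst, h, TSub.up_id]; exact congrArg (CTy.mu · τ) (LocSet.subst_var ρ)
  | all κ ρ τ h =>
    simp only [subst, h, TSub.up_id]
    have : κ.subst (TSub.id : TSub M).loc (TSub.id : TSub M).set = κ := by
      cases κ <;> simp only [Kind.subst]
      exact congrArg Kind.prog (LocSet.subst_var _)
    rw [this]
    exact congrArg (CTy.all κ · τ) (LocSet.subst_var ρ)

/-- A renaming that fixes the type-level variables fixes every program type. -/
theorem TSub.ofRen_eq_id {r : Ren} (h : ∀ s, s ≠ .lv → s ≠ .pv → r s = fun i => i) :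
    (TSub.ofRen r : TSub M) = TSub.id := by
  simp [TSub.ofRen, TSub.id, LSub.ofRen, h]

theorem CTy.rename_eq_self {r : Ren} (h : ∀ s, s ≠ .lv → s ≠ .pv → r s = fun i => i)
    (τ : CTy M) : τ.rename r = τ := by
  rw [rename_eq_subst, TSub.ofRen_eq_id h, subst_id]

theorem Ren.shift_of_ne {s s' : BSort} (h : s' ≠ s) : Ren.shift s s' = fun i => i := by
  funext i; simp [Ren.shift, h]

theorem TSub.up_lv (σ : TSub M) : σ.up .lv = σ := by
  refine TSub.ext' ?_ fun i => ?_
  · ext1 i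
    · exact Loc.subst_var _
    · exact LocSet.rename_eq_self (Ren.shift_of_ne (by decide)) (Ren.shift_of_ne (by decide)) _
    · exact M.tyRename_eq_self (Ren.shift_of_ne (by decide)) (Ren.shift_of_ne (by decide))
        (Ren.shift_of_ne (by decide)) _
  · exact CTy.rename_eq_self (fun s h _ => Ren.shift_of_ne h) _

theorem TSub.up_pv (σ : TSub M) : σ.up .pv = σ := by
  refine TSub.ext' ?_ fun i => ?_
  · ext1 i
    · exact Loc.subst_var _
    · exact LocSet.rename_eq_self (Ren.shift_of_ne (by decide)) (Ren.shift_of_ne (by decide)) _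
    · exact M.tyRename_eq_self (Ren.shift_of_ne (by decide)) (Ren.shift_of_ne (by decide))
        (Ren.shift_of_ne (by decide)) _
  · exact CTy.rename_eq_self (fun s _ h => Ren.shift_of_ne h) _

/-- The sort of the variables that a type-level argument can replace. -/
def TArg.sort : TArg M → BSort
  | .loc _ => .loc
  | .set _ => .set
  | .ty _ => .ty
  | .prog _ => .prog

theorem TArg.sort_subst (σ : TSub M) (a : TArg M) : (a.subst σ).sort = a.sort := by
  cases a <;> rfl

theorem TArg.rename_eq_subst (r : Ren) (a : TArg M) : a.rename r = a.subst (TSub.ofRen r) := by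
  cases a <;> simp only [rename, subst, CTy.rename_eq_subst] <;> rfl

/-- Weakening by a variable and instantiating it has no effect. -/
theorem TArg.shift_comp_inst (a : TArg M) :
    (TSub.ofRen (Ren.shift a.sort)).comp a.inst = TSub.id := by
  refine TSub.ext' ?_ fun i => ?_
  · ext1 i <;> cases a <;>
      simp [TSub.comp, TSub.ofRen, LSub.comp, LSub.ofRen, Ren.shift, sort, inst, TSub.id, cons,
        Loc.subst, LocSet.subst_singleton, Atom.subst, M.tySubst_tvar]
  · cases a <;> simp [TSub.comp, TSub.ofRen, Ren.shift, sort, inst, TSub.id, cons, CTy.subst]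

theorem CTy.shift_inst (a : TArg M) (τ : CTy M) :
    (τ.rename (Ren.shift a.sort)).subst a.inst = τ := by
  rw [rename_subst, a.shift_comp_inst, subst_id]

theorem LocalLang.shift_inst (a : TArg M) (t : M.Ty) :
    M.tySubst a.inst.toLSub (M.tyRename (Ren.shift a.sort) t) = t := by
  rw [LocalLang.tyRename, M.tySubst_comp]
  have := congrArg TSub.toLSub a.shift_comp_inst
  exact (congrArg (M.tySubst · t) this).trans (M.tySubst_id t)

theorem LocSet.shift_inst (a : TArg M) (ρ : LocSet L) :
    (ρ.rename (Ren.shift a.sort)).subst a.inst.loc a.inst.set = ρ := by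
  rw [LocSet.rename, LocSet.subst_subst]
  have := congrArg TSub.toLSub a.shift_comp_inst
  have hl := congrArg LSub.loc this
  have hs := congrArg LSub.set this
  exact (congrArg₂ (LocSet.subst · · ρ) hl hs).trans (LocSet.subst_var ρ)

theorem TArg.inst_comp (σ : TSub M) (a : TArg M) :
    a.inst.comp σ = (σ.up a.sort).comp (a.subst σ).inst := by
  have key : ∀ i, ((σ.prog i).rename (Ren.shift a.sort)).subst (a.subst σ).inst = σ.prog i :=
    fun i => by rw [← a.sort_subst σ, CTy.shift_inst]
  have keyl : ∀ i, ((σ.loc i).rename (Ren.shift a.sort)).subst (a.subst σ).inst.loc = σ.loc i :=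
    fun i => by
      rw [← a.sort_subst σ, Loc.rename, Loc.subst_subst]
      have := congrArg (fun σ : TSub M => σ.loc) (a.subst σ).shift_comp_inst
      exact (congrArg (Loc.subst · _) this).trans (Loc.subst_var _)
  have keys : ∀ i, ((σ.set i).rename (Ren.shift a.sort)).subst (a.subst σ).inst.loc
      (a.subst σ).inst.set = σ.set i :=
    fun i => by rw [← a.sort_subst σ, LocSet.shift_inst]
  have keyt : ∀ i, M.tySubst (a.subst σ).inst.toLSub
      (M.tyRename (Ren.shift a.sort) (σ.ty i)) = σ.ty i :=
    fun i => by rw [← a.sort_subst σ, LocalLang.shift_inst]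
  refine TSub.ext' ?_ fun i => ?_
  · ext1 i
    · have := keyl i
      cases a
      · cases i with
        | zero => rfl
        | succ i => exact (keyl i).symm
      all_goals exact this.symm
    · have := keys i
      cases a
      case set =>
        cases i with
        | zero =>
          simp [TSub.comp, LSub.comp, TSub.up, TArg.inst, TArg.subst, TArg.sort, consIf_self, cons,
            LocSet.subst_singleton, Atom.subst]
        | succ i => exact (LocSet.subst_singleton _ _ _).trans (keys i).symm
      all_goals exact (LocSet.subst_singleton _ _ _).trans this.symm
    · have := keyt i
      cases a
      case ty =>
        cases i with
        | zero =>
          simp [TSub.comp, LSub.comp, TSub.up, TArg.inst, TArg.subst, TArg.sort, consIf_self, cons,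
            M.tySubst_tvar]
        | succ i => exact (M.tySubst_tvar _ _).trans (keyt i).symm
      all_goals exact (M.tySubst_tvar _ _).trans this.symm
  · have := key i
    cases a
    case prog =>
      cases i with
      | zero => rfl
      | succ i => exact (key i).symm
    all_goals exact this.symm

theorem CTy.inst_subst (σ : TSub M) (a : TArg M) (τ : CTy M) :
    (τ.subst a.inst).subst σ = (τ.subst (σ.up a.sort)).subst (a.subst σ).inst := by
  rw [subst_subst, subst_subst, a.inst_comp σ]

theorem LocSet.inst_subst (σ : TSub M) (a : TArg M) (ρ : LocSet L) :
    (ρ.subst a.inst.loc a.inst.set).subst σ.loc σ.set =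
      (ρ.subst (σ.up a.sort).loc (σ.up a.sort).set).subst (a.subst σ).inst.loc
        (a.subst σ).inst.set := by
  rw [LocSet.subst_subst, LocSet.subst_subst]
  have hl := congrArg (fun σ : TSub M => σ.loc) (a.inst_comp σ)
  have hs := congrArg (fun σ : TSub M => σ.set) (a.inst_comp σ)
  exact congrArg₂ (LocSet.subst · · ρ) hl hs

theorem LocSet.subst_shift (s : BSort) (σ : LSub L M.Ty) (ρ : LocSet L) :
    (ρ.rename (Ren.shift s)).subst (σ.up M s).loc (σ.up M s).set =
      (ρ.subst σ.loc σ.set).rename (Ren.shift s) := by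
  have key := LSub.shift_comp_up (M := M) s σ
  rw [LocSet.rename, LocSet.subst_subst, LocSet.subst_subst]
  exact congrArg₂ (LocSet.subst · · ρ) (congrArg LSub.loc key) (congrArg LSub.set key)

theorem Loc.subst_shift (s : BSort) (σ : LSub L M.Ty) (ℓ : Loc L) :
    (ℓ.rename (Ren.shift s)).subst (σ.up M s).loc = (ℓ.subst σ.loc).rename (Ren.shift s) := by
  have key := LSub.shift_comp_up (M := M) s σ
  rw [Loc.rename, Loc.subst_subst, Loc.subst_subst]
  exact congrArg (Loc.subst · ℓ) (congrArg LSub.loc key)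

theorem LocalLang.subst_shift (s : BSort) (σ : LSub L M.Ty) (t : M.Ty) :
    M.tySubst (σ.up M s) (M.tyRename (Ren.shift s) t) =
      M.tyRename (Ren.shift s) (M.tySubst σ t) := by
  rw [LocalLang.tyRename, M.tySubst_comp, M.tySubst_comp,
    LSub.shift_comp_up]

end Algebra

/-! ### Kinding -/

section Kinding

variable {L : Type u} [DecidableEq L] {M : LocalLang.{u, v, w} L}

theorem LocOk.subst {Γ Γ' : LCtx} {σ : LSub L M.Ty} (hσ : LSub.Ok M.WfTy Γ Γ' σ) {ℓ : Loc L}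
    (h : LocOk Γ ℓ) : LocOk Γ' (ℓ.subst σ.loc) := by
  cases ℓ with
  | var i => exact hσ.loc i h
  | const a => trivial

theorem SetOk.any {Γ : LCtx} {k : SetKind} {ρ : LocSet L} (h : SetOk Γ k ρ) :
    SetOk Γ .any ρ := by
  intro x hx
  have := h x hx
  cases x with
  | loc ℓ => exact this
  | var i => cases k <;> simp_all
  | top => rfl

theorem SetOk.union {Γ : LCtx} {k : SetKind} {ρ ρ' : LocSet L} (h : SetOk Γ k ρ)
    (h' : SetOk Γ k ρ') : SetOk Γ k (ρ ∪ ρ') := fun x hx =>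
  (Finset.mem_union.1 hx).elim (h x) (h' x)

theorem SetOk.subst {Γ Γ' : LCtx} {σ : LSub L M.Ty} (hσ : LSub.Ok M.WfTy Γ Γ' σ)
    {k : SetKind} {ρ : LocSet L} (h : SetOk Γ k ρ) : SetOk Γ' k (ρ.subst σ.loc σ.set) := by
  intro x hx
  obtain ⟨y, hy, hxy⟩ := LocSet.mem_subst.1 hx
  have hy' := h y hy
  cases y with
  | loc ℓ =>
    obtain rfl := Finset.mem_singleton.1 hxy
    exact LocOk.subst hσ hy'
  | var i =>
    rcases hy' with hy' | ⟨rfl, hy'⟩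
    · have := hσ.set i _ hy'
      cases k
      · exact this.any x hxy
      · exact this x hxy
    · exact hσ.set i _ hy' x hxy
  | top =>
    obtain rfl := Finset.mem_singleton.1 hxy
    exact hy'

/-- Weakening by a variable of kind `κ`. -/
theorem LSub.Ok.shift (Γ : KCtx L) (κ : Kind L) :
    LSub.Ok M.WfTy Γ.toLCtx (Γ.bind κ).toLCtx (LSub.ofRen (L := L) M.tvar (Ren.shift κ.sort)) where
  loc i hi := by
    cases κ <;> simp [LSub.ofRen, Ren.shift, Kind.sort, KCtx.bind, LocOk] <;> omega
  set i k hi := by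
    intro x hx
    obtain rfl := Finset.mem_singleton.1 hx
    cases κ <;> cases k <;> simp [Ren.shift, Kind.sort, KCtx.bind, hi]
  ty i hi := by
    refine M.wfTy_tvar _ _ ?_
    cases κ <;> simp [Ren.shift, Kind.sort, KCtx.bind] <;> omega

theorem LSub.Ok.id (Γ : LCtx) :
    LSub.Ok M.WfTy Γ Γ (LSub.ofRen (L := L) M.tvar fun _ i => i) where
  loc i hi := hi
  set i k hi := by
    intro x hx
    obtain rfl := Finset.mem_singleton.1 hx
    cases k <;> simp [hi]
  ty i hi := M.wfTy_tvar _ _ hi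

theorem KCtx.bind_subst_toLCtx (Γ : KCtx L) (κ : Kind L) (f : ℕ → Loc L) (g : ℕ → LocSet L) :
    (Γ.bind (κ.subst f g)).toLCtx = (Γ.bind κ).toLCtx := by
  cases κ <;> rfl

theorem LSub.Ok.up {Γ Γ' : KCtx L} {σ : LSub L M.Ty}
    (hσ : LSub.Ok M.WfTy Γ.toLCtx Γ'.toLCtx σ) (κ : Kind L) :
    LSub.Ok M.WfTy (Γ.bind κ).toLCtx (Γ'.bind κ).toLCtx (σ.up M κ.sort) := by
  have hs := LSub.Ok.shift (M := M) Γ' κ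
  refine ⟨fun i hi => ?_, fun i k hi => ?_, fun i hi => ?_⟩
  · have key : ∀ i < Γ.loc,
        LocOk (Γ'.bind κ).toLCtx ((σ.loc i).rename (Ren.shift κ.sort)) :=
      fun i hi => LocOk.subst hs (hσ.loc i hi)
    cases κ
    case loc =>
      cases i with
      | zero => exact Nat.succ_pos _
      | succ i => exact key i (Nat.lt_of_succ_lt_succ hi)
    all_goals exact key i hi
  · have key : ∀ i k, Γ.set[i]? = some k →
        SetOk (Γ'.bind κ).toLCtx k ((σ.set i).rename (Ren.shift κ.sort)) :=
      fun i k hi => SetOk.subst hs (hσ.set i k hi)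
    cases κ
    case set k' =>
      cases i with
      | zero =>
        intro x hx
        obtain rfl := Finset.mem_singleton.1 hx
        have hi : k' = k := by simpa [KCtx.bind] using hi
        subst hi
        cases k' <;> simp [KCtx.bind]
      | succ i => exact key i k hi
    all_goals exact key i k hi
  · have key : ∀ i < Γ.ty,
        M.WfTy (Γ'.bind κ).toLCtx (M.tyRename (Ren.shift κ.sort) (σ.ty i)) :=
      fun i hi => M.wfTy_subst _ _ _ _ hs (hσ.ty i hi)
    cases κ
    case lty =>
      cases i with
      | zero => exact M.wfTy_tvar _ _ (Nat.succ_pos _)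
      | succ i => exact key i (Nat.lt_of_succ_lt_succ hi)
    all_goals exact key i hi

/-- `σ` maps the type-level variables of `Γ` to objects of the same kinds over `Γ'`. -/
structure TSub.Ok (Γ Γ' : KCtx L) (σ : TSub M) : Prop where
  toLSub : LSub.Ok M.WfTy Γ.toLCtx Γ'.toLCtx σ.toLSub
  prog : ∀ i ρ, Γ.prog[i]? = some ρ → Kinded Γ' (σ.prog i) (ρ.subst σ.loc σ.set)

theorem KindOk.subst {Γ Γ' : KCtx L} {σ : TSub M} (hσ : TSub.Ok Γ Γ' σ) {κ : Kind L}
    (h : KindOk Γ κ) : KindOk Γ' (κ.subst σ.loc σ.set) := by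
  cases κ <;> first | trivial | exact SetOk.subst hσ.toLSub h

theorem KCtx.bind_prog (Γ : KCtx L) (κ : Kind L) (i : ℕ) :
    (Γ.bind κ).prog[Ren.shift κ.sort .prog i]? =
      Γ.prog[i]?.map (LocSet.rename (Ren.shift κ.sort)) := by
  cases κ <;> simp [KCtx.bind, Ren.shift, Kind.sort]

theorem TSub.subst_up_of_ne {s : BSort} (hl : s ≠ .loc) (hs : s ≠ .set) (σ : TSub M)
    (ρ : LocSet L) : ρ.subst (σ.up s).loc (σ.up s).set = ρ.subst σ.loc σ.set := by
  have h₁ : (σ.up s).loc = σ.loc := by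
    funext i
    simp [TSub.up, consIf_of_ne hl, Loc.rename, Ren.shift_of_ne (Ne.symm hl), Loc.subst_var]
  have h₂ : (σ.up s).set = σ.set := by
    funext i
    simp only [TSub.up, consIf_of_ne hs]
    exact LocSet.rename_eq_self (Ren.shift_of_ne (Ne.symm hl)) (Ren.shift_of_ne (Ne.symm hs)) _
  rw [h₁, h₂]

theorem LocSet.rename_shift_of_ne {s : BSort} (hl : s ≠ .loc) (hs : s ≠ .set) (ρ : LocSet L) :
    ρ.rename (Ren.shift s) = ρ :=
  rename_eq_self (Ren.shift_of_ne (Ne.symm hl)) (Ren.shift_of_ne (Ne.symm hs)) _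

/-- A well-kinded substitution stays so under a binder, if its program types can be
weakened. -/
theorem TSub.Ok.up_of {Γ Γ' : KCtx L} {σ : TSub M} (hσ : TSub.Ok Γ Γ' σ) (κ : Kind L)
    (hw : ∀ i ρ, Kinded Γ' (σ.prog i) ρ → Kinded (Γ'.bind (κ.subst σ.loc σ.set))
      ((σ.prog i).rename (Ren.shift κ.sort)) (ρ.rename (Ren.shift κ.sort))) :
    TSub.Ok (Γ.bind κ) (Γ'.bind (κ.subst σ.loc σ.set)) (σ.up κ.sort) := by
  refine ⟨?_, fun i ρ hi => ?_⟩
  · rw [KCtx.bind_subst_toLCtx]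
    exact hσ.toLSub.up κ
  · have key : ∀ i ρ, Γ.prog[i]? = some ρ → Kinded (Γ'.bind (κ.subst σ.loc σ.set))
        ((σ.prog i).rename (Ren.shift κ.sort))
        ((ρ.rename (Ren.shift κ.sort)).subst (σ.up κ.sort).loc (σ.up κ.sort).set) := by
      intro i ρ hi
      have := hw i _ (hσ.prog i ρ hi)
      rwa [← LocSet.subst_shift (M := M)] at this
    cases κ
    case prog ρ' =>
      cases i with
      | zero =>
        simp only [KCtx.bind, List.getElem?_cons_zero, Option.some.injEq] at hi
        subst hi
        refine Kinded.var ?_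
        rw [Kind.sort, TSub.subst_up_of_ne (by decide) (by decide)]
        rfl
      | succ i =>
        simp only [KCtx.bind, List.getElem?_cons_succ, List.getElem?_map,
          Option.map_eq_some_iff] at hi
        obtain ⟨ρ₀, h₀, rfl⟩ := hi
        exact key i ρ₀ h₀
    all_goals
      simp only [KCtx.bind, List.getElem?_map, Option.map_eq_some_iff] at hi
      obtain ⟨ρ₀, h₀, rfl⟩ := hi
      exact key i ρ₀ h₀

/-- Kinding is preserved by every class `S` of well-kinded substitutions that is closed
under binders. Applied first to renamings, and then to all substitutions. -/
theorem Kinded.subst_of_closed (S : KCtx L → KCtx L → TSub M → Prop)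
    (hS : ∀ Γ Γ' σ, S Γ Γ' σ → TSub.Ok Γ Γ' σ)
    (hup : ∀ Γ Γ' σ κ, S Γ Γ' σ → S (Γ.bind κ) (Γ'.bind (κ.subst σ.loc σ.set)) (σ.up κ.sort))
    {Γ Γ' : KCtx L} {σ : TSub M} {τ : CTy M} {ρ : LocSet L} (h : Kinded Γ τ ρ)
    (hσ : S Γ Γ' σ) : Kinded Γ' (τ.subst σ) (ρ.subst σ.loc σ.set) := by
  induction h generalizing Γ' σ with
  | var h => exact (hS _ _ _ hσ).prog _ _ h
  | located ht hρ =>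
    have ok := (hS _ _ _ hσ).toLSub
    exact .located (M.wfTy_subst _ _ _ _ ok ht) (SetOk.subst ok hρ)
  | arrow _ _ hρ ih₁ ih₂ =>
    simp only [LocSet.subst_union, CTy.subst]
    exact .arrow (ih₁ hσ) (ih₂ hσ) (SetOk.subst (hS _ _ _ hσ).toLSub hρ)
  | prod _ _ ih₁ ih₂ =>
    simp only [LocSet.subst_union, CTy.subst]
    exact .prod (ih₁ hσ) (ih₂ hσ)
  | sum _ _ hρ hs ih₁ ih₂ =>
    refine .sum (ih₁ hσ) (ih₂ hσ) (SetOk.subst (hS _ _ _ hσ).toLSub hρ) ?_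
    rw [← LocSet.subst_union]
    exact hs.subst _ _
  | @mu Γ τ ρ ρ' hρ _ hs ih =>
    have := ih (hup _ _ _ _ hσ)
    rw [Kind.sort, TSub.subst_up_of_ne (by decide) (by decide)] at this
    exact .mu (SetOk.subst (hS _ _ _ hσ).toLSub hρ) this (hs.subst _ _)
  | @allLoc Γ κ τ ρ ρ' hκ _ hρ ih =>
    rw [LocSet.subst_all]
    have ok := hup _ _ _ κ hσ
    refine .allLoc (by rwa [Kind.sort_subst]) (ih ok) (SetOk.subst (hS _ _ _ ok).toLSub hρ)
  | @all Γ κ τ ρ ρ' hκ hs _ hρ ih =>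
    have ok := hup _ _ _ κ hσ
    have hl : κ.sort ≠ .loc := by rcases hs with hs | hs <;> simp [hs]
    have hs' : κ.sort ≠ .set := by rcases hs with hs | hs <;> simp [hs]
    rw [LocSet.subst_union, ← TSub.subst_up_of_ne hl hs' σ ρ,
      ← TSub.subst_up_of_ne hl hs' σ ρ']
    exact .all (hκ.subst (hS _ _ _ hσ)) (by rwa [Kind.sort_subst]) (ih ok)
      (SetOk.subst (hS _ _ _ ok).toLSub hρ)

theorem Kinded.var_inv {Γ : KCtx L} {i : ℕ} {ρ : LocSet L}
    (h : Kinded Γ (.var i : CTy M) ρ) : Γ.prog[i]? = some ρ := by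
  cases h; assumption

theorem Kinded.rename {Γ Γ' : KCtx L} {r : Ren} {τ : CTy M} {ρ : LocSet L}
    (h : Kinded Γ τ ρ) (hr : TSub.Ok Γ Γ' (TSub.ofRen r : TSub M)) :
    Kinded Γ' (τ.rename r) (ρ.rename r) := by
  rw [CTy.rename_eq_subst]
  refine h.subst_of_closed (fun Γ Γ' σ => TSub.Ok Γ Γ' σ ∧ ∃ r, σ = TSub.ofRen r)
    (fun _ _ _ h => h.1) ?_ ⟨hr, r, rfl⟩
  rintro Γ Γ' _ κ ⟨ok, r, rfl⟩
  refine ⟨ok.up_of κ fun i ρ hi => ?_, _, TSub.up_ofRen _ _⟩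
  refine Kinded.var ?_
  have := KCtx.bind_prog Γ' (κ.subst (TSub.ofRen r : TSub M).loc (TSub.ofRen r : TSub M).set)
    (r .prog i)
  rw [Kind.sort_subst] at this
  rw [this, hi.var_inv]
  rfl

theorem TSub.Ok.shift (Γ : KCtx L) (κ : Kind L) :
    TSub.Ok Γ (Γ.bind κ) (TSub.ofRen (Ren.shift κ.sort) : TSub M) where
  toLSub := LSub.Ok.shift Γ κ
  prog i ρ hi := Kinded.var (by rw [KCtx.bind_prog, hi]; rfl)

theorem Kinded.shift {Γ : KCtx L} {τ : CTy M} {ρ : LocSet L} (h : Kinded Γ τ ρ) (κ : Kind L) :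
    Kinded (Γ.bind κ) (τ.rename (Ren.shift κ.sort)) (ρ.rename (Ren.shift κ.sort)) :=
  h.rename (TSub.Ok.shift Γ κ)

theorem TSub.Ok.up {Γ Γ' : KCtx L} {σ : TSub M} (hσ : TSub.Ok Γ Γ' σ) (κ : Kind L) :
    TSub.Ok (Γ.bind κ) (Γ'.bind (κ.subst σ.loc σ.set)) (σ.up κ.sort) :=
  hσ.up_of κ fun _ _ h => by simpa only [Kind.sort_subst] using h.shift (κ.subst σ.loc σ.set)

theorem Kinded.subst {Γ Γ' : KCtx L} {σ : TSub M} {τ : CTy M} {ρ : LocSet L}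
    (h : Kinded Γ τ ρ) (hσ : TSub.Ok Γ Γ' σ) :
    Kinded Γ' (τ.subst σ) (ρ.subst σ.loc σ.set) :=
  h.subst_of_closed TSub.Ok (fun _ _ _ h => h) (fun _ _ _ κ h => h.up κ) hσ

theorem TArgOk.subst {Γ Γ' : KCtx L} {σ : TSub M} (hσ : TSub.Ok Γ Γ' σ) {a : TArg M}
    {κ : Kind L} (h : TArgOk Γ a κ) : TArgOk Γ' (a.subst σ) (κ.subst σ.loc σ.set) := by
  cases h with
  | loc h => exact .loc (LocOk.subst hσ.toLSub h)
  | set h => exact .set (SetOk.subst hσ.toLSub h)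
  | ty h => exact .ty (M.wfTy_subst _ _ _ _ hσ.toLSub h)
  | prog h => exact .prog (h.subst hσ)

theorem TArgOk.sort_eq {Γ : KCtx L} {a : TArg M} {κ : Kind L} (h : TArgOk Γ a κ) :
    a.sort = κ.sort := by cases h <;> rfl

theorem TSub.Ok.id (Γ : KCtx L) : TSub.Ok Γ Γ (TSub.id : TSub M) where
  toLSub := LSub.Ok.id Γ.toLCtx
  prog i ρ hi := Kinded.var (by rw [hi]; exact congrArg some (LocSet.subst_var ρ).symm)

/-- Instantiating the variable bound last by an argument of the same kind. -/
theorem TArgOk.inst {Γ : KCtx L} {a : TArg M} {κ : Kind L} (h : TArgOk Γ a κ) :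
    TSub.Ok (Γ.bind κ) Γ a.inst := by
  have idl := LSub.Ok.id (M := M) Γ.toLCtx
  refine ⟨?_, ?_⟩
  · refine ⟨fun i hi => ?_, fun i k hi => ?_, fun i hi => ?_⟩
    · cases h
      case loc h =>
        cases i with
        | zero => exact h
        | succ i => exact Nat.lt_of_succ_lt_succ hi
      all_goals exact hi
    · cases h
      case set h =>
        cases i with
        | zero =>
          simp only [KCtx.bind, List.getElem?_cons_zero, Option.some.injEq] at hi
          exact hi ▸ h
        | succ i => exact idl.set i k hi
      all_goals exact idl.set i k hi
    · cases h
      case ty h =>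
        cases i with
        | zero => exact h
        | succ i => exact idl.ty i (Nat.lt_of_succ_lt_succ hi)
      all_goals exact idl.ty i hi
  · intro i ρ hi
    have key : ∀ i ρ₀, Γ.prog[i]? = some ρ₀ → Kinded Γ (.var i : CTy M)
        ((ρ₀.rename (Ren.shift κ.sort)).subst a.inst.loc a.inst.set) := fun i ρ₀ h₀ => by
      rw [← h.sort_eq, LocSet.shift_inst]; exact .var h₀
    cases h
    case prog τ ρ' h =>
      cases i with
      | zero =>
        simp only [KCtx.bind, List.getElem?_cons_zero, Option.some.injEq] at hi
        subst hi
        have : ρ'.subst (TArg.prog τ).inst.loc (TArg.prog τ).inst.set = ρ' :=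
          LocSet.subst_var ρ'
        rw [this]
        exact h
      | succ i =>
        simp only [KCtx.bind, List.getElem?_cons_succ, List.getElem?_map,
          Option.map_eq_some_iff] at hi
        obtain ⟨ρ₀, h₀, rfl⟩ := hi
        exact key i ρ₀ h₀
    all_goals
      simp only [KCtx.bind, List.getElem?_map, Option.map_eq_some_iff] at hi
      obtain ⟨ρ₀, h₀, rfl⟩ := hi
      exact key i ρ₀ h₀

/-- The kind of a program type is unique. -/
theorem Kinded.unique {Γ : KCtx L} {τ : CTy M} {ρ ρ' : LocSet L} (h : Kinded Γ τ ρ)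
    (h' : Kinded Γ τ ρ') : ρ = ρ' := by
  induction h generalizing ρ' with
  | var h => exact Option.some.inj (h.symm.trans h'.var_inv)
  | located => cases h'; rfl
  | arrow _ _ _ ih₁ ih₂ =>
    cases h' with
    | arrow h₁ h₂ => rw [ih₁ h₁, ih₂ h₂]
  | prod _ _ ih₁ ih₂ =>
    cases h' with
    | prod h₁ h₂ => rw [ih₁ h₁, ih₂ h₂]
  | sum => cases h'; rfl
  | mu => cases h'; rfl
  | allLoc hκ _ _ ih =>
    cases h' with
    | allLoc => rfl
    | all _ hs => rcases hκ with hκ | hκ <;> simp [hκ] at hs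
  | all _ hs _ _ ih =>
    cases h' with
    | allLoc hκ => rcases hκ with hκ | hκ <;> simp [hκ] at hs
    | all _ _ h => rw [ih h]

theorem SetOk.of_bind {Γ : KCtx L} {κ : Kind L} (hl : κ.sort ≠ .loc) (hs : κ.sort ≠ .set)
    {k : SetKind} {ρ : LocSet L} : SetOk (Γ.bind κ).toLCtx k ρ ↔ SetOk Γ.toLCtx k ρ := by
  cases κ
  · exact absurd rfl hl
  · exact absurd rfl hs
  · exact Iff.rfl
  · exact Iff.rfl

theorem Kinded.setOk {Γ : KCtx L} {τ : CTy M} {ρ : LocSet L} (h : Kinded Γ τ ρ)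
    (hΓ : ∀ ρ ∈ Γ.prog, SetOk Γ.toLCtx .any ρ) : SetOk Γ.toLCtx .any ρ := by
  induction h with
  | var h => exact hΓ _ (List.mem_of_getElem? h)
  | located _ hρ => exact hρ
  | arrow _ _ hρ ih₁ ih₂ => exact ((ih₁ hΓ).union (ih₂ hΓ)).union hρ
  | prod _ _ ih₁ ih₂ => exact (ih₁ hΓ).union (ih₂ hΓ)
  | sum _ _ hρ => exact hρ
  | mu hρ => exact hρ
  | allLoc =>
    intro x hx
    obtain rfl := Finset.mem_singleton.1 hx
    rfl
  | @all Γ κ τ ρ ρ' hκ hs _ hρ ih =>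
    have hl : κ.sort ≠ .loc := by rcases hs with hs | hs <;> simp [hs]
    have hs' : κ.sort ≠ .set := by rcases hs with hs | hs <;> simp [hs]
    refine ((SetOk.of_bind hl hs').1 hρ).union ((SetOk.of_bind hl hs').1 (ih fun ρ₀ h₀ => ?_))
    rw [SetOk.of_bind hl hs']
    have hmap : ρ₀ ∈ Γ.prog.map (LocSet.rename (Ren.shift κ.sort)) → SetOk Γ.toLCtx .any ρ₀ := by
      intro h
      obtain ⟨ρ₁, h₁, rfl⟩ := List.mem_map.1 h
      rw [LocSet.rename_shift_of_ne hl hs']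
      exact hΓ _ h₁
    cases κ
    case prog ρp =>
      rcases List.mem_cons.1 h₀ with rfl | h₀
      · exact hκ
      · exact hmap h₀
    all_goals exact hmap h₀

end Kinding

/-! ### Participants and running threads -/

section Participants

variable {L : Type u} [DecidableEq L] {M : LocalLang.{u, v, w} L}

namespace LocSet

theorem const_mem_subst {f : ℕ → Loc L} {g : ℕ → LocSet L} {ρ : LocSet L} {a : L}
    (h : Atom.loc (.const a) ∈ ρ.subst f g) : Atom.loc (.const a) ∈ ρ ∨
      (∃ i, f i = .const a) ∨ ∃ i, Atom.loc (.const a) ∈ g i := by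
  obtain ⟨y, hy, hxy⟩ := mem_subst.1 h
  cases y with
  | loc ℓ =>
    have h := Atom.loc.inj (Finset.mem_singleton.1 hxy)
    cases ℓ with
    | var i => exact .inr (.inl ⟨i, h.symm⟩)
    | const b => rw [h]; exact .inl hy
  | var i => exact .inr (.inr ⟨i, hxy⟩)
  | top => simp [Atom.subst] at hxy

theorem const_mem_subst_of_mem (f : ℕ → Loc L) (g : ℕ → LocSet L) {ρ : LocSet L} {a : L}
    (h : Atom.loc (.const a) ∈ ρ) : Atom.loc (.const a) ∈ ρ.subst f g :=
  mem_subst.2 ⟨_, h, Finset.mem_singleton_self _⟩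

theorem const_mem_rename {r : Ren} {ρ : LocSet L} {a : L} :
    Atom.loc (.const a) ∈ ρ.rename r ↔ Atom.loc (.const a) ∈ ρ := by
  refine ⟨fun h => ?_, const_mem_subst_of_mem _ _⟩
  rcases const_mem_subst h with h | ⟨i, h⟩ | ⟨i, h⟩
  · exact h
  · simp at h
  · simp at h

theorem const_mem_drop {s : BSort} {ρ : LocSet L} {a : L} :
    Atom.loc (.const a) ∈ ρ.drop s ↔ Atom.loc (.const a) ∈ ρ := by
  cases s <;> simp [drop, const_mem_rename]

theorem drop_mono (s : BSort) {ρ ρ' : LocSet L} (h : ρ ⊆ ρ') : ρ.drop s ⊆ ρ'.drop s := by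
  cases s
  · exact subst_mono _ _ (Finset.erase_subset_erase _ h)
  · exact subst_mono _ _ (Finset.erase_subset_erase _ h)
  all_goals exact h

theorem rename_shift_lower (s : BSort) (ρ : LocSet L) :
    (ρ.rename (Ren.shift s)).rename (Ren.lower s) = ρ := by
  rw [rename, rename, subst_subst]
  refine Eq.trans ?_ (subst_var ρ)
  congr 1 <;> funext i <;> cases s <;>
    simp [Loc.subst, subst_singleton, Atom.subst, Ren.shift, Ren.lower]

/-- An element of `ρ[σ]` that comes from an element of `ρ` other than the dropped variable
is still there when that variable is dropped. -/
theorem rename_lower_subset_drop_subst (σ : LSub L M.Ty) {s : BSort} (hs : s = .loc ∨ s = .set)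
    {ρ : LocSet L} {y : Atom L} (hy : y ∈ ρ)
    (hne : y ≠ if s = .loc then .loc (.var 0) else .var 0) :
    rename (Ren.lower s) (y.subst (σ.up M s).loc (σ.up M s).set) ⊆
      (ρ.drop s).subst σ.loc σ.set := by
  have key : ∀ x : Atom L, x ∈ ρ.drop s → y.subst (σ.up M s).loc (σ.up M s).set =
      rename (Ren.shift s) (x.subst σ.loc σ.set) →
      rename (Ren.lower s) (y.subst (σ.up M s).loc (σ.up M s).set) ⊆
        (ρ.drop s).subst σ.loc σ.set := by
    intro x hx he
    rw [he, rename_shift_lower]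
    exact fun z hz => mem_subst.2 ⟨x, hx, hz⟩
  rcases hs with rfl | rfl
  · cases y with
    | loc ℓ =>
      refine key (.loc (ℓ.rename (Ren.lower .loc)))
        (mem_subst.2 ⟨_, Finset.mem_erase.2 ⟨hne, hy⟩, Finset.mem_singleton_self _⟩) ?_
      rcases ℓ with (_ | i) | a
      · simp at hne
      · rfl
      · rfl
    | var i =>
      exact key (.var i)
        (mem_subst.2 ⟨_, Finset.mem_erase.2 ⟨hne, hy⟩, Finset.mem_singleton_self _⟩) rfl
    | top =>
      exact key .top
        (mem_subst.2 ⟨_, Finset.mem_erase.2 ⟨hne, hy⟩, Finset.mem_singleton_self _⟩) rfl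
  · cases y with
    | loc ℓ =>
      refine key (.loc ℓ)
        (mem_subst.2 ⟨_, Finset.mem_erase.2 ⟨hne, hy⟩, ?_⟩) ?_
      · refine Finset.mem_singleton.2 (congrArg Atom.loc ?_)
        exact (Loc.subst_var ℓ).symm
      · rcases ℓ with i | a <;> rfl
    | var i =>
      rcases i with _ | i
      · simp at hne
      · exact key (.var i)
          (mem_subst.2 ⟨_, Finset.mem_erase.2 ⟨hne, hy⟩, Finset.mem_singleton_self _⟩) rfl
    | top =>
      exact key .top
        (mem_subst.2 ⟨_, Finset.mem_erase.2 ⟨hne, hy⟩, Finset.mem_singleton_self _⟩) rfl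

theorem drop_subst_up (σ : LSub L M.Ty) {s : BSort} (hs : s = .loc ∨ s = .set)
    (ρ : LocSet L) : (ρ.subst (σ.up M s).loc (σ.up M s).set).drop s ⊆
      (ρ.drop s).subst σ.loc σ.set := by
  intro x hx
  have : ∃ z ∈ ρ.subst (σ.up M s).loc (σ.up M s).set,
      z ≠ (if s = .loc then Atom.loc (.var 0) else .var 0) ∧
        x ∈ rename (Ren.lower s) {z} := by
    rcases hs with rfl | rfl
    all_goals
      obtain ⟨z, hz, hxz⟩ := mem_subst.1 hx
      exact ⟨z, Finset.mem_of_mem_erase hz, Finset.ne_of_mem_erase hz, by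
        rw [rename, subst_singleton]; exact hxz⟩
  obtain ⟨z, hz, hne, hxz⟩ := this
  obtain ⟨y, hy, hzy⟩ := mem_subst.1 hz
  refine rename_lower_subset_drop_subst σ hs hy ?_
    (subst_mono _ _ (Finset.singleton_subset_iff.2 hzy) hxz)
  rintro rfl
  apply hne
  rcases hs with rfl | rfl
  · exact Finset.mem_singleton.1 hzy
  · exact Finset.mem_singleton.1 hzy

/-- Instantiating a location variable by `a` adds at most `a` to the other elements. -/
theorem subst_inst_loc_subset (a : L) (ρ : LocSet L) :
    ρ.subst (TArg.loc (.const a) : TArg M).inst.loc (TArg.loc (.const a) : TArg M).inst.set ⊆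
      ρ.drop .loc ∪ single (.const a) := by
  intro x hx
  obtain ⟨y, hy, hxy⟩ := mem_subst.1 hx
  by_cases hne : y = .loc (.var 0)
  · subst hne
    exact Finset.mem_union_right _ hxy
  · refine Finset.mem_union_left _ (mem_subst.2 ⟨y, Finset.mem_erase.2 ⟨hne, hy⟩, ?_⟩)
    rcases y with ((_ | i) | a) | i | _
    · simp at hne
    all_goals exact hxy

theorem subst_inst_set_subset (ρ' ρ : LocSet L) :
    ρ.subst (TArg.set ρ' : TArg M).inst.loc (TArg.set ρ' : TArg M).inst.set ⊆
      ρ.drop .set ∪ ρ' := by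
  intro x hx
  obtain ⟨y, hy, hxy⟩ := mem_subst.1 hx
  by_cases hne : y = .var 0
  · subst hne
    exact Finset.mem_union_right _ hxy
  · refine Finset.mem_union_left _ (mem_subst.2 ⟨y, Finset.mem_erase.2 ⟨hne, hy⟩, ?_⟩)
    rcases y with (i | a) | (_ | i) | _
    · exact hxy
    · exact hxy
    · simp at hne
    all_goals exact hxy

end LocSet

theorem LocalLang.expRename_expRename (r r' : Ren) (e : M.Exp) :
    M.expRename r' (M.expRename r e) = M.expRename (fun s i => r' s (r s i)) e := by
  simp only [LocalLang.expRename, M.expSubst_comp, M.expSubst_evar]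
  congr 1
  ext1 i
  · rfl
  · simp [LSub.comp, LSub.ofRen, LocSet.subst_singleton, Atom.subst]
  · simp [LSub.comp, LSub.ofRen, M.tySubst_tvar]

theorem LocalLang.tyRename_tyRename (r r' : Ren) (t : M.Ty) :
    M.tyRename r' (M.tyRename r t) = M.tyRename (fun s i => r' s (r s i)) t := by
  simp only [LocalLang.tyRename, M.tySubst_comp]
  congr 1
  ext1 i
  · rfl
  · simp [LSub.comp, LSub.ofRen, LocSet.subst_singleton, Atom.subst]
  · simp [LSub.comp, LSub.ofRen, M.tySubst_tvar]

theorem LocSet.rename_rename (r r' : Ren) (ρ : LocSet L) :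
    (ρ.rename r).rename r' = ρ.rename fun s i => r' s (r s i) := by
  rw [rename, rename, subst_subst, rename]
  rfl

theorem Loc.rename_rename (r r' : Ren) (ℓ : Loc L) :
    (ℓ.rename r).rename r' = ℓ.rename fun s i => r' s (r s i) := by
  cases ℓ <;> rfl

theorem Kind.rename_rename (r r' : Ren) (κ : Kind L) :
    (κ.rename r).rename r' = κ.rename fun s i => r' s (r s i) := by
  cases κ with
  | prog ρ => exact congrArg Kind.prog (LocSet.rename_rename r r' ρ)
  | _ => rfl

theorem Kind.sort_rename (r : Ren) (κ : Kind L) : (κ.rename r).sort = κ.sort :=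
  Kind.sort_subst _ _ κ

theorem TArg.rename_rename (r r' : Ren) (a : TArg M) :
    (a.rename r).rename r' = a.rename fun s i => r' s (r s i) := by
  cases a <;> simp only [rename, Loc.rename_rename, LocSet.rename_rename,
    LocalLang.tyRename_tyRename, CTy.rename_rename]

theorem Ren.up_comp (s : BSort) (r r' : Ren) :
    (fun s' i => Ren.up s r' s' (Ren.up s r s' i)) = Ren.up s fun s' i => r' s' (r s' i) := by
  funext s' i
  by_cases h : s' = s
  · cases i <;> simp [Ren.up, h]
  · simp [Ren.up, h]

theorem Chor.rename_rename (r r' : Ren) (C : Chor M) :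
    (C.rename r).rename r' = C.rename fun s i => r' s (r s i) := by
  induction C generalizing r r' <;>
    simp only [rename, LocSet.rename_rename, LocalLang.expRename_expRename, Loc.rename_rename,
      LocalLang.tyRename_tyRename, Kind.rename_rename, Kind.sort_rename, TArg.rename_rename,
      Ren.up_comp, *]

namespace Sub

theorem ext' {σ σ' : Sub M} (h₁ : σ.toTSub = σ'.toTSub) (h₂ : ∀ i, σ.lv i = σ'.lv i)
    (h₃ : ∀ i, σ.pv i = σ'.pv i) : σ = σ' := by
  cases σ; cases σ'
  simp only [mk.injEq]
  exact ⟨h₁, funext h₂, funext h₃⟩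

/-- The renaming `r` as a substitution. -/
def ofRen (r : Ren) : Sub M :=
  { TSub.ofRen r with lv := fun i => M.evar (r .lv i), pv := fun i => .var (r .pv i) }

theorem up_ofRen (s : BSort) (r : Ren) : (ofRen r : Sub M).up s = ofRen (Ren.up s r) := by
  refine ext' (TSub.up_ofRen s r) (fun i => ?_) fun i => ?_
  · by_cases h : s = .lv
    · subst h
      cases i <;> simp [ofRen, up, consIf_self, cons, Ren.up, LocalLang.expRename,
        M.expSubst_evar, Ren.shift]
    · simp [ofRen, up, consIf_of_ne h, Ren.up, LocalLang.expRename, M.expSubst_evar, Ren.shift,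
        Ne.symm h]
  · by_cases h : s = .pv
    · subst h; cases i <;> simp [ofRen, up, consIf_self, cons, Ren.up, Chor.rename, Ren.shift]
    · simp [ofRen, up, consIf_of_ne h, Ren.up, Chor.rename, Ren.shift, Ne.symm h]

end Sub

theorem Chor.rename_eq_subst (r : Ren) (C : Chor M) : C.rename r = C.subst (Sub.ofRen r) := by
  induction C generalizing r <;>
    simp only [rename, subst, Sub.up_ofRen, TArg.rename_eq_subst, *] <;> rfl

/-- Going under a local variable and under a location variable commute. -/
theorem Sub.up_lv_up_loc (σ : Sub M) : (σ.up .lv).up .loc = (σ.up .loc).up .lv := by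
  have hr : (fun s i => Ren.shift .loc s (Ren.shift .lv s i)) =
      fun s i => Ren.shift .lv s (Ren.shift .loc s i) := by
    funext s i; cases s <;> simp [Ren.shift]
  refine ext' ?_ (fun i => ?_) fun i => ?_
  · change (σ.toTSub.up .lv).up .loc = (σ.toTSub.up .loc).up .lv
    rw [TSub.up_lv, TSub.up_lv]
  · cases i with
    | zero => exact M.expSubst_evar _ _ _
    | succ i =>
      change M.expRename _ (M.expRename _ _) = M.expRename _ (M.expRename _ _)
      rw [M.expRename_expRename, M.expRename_expRename, hr]
  · change ((σ.pv i).rename _).rename _ = ((σ.pv i).rename _).rename _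
    rw [Chor.rename_rename, Chor.rename_rename, hr]

namespace Chor

open Classical in
/-- The participants of a choreography: the locations that take part in the actions that
occur in it. Values have none, and the thread that a `killAfter` is going to end is not a
participant of the surrounding choreography. -/
noncomputable def parts : Chor M → LocSet L
  | .var _ => ∅
  | .done ρ e => if M.Val e then ∅ else ρ
  | .func _ _ => ∅
  | .app ρ C₁ C₂ => C₁.parts ∪ C₂.parts ∪ ρ
  | .tfun _ _ => ∅
  | .tapp ρ C _ => C.parts ∪ ρ
  | .fold _ C => C.parts
  | .unfold ρ C => C.parts ∪ ρ
  | .pair _ C₁ C₂ => C₁.parts ∪ C₂.parts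
  | .fst ρ C => C.parts ∪ ρ
  | .snd ρ C => C.parts ∪ ρ
  | .inl _ C => C.parts
  | .inr _ C => C.parts
  | .case ρ C C₁ C₂ => C.parts ∪ C₁.parts ∪ C₂.parts ∪ ρ
  | .localCase ρ C C₁ C₂ => C.parts ∪ C₁.parts ∪ C₂.parts ∪ ρ
  | .letIn ρ _ C₁ C₂ => C₁.parts ∪ C₂.parts ∪ ρ
  | .letLoc ρ C₁ C₂ => C₁.parts ∪ C₂.parts.drop .loc ∪ ρ
  | .letSet ρ _ C₁ C₂ => C₁.parts ∪ C₂.parts.drop .set ∪ ρ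
  | .send C ℓ ρ => C.parts ∪ LocSet.single ℓ ∪ ρ
  | .sync ℓ _ ρ C => LocSet.single ℓ ∪ ρ ∪ C.parts
  | .fork ℓ C => LocSet.single ℓ ∪ C.parts.drop .loc
  | .killAfter a C => C.parts.erase (.loc (.const a))

/-- The threads that a choreography is going to kill, including those in the bodies of
functions. -/
def kills : Chor M → Finset L
  | .var _ => ∅
  | .done _ _ => ∅
  | .func _ C => C.kills
  | .app _ C₁ C₂ => C₁.kills ∪ C₂.kills
  | .tfun _ C => C.kills
  | .tapp _ C _ => C.kills
  | .fold _ C => C.kills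
  | .unfold _ C => C.kills
  | .pair _ C₁ C₂ => C₁.kills ∪ C₂.kills
  | .fst _ C => C.kills
  | .snd _ C => C.kills
  | .inl _ C => C.kills
  | .inr _ C => C.kills
  | .case _ C C₁ C₂ => C.kills ∪ (C₁.kills ∪ C₂.kills)
  | .localCase _ C C₁ C₂ => C.kills ∪ (C₁.kills ∪ C₂.kills)
  | .letIn _ _ C₁ C₂ => C₁.kills ∪ C₂.kills
  | .letLoc _ C₁ C₂ => C₁.kills ∪ C₂.kills
  | .letSet _ _ C₁ C₂ => C₁.kills ∪ C₂.kills
  | .send C _ _ => C.kills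
  | .sync _ _ _ C => C.kills
  | .fork _ C => C.kills
  | .killAfter a C => insert a C.kills

/-- No thread that is going to be killed inside `C` is a participant of `C`. -/
def Sep (C : Chor M) : Prop := ∀ a ∈ C.kills, Atom.loc (.const a) ∉ C.parts

/-- Threads are used linearly: function bodies have no running threads, different
subterms have different ones, and no thread is a participant outside of its `killAfter`.
The branches of a case distinction may share threads, since they step together. -/
def Lin : Chor M → Prop
  | .var _ => True
  | .done _ _ => True
  | .func _ C => C.kills = ∅
  | .app ρ C₁ C₂ => C₁.Lin ∧ C₂.Lin ∧ Disjoint C₁.kills C₂.kills ∧ (app ρ C₁ C₂).Sep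
  | .tfun _ C => C.kills = ∅
  | .tapp ρ C a => C.Lin ∧ (tapp ρ C a).Sep
  | .fold ρ C => C.Lin ∧ (fold ρ C).Sep
  | .unfold ρ C => C.Lin ∧ (unfold ρ C).Sep
  | .pair ρ C₁ C₂ => C₁.Lin ∧ C₂.Lin ∧ Disjoint C₁.kills C₂.kills ∧ (pair ρ C₁ C₂).Sep
  | .fst ρ C => C.Lin ∧ (fst ρ C).Sep
  | .snd ρ C => C.Lin ∧ (snd ρ C).Sep
  | .inl ρ C => C.Lin ∧ (inl ρ C).Sep
  | .inr ρ C => C.Lin ∧ (inr ρ C).Sep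
  | .case ρ C C₁ C₂ => C.Lin ∧ C₁.Lin ∧ C₂.Lin ∧ Disjoint C.kills (C₁.kills ∪ C₂.kills) ∧
      (case ρ C C₁ C₂).Sep
  | .localCase ρ C C₁ C₂ => C.Lin ∧ C₁.Lin ∧ C₂.Lin ∧
      Disjoint C.kills (C₁.kills ∪ C₂.kills) ∧ (localCase ρ C C₁ C₂).Sep
  | .letIn ρ t C₁ C₂ => C₁.Lin ∧ C₂.Lin ∧ Disjoint C₁.kills C₂.kills ∧ (letIn ρ t C₁ C₂).Sep
  | .letLoc ρ C₁ C₂ => C₁.Lin ∧ C₂.Lin ∧ Disjoint C₁.kills C₂.kills ∧ (letLoc ρ C₁ C₂).Sep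
  | .letSet ρ k C₁ C₂ => C₁.Lin ∧ C₂.Lin ∧ Disjoint C₁.kills C₂.kills ∧ (letSet ρ k C₁ C₂).Sep
  | .send C ℓ ρ => C.Lin ∧ (send C ℓ ρ).Sep
  | .sync ℓ d ρ C => C.Lin ∧ (sync ℓ d ρ C).Sep
  | .fork ℓ C => C.Lin ∧ (fork ℓ C).Sep
  | .killAfter a C => C.Lin ∧ a ∉ C.kills ∧ (killAfter a C).Sep

theorem Sep.of_kills_eq_empty {C : Chor M} (h : C.kills = ∅) : C.Sep := by simp [Sep, h]

theorem Lin.of_kills_eq_empty {C : Chor M} (h : C.kills = ∅) : C.Lin := by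
  induction C <;> simp_all [kills, Lin, Sep.of_kills_eq_empty]

theorem Lin.sep {C : Chor M} (h : C.Lin) : C.Sep := by
  cases C <;> simp_all [Lin, Sep, parts, kills]

theorem Value.parts_eq_empty {C : Chor M} (h : C.Value) : C.parts = ∅ := by
  induction h <;> simp_all [parts]

theorem Value.kills_eq_empty {C : Chor M} (h : C.Value) (hl : C.Lin) : C.kills = ∅ := by
  induction h <;> simp_all [kills, Lin]

theorem parts_subset_cloc (C : Chor M) : C.parts ⊆ C.cloc := by
  induction C with
  | done ρ e => by_cases h : M.Val e <;> simp [parts, cloc, h]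
  | killAfter a C ih =>
    exact ((Finset.erase_subset _ _).trans ih).trans Finset.subset_union_right
  | letLoc ρ C₁ C₂ ih₁ ih₂ =>
    simp only [parts, cloc]
    gcongr
    exact LocSet.drop_mono _ ih₂
  | letSet ρ k C₁ C₂ ih₁ ih₂ =>
    simp only [parts, cloc]
    gcongr
    exact LocSet.drop_mono _ ih₂
  | fork ℓ C ih =>
    simp only [parts, cloc]
    gcongr
    exact LocSet.drop_mono _ ih
  | _ =>
    simp only [parts, cloc]
    first | rfl | assumption | gcongr

end Chor

/-- Substitutions that leave the shape of actions alone: choreography variables are replaced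
by choreographies without participants and threads, and local variables by values or
variables. -/
structure Sub.Tame (σ : Sub M) : Prop where
  parts : ∀ i, (σ.pv i).parts = ∅
  kills : ∀ i, (σ.pv i).kills = ∅
  lv : ∀ i, M.Val (σ.lv i) ∨ ∃ j, σ.lv i = M.evar j

namespace Chor

/-- Tame substitutions do not add participants, and leave the threads alone. The class `S` is
needed because tameness is known to be stable under binders only once renamings are
understood. -/
theorem parts_kills_subst_of_closed (S : Sub M → Prop) (hS : ∀ σ, S σ → σ.Tame)
    (hup : ∀ σ s, S σ → S (σ.up s)) {σ : Sub M} (hσ : S σ) (C : Chor M) :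
    (C.subst σ).parts ⊆ C.parts.subst σ.loc σ.set ∧ (C.subst σ).kills = C.kills := by
  have union : ∀ {ρ₁ ρ₂ ρ₁' ρ₂' : LocSet L} {σ : Sub M}, ρ₁' ⊆ ρ₁.subst σ.loc σ.set →
      ρ₂' ⊆ ρ₂.subst σ.loc σ.set → ρ₁' ∪ ρ₂' ⊆ (ρ₁ ∪ ρ₂).subst σ.loc σ.set := fun h₁ h₂ => by
    rw [LocSet.subst_union]; exact Finset.union_subset_union h₁ h₂
  have single : ∀ (ℓ : Loc L) (σ : Sub M), LocSet.single (ℓ.subst σ.loc) ⊆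
      (LocSet.single ℓ).subst σ.loc σ.set := fun ℓ σ => (LocSet.subst_single _ _ _).symm.subset
  have rfl' : ∀ ρ : LocSet L, ρ ⊆ ρ := fun ρ => Finset.Subset.refl ρ
  have lv : ∀ {ρ : LocSet L} {σ : Sub M} (x : LocSet L),
      x ⊆ ρ.subst (σ.up .lv).loc (σ.up .lv).set → x ⊆ ρ.subst σ.loc σ.set :=
    fun {ρ σ} x h => h.trans
      (TSub.subst_up_of_ne (s := .lv) (by decide) (by decide) σ.toTSub ρ).subset
  have pv : ∀ {ρ : LocSet L} {σ : Sub M} (x : LocSet L),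
      x ⊆ ρ.subst (σ.up .pv).loc (σ.up .pv).set → x ⊆ ρ.subst σ.loc σ.set :=
    fun {ρ σ} x h => h.trans
      (TSub.subst_up_of_ne (s := .pv) (by decide) (by decide) σ.toTSub ρ).subset
  have loc : ∀ {ρ : LocSet L} {σ : Sub M} (x : LocSet L),
      x ⊆ ρ.subst (σ.up .loc).loc (σ.up .loc).set →
      x.drop .loc ⊆ (ρ.drop .loc).subst σ.loc σ.set := fun x h =>
    (LocSet.drop_mono .loc h).trans (LocSet.drop_subst_up _ (.inl rfl) _)
  have set : ∀ {ρ : LocSet L} {σ : Sub M} (x : LocSet L),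
      x ⊆ ρ.subst (σ.up .set).loc (σ.up .set).set →
      x.drop .set ⊆ (ρ.drop .set).subst σ.loc σ.set := fun x h =>
    (LocSet.drop_mono .set h).trans (LocSet.drop_subst_up _ (.inr rfl) _)
  induction C generalizing σ with
  | var i =>
    exact ⟨by simp [subst, (hS _ hσ).parts, parts], by simp [subst, (hS _ hσ).kills, kills]⟩
  | done ρ e =>
    refine ⟨?_, rfl⟩
    by_cases h : M.Val e
    · have := M.val_subst e σ.toLSub σ.lv h (hS _ hσ).lv
      simp [parts, subst, this]
    · by_cases h' : M.Val (M.expSubst σ.toLSub σ.lv e) <;> simp [parts, subst, h, h']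
  | func ρ C ih =>
    exact ⟨by simp [subst, parts], (ih (hup _ _ (hup _ _ hσ))).2⟩
  | tfun κ C ih =>
    exact ⟨by simp [subst, parts], (ih (hup _ _ (hup _ _ hσ))).2⟩
  | app ρ C₁ C₂ ih₁ ih₂ =>
    exact ⟨union (union (ih₁ hσ).1 (ih₂ hσ).1) (rfl' _),
      congrArg₂ _ (ih₁ hσ).2 (ih₂ hσ).2⟩
  | pair ρ C₁ C₂ ih₁ ih₂ =>
    exact ⟨union (ih₁ hσ).1 (ih₂ hσ).1, congrArg₂ _ (ih₁ hσ).2 (ih₂ hσ).2⟩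
  | tapp ρ C a ih => exact ⟨union (ih hσ).1 (rfl' _), (ih hσ).2⟩
  | unfold ρ C ih => exact ⟨union (ih hσ).1 (rfl' _), (ih hσ).2⟩
  | fst ρ C ih => exact ⟨union (ih hσ).1 (rfl' _), (ih hσ).2⟩
  | snd ρ C ih => exact ⟨union (ih hσ).1 (rfl' _), (ih hσ).2⟩
  | fold ρ C ih => exact ih hσ
  | inl ρ C ih => exact ih hσ
  | inr ρ C ih => exact ih hσ
  | case ρ C C₁ C₂ ih ih₁ ih₂ =>
    have h₁ := ih₁ (hup _ .pv hσ)
    have h₂ := ih₂ (hup _ .pv hσ)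
    exact ⟨union (union (union (ih hσ).1 (pv _ h₁.1)) (pv _ h₂.1)) (rfl' _),
      congrArg₂ _ (ih hσ).2 (congrArg₂ _ h₁.2 h₂.2)⟩
  | localCase ρ C C₁ C₂ ih ih₁ ih₂ =>
    have h₁ := ih₁ (hup _ .lv hσ)
    have h₂ := ih₂ (hup _ .lv hσ)
    exact ⟨union (union (union (ih hσ).1 (lv _ h₁.1)) (lv _ h₂.1)) (rfl' _),
      congrArg₂ _ (ih hσ).2 (congrArg₂ _ h₁.2 h₂.2)⟩
  | letIn ρ t C₁ C₂ ih₁ ih₂ =>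
    have h₂ := ih₂ (hup _ .lv hσ)
    exact ⟨union (union (ih₁ hσ).1 (lv _ h₂.1)) (rfl' _), congrArg₂ _ (ih₁ hσ).2 h₂.2⟩
  | letLoc ρ C₁ C₂ ih₁ ih₂ =>
    have h₂ := ih₂ (hup _ .loc hσ)
    exact ⟨union (union (ih₁ hσ).1 (loc _ h₂.1)) (rfl' _), congrArg₂ _ (ih₁ hσ).2 h₂.2⟩
  | letSet ρ k C₁ C₂ ih₁ ih₂ =>
    have h₂ := ih₂ (hup _ .set hσ)
    exact ⟨union (union (ih₁ hσ).1 (set _ h₂.1)) (rfl' _), congrArg₂ _ (ih₁ hσ).2 h₂.2⟩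
  | send C ℓ ρ ih =>
    exact ⟨union (union (ih hσ).1 (single _ _)) (rfl' _), (ih hσ).2⟩
  | sync ℓ d ρ C ih =>
    exact ⟨union (union (single _ _) (rfl' _)) (ih hσ).1, (ih hσ).2⟩
  | fork ℓ C ih =>
    -- `fork` binds its two variables in the other order, which makes no difference
    have h := ih (hup _ .lv (hup _ .loc hσ))
    rw [← Sub.up_lv_up_loc] at h
    refine ⟨union (single _ _) (loc _ ?_), h.2⟩
    refine h.1.trans (le_of_eq ?_)
    change LocSet.subst ((σ.toTSub.up .lv).up .loc).loc ((σ.toTSub.up .lv).up .loc).set _ = _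
    rw [TSub.up_lv]; rfl
  | killAfter a C ih =>
    refine ⟨fun x hx => ?_, congrArg (insert a) (ih hσ).2⟩
    obtain ⟨hne, hx⟩ := Finset.mem_erase.1 hx
    obtain ⟨y, hy, hxy⟩ := LocSet.mem_subst.1 ((ih hσ).1 hx)
    refine LocSet.mem_subst.2 ⟨y, Finset.mem_erase.2 ⟨?_, hy⟩, hxy⟩
    -- if the element came from the erased `{a}`, it would be `{a}` itself
    rintro rfl
    exact hne (Finset.mem_singleton.1 hxy)

theorem _root_.LambdaFork.Sub.Tame.ofRen (r : Ren) : (Sub.ofRen r : Sub M).Tame where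
  parts _ := rfl
  kills _ := rfl
  lv _ := .inr ⟨_, rfl⟩

theorem parts_kills_rename (r : Ren) (C : Chor M) :
    (C.rename r).parts ⊆ C.parts.rename r ∧ (C.rename r).kills = C.kills := by
  rw [rename_eq_subst]
  refine parts_kills_subst_of_closed (fun σ => ∃ r, σ = Sub.ofRen r) ?_ ?_ ⟨r, rfl⟩ C
  · rintro _ ⟨r, rfl⟩; exact Sub.Tame.ofRen r
  · rintro _ s ⟨r, rfl⟩; exact ⟨_, Sub.up_ofRen s r⟩

theorem _root_.LambdaFork.Sub.Tame.up {σ : Sub M} (hσ : σ.Tame) (s : BSort) : (σ.up s).Tame := by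
  have hp : ∀ i, ((σ.pv i).rename (Ren.shift s)).parts = ∅ := fun i => by
    have := (parts_kills_rename (Ren.shift s) (σ.pv i)).1
    rw [hσ.parts i] at this
    exact Finset.subset_empty.1 this
  have hk : ∀ i, ((σ.pv i).rename (Ren.shift s)).kills = ∅ := fun i => by
    rw [(parts_kills_rename (Ren.shift s) (σ.pv i)).2, hσ.kills i]
  have hl : ∀ i, M.Val (M.expRename (Ren.shift s) (σ.lv i)) ∨
      ∃ j, M.expRename (Ren.shift s) (σ.lv i) = M.evar j := fun i => by
    rcases hσ.lv i with h | ⟨j, h⟩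
    · exact .inl (M.val_subst _ _ _ h fun _ => .inr ⟨_, rfl⟩)
    · rw [h]; exact .inr ⟨_, M.expSubst_evar _ _ _⟩
  refine ⟨fun i => ?_, fun i => ?_, fun i => ?_⟩
  · by_cases h : s = .pv
    · subst h; cases i with
      | zero => rfl
      | succ i => exact hp i
    · simpa [Sub.up, consIf_of_ne h] using hp i
  · by_cases h : s = .pv
    · subst h; cases i with
      | zero => rfl
      | succ i => exact hk i
    · simpa [Sub.up, consIf_of_ne h] using hk i
  · by_cases h : s = .lv
    · subst h; cases i with
      | zero => exact .inr ⟨_, rfl⟩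
      | succ i => exact hl i
    · simpa [Sub.up, consIf_of_ne h] using hl i

theorem parts_subst {σ : Sub M} (hσ : σ.Tame) (C : Chor M) :
    (C.subst σ).parts ⊆ C.parts.subst σ.loc σ.set :=
  (parts_kills_subst_of_closed Sub.Tame (fun _ h => h) (fun _ s h => h.up s) hσ C).1

theorem kills_subst {σ : Sub M} (hσ : σ.Tame) (C : Chor M) : (C.subst σ).kills = C.kills :=
  (parts_kills_subst_of_closed Sub.Tame (fun _ h => h) (fun _ s h => h.up s) hσ C).2

end Chor

/-- `σ` does not introduce the locations `K`. -/
structure LSub.Avoids {Ty : Type v} (K : Finset L) (σ : LSub L Ty) : Prop where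
  loc : ∀ i, ∀ a ∈ K, σ.loc i ≠ .const a
  set : ∀ i, ∀ a ∈ K, Atom.loc (.const a) ∉ σ.set i

theorem LSub.Avoids.mono {Ty : Type v} {K K' : Finset L} {σ : LSub L Ty} (h : σ.Avoids K)
    (hK : K' ⊆ K) : σ.Avoids K' :=
  ⟨fun i a ha => h.loc i a (hK ha), fun i a ha => h.set i a (hK ha)⟩

theorem LSub.Avoids.up {K : Finset L} {σ : LSub L M.Ty} (h : σ.Avoids K) (s : BSort) :
    (σ.up M s).Avoids K := by
  have hl : ∀ i, ∀ a ∈ K, (σ.loc i).rename (Ren.shift s) ≠ .const a := fun i a ha he => by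
    apply h.loc i a ha
    cases hi : σ.loc i <;> simp_all [Loc.rename, Loc.subst]
  have hs : ∀ i, ∀ a ∈ K, Atom.loc (.const a) ∉ (σ.set i).rename (Ren.shift s) :=
    fun i a ha he => h.set i a ha (LocSet.const_mem_rename.1 he)
  refine ⟨fun i => ?_, fun i => ?_⟩
  · by_cases h : s = .loc
    · subst h; cases i with
      | zero => simp [LSub.up, consIf_self, cons]
      | succ i => exact hl i
    · simpa [LSub.up, consIf_of_ne h] using hl i
  · by_cases h : s = .set
    · subst h; cases i with
      | zero => simp [LSub.up, consIf_self, cons]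
      | succ i => exact hs i
    · simpa [LSub.up, consIf_of_ne h] using hs i

namespace Chor

/-- A substitution that does not introduce a running thread keeps the running threads apart
from the participants. -/
theorem Sep.subst {σ : Sub M} (hσ : σ.Tame) {C : Chor M} (ha : σ.toLSub.Avoids C.kills)
    (h : C.Sep) : (C.subst σ).Sep := by
  intro a hk hp
  rw [kills_subst hσ] at hk
  rcases LocSet.const_mem_subst (parts_subst hσ C hp) with h' | ⟨i, h'⟩ | ⟨i, h'⟩
  · exact h a hk h'
  · exact ha.loc i a hk h'
  · exact ha.set i a hk h'

/-- Linearity is stable under substitutions that do not introduce a running thread. -/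
theorem Lin.subst {σ : Sub M} (hσ : σ.Tame) {C : Chor M} (ha : σ.toLSub.Avoids C.kills)
    (h : C.Lin) : (C.subst σ).Lin := by
  induction C generalizing σ with
  | var i => exact Lin.of_kills_eq_empty (hσ.kills i)
  | done ρ e => trivial
  | func ρ C ih => exact (kills_subst ((hσ.up _).up _) C).trans h
  | tfun κ C ih => exact (kills_subst ((hσ.up _).up _) C).trans h
  | app ρ C₁ C₂ ih₁ ih₂ =>
    have s := h.sep.subst hσ ha
    refine ⟨ih₁ hσ (ha.mono ?_) h.1, ih₂ hσ (ha.mono ?_) h.2.1, ?_, s⟩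
    · exact Finset.subset_union_left
    · exact Finset.subset_union_right
    · simpa only [kills_subst hσ] using h.2.2.1
  | pair ρ C₁ C₂ ih₁ ih₂ =>
    have s := h.sep.subst hσ ha
    refine ⟨ih₁ hσ (ha.mono ?_) h.1, ih₂ hσ (ha.mono ?_) h.2.1, ?_, s⟩
    · exact Finset.subset_union_left
    · exact Finset.subset_union_right
    · simpa only [kills_subst hσ] using h.2.2.1
  | tapp ρ C a ih => exact ⟨ih hσ ha h.1, h.sep.subst hσ ha⟩
  | fold ρ C ih => exact ⟨ih hσ ha h.1, h.sep.subst hσ ha⟩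
  | unfold ρ C ih => exact ⟨ih hσ ha h.1, h.sep.subst hσ ha⟩
  | fst ρ C ih => exact ⟨ih hσ ha h.1, h.sep.subst hσ ha⟩
  | snd ρ C ih => exact ⟨ih hσ ha h.1, h.sep.subst hσ ha⟩
  | inl ρ C ih => exact ⟨ih hσ ha h.1, h.sep.subst hσ ha⟩
  | inr ρ C ih => exact ⟨ih hσ ha h.1, h.sep.subst hσ ha⟩
  | send C ℓ ρ ih => exact ⟨ih hσ ha h.1, h.sep.subst hσ ha⟩
  | sync ℓ d ρ C ih => exact ⟨ih hσ ha h.1, h.sep.subst hσ ha⟩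
  | case ρ C C₁ C₂ ih ih₁ ih₂ =>
    have s := h.sep.subst hσ ha
    refine ⟨ih hσ (ha.mono ?_) h.1, ih₁ (hσ.up _) ((ha.mono ?_).up _) h.2.1,
      ih₂ (hσ.up _) ((ha.mono ?_).up _) h.2.2.1, ?_, s⟩
    · exact Finset.subset_union_left
    · exact Finset.subset_union_left.trans Finset.subset_union_right
    · exact Finset.subset_union_right.trans Finset.subset_union_right
    · simpa only [kills_subst hσ, kills_subst (hσ.up _)] using h.2.2.2.1
  | localCase ρ C C₁ C₂ ih ih₁ ih₂ =>
    have s := h.sep.subst hσ ha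
    refine ⟨ih hσ (ha.mono ?_) h.1, ih₁ (hσ.up _) ((ha.mono ?_).up _) h.2.1,
      ih₂ (hσ.up _) ((ha.mono ?_).up _) h.2.2.1, ?_, s⟩
    · exact Finset.subset_union_left
    · exact Finset.subset_union_left.trans Finset.subset_union_right
    · exact Finset.subset_union_right.trans Finset.subset_union_right
    · simpa only [kills_subst hσ, kills_subst (hσ.up _)] using h.2.2.2.1
  | letIn ρ t C₁ C₂ ih₁ ih₂ =>
    have s := h.sep.subst hσ ha
    refine ⟨ih₁ hσ (ha.mono ?_) h.1, ih₂ (hσ.up _) ((ha.mono ?_).up _) h.2.1, ?_, s⟩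
    · exact Finset.subset_union_left
    · exact Finset.subset_union_right
    · simpa only [kills_subst hσ, kills_subst (hσ.up _)] using h.2.2.1
  | letLoc ρ C₁ C₂ ih₁ ih₂ =>
    have s := h.sep.subst hσ ha
    refine ⟨ih₁ hσ (ha.mono ?_) h.1, ih₂ (hσ.up _) ((ha.mono ?_).up _) h.2.1, ?_, s⟩
    · exact Finset.subset_union_left
    · exact Finset.subset_union_right
    · simpa only [kills_subst hσ, kills_subst (hσ.up _)] using h.2.2.1
  | letSet ρ k C₁ C₂ ih₁ ih₂ =>
    have s := h.sep.subst hσ ha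
    refine ⟨ih₁ hσ (ha.mono ?_) h.1, ih₂ (hσ.up _) ((ha.mono ?_).up _) h.2.1, ?_, s⟩
    · exact Finset.subset_union_left
    · exact Finset.subset_union_right
    · simpa only [kills_subst hσ, kills_subst (hσ.up _)] using h.2.2.1
  | fork ℓ C ih =>
    exact ⟨ih ((hσ.up _).up _) ((LSub.Avoids.up ha .lv).up .loc) h.1, h.sep.subst hσ ha⟩
  | killAfter a C ih =>
    refine ⟨ih hσ (ha.mono (Finset.subset_insert _ _)) h.1, ?_, h.sep.subst hσ ha⟩
    rw [kills_subst hσ]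
    exact h.2.1

end Chor

end Participants

/-! ### Typing of running choreographies -/

section Typing

variable {L : Type u} [DecidableEq L] {M : LocalLang.{u, v, w} L}

/-- Typing of the choreographies that occur during execution. In contrast to `HasType` there
is a rule for `killAfter`, participants are computed by `Chor.parts`, and the body of a
function may have fewer participants than its type says: substituting a value for a local
variable can turn an expression into a value, which has no participants. -/
inductive RunType : Ctx M → Chor M → CTy M → Prop
  | var {Γ : Ctx M} {i : ℕ} {τ : CTy M} (h : Γ.pv[i]? = some τ) : RunType Γ (.var i) τ
  | done {Γ : Ctx M} {ρ : LocSet L} {e : M.Exp} {t : M.Ty} (hρ : SetOk Γ.lctx .any ρ)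
      (h : M.Typed Γ.lctx (Γ.proj ρ) e t) : RunType Γ (.done ρ e) (.located t ρ)
  | func {Γ : Ctx M} {C : Chor M} {τ₁ τ₂ : CTy M} {ρ₁ ρ₂ ρ ρa : LocSet L}
      (h₁ : Kinded Γ.kinds τ₁ ρ₁) (h₂ : Kinded Γ.kinds τ₂ ρ₂) (hρ : SetOk Γ.lctx .any ρ)
      (ha : ρa = ρ₁ ∪ ρ₂ ∪ ρ) (hp : C.parts ⊆ ρ)
      (h : RunType ((Γ.bindPv (.arrow τ₁ ρ τ₂)).bindPv τ₁) C τ₂) :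
      RunType Γ (.func ρa C) (.arrow τ₁ ρ τ₂)
  | app {Γ : Ctx M} {C₁ C₂ : Chor M} {τ₁ τ₂ : CTy M} {ρ ρt₁ ρt₂ ρa : LocSet L}
      (h₁ : RunType Γ C₁ (.arrow τ₁ ρ τ₂)) (h₂ : RunType Γ C₂ τ₁)
      (ht₁ : Kinded Γ.kinds τ₁ ρt₁) (ht₂ : Kinded Γ.kinds τ₂ ρt₂)
      (ha : ρa = ρt₁ ∪ ρt₂ ∪ ρ) : RunType Γ (.app ρa C₁ C₂) τ₂
  | tfun {Γ : Ctx M} {κ : Kind L} {C : Chor M} {τ : CTy M} {ρ ρt : LocSet L}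
      (ht : Kinded Γ.kinds (.all κ ρ τ) ρt) (hp : C.parts ⊆ ρ)
      (h : RunType ((Γ.bindPv (.all κ ρ τ)).bindTy κ) C τ) :
      RunType Γ (.tfun κ C) (.all κ ρ τ)
  | tapp {Γ : Ctx M} {κ : Kind L} {C : Chor M} {a : TArg M} {τ τ' : CTy M}
      {ρ ρt ρa : LocSet L} (h : RunType Γ C (.all κ ρ τ)) (ha : TArgOk Γ.kinds a κ)
      (ht : Kinded Γ.kinds τ' ρt) (hτ : τ' = τ.subst a.inst)
      (hρ : ρa = ρt ∪ ρ.subst a.inst.loc a.inst.set) : RunType Γ (.tapp ρa C a) τ'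
  | fold {Γ : Ctx M} {C : Chor M} {τ : CTy M} {ρ : LocSet L}
      (ht : Kinded Γ.kinds (.mu ρ τ) ρ)
      (h : RunType Γ C (τ.subst (TArg.prog (.mu ρ τ)).inst)) : RunType Γ (.fold ρ C) (.mu ρ τ)
  | unfold {Γ : Ctx M} {C : Chor M} {τ τ' : CTy M} {ρ : LocSet L}
      (ht : Kinded Γ.kinds (.mu ρ τ) ρ) (h : RunType Γ C (.mu ρ τ))
      (hτ : τ' = τ.subst (TArg.prog (.mu ρ τ)).inst) : RunType Γ (.unfold ρ C) τ'
  | pair {Γ : Ctx M} {C₁ C₂ : Chor M} {τ₁ τ₂ : CTy M} {ρt₁ ρt₂ ρa : LocSet L}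
      (h₁ : RunType Γ C₁ τ₁) (h₂ : RunType Γ C₂ τ₂)
      (ht₁ : Kinded Γ.kinds τ₁ ρt₁) (ht₂ : Kinded Γ.kinds τ₂ ρt₂) (ha : ρa = ρt₁ ∪ ρt₂) :
      RunType Γ (.pair ρa C₁ C₂) (.prod τ₁ τ₂)
  | fst {Γ : Ctx M} {C : Chor M} {τ₁ τ₂ : CTy M} {ρt₁ ρt₂ ρa : LocSet L}
      (h : RunType Γ C (.prod τ₁ τ₂))
      (ht₁ : Kinded Γ.kinds τ₁ ρt₁) (ht₂ : Kinded Γ.kinds τ₂ ρt₂) (ha : ρa = ρt₁ ∪ ρt₂) :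
      RunType Γ (.fst ρa C) τ₁
  | snd {Γ : Ctx M} {C : Chor M} {τ₁ τ₂ : CTy M} {ρt₁ ρt₂ ρa : LocSet L}
      (h : RunType Γ C (.prod τ₁ τ₂))
      (ht₁ : Kinded Γ.kinds τ₁ ρt₁) (ht₂ : Kinded Γ.kinds τ₂ ρt₂) (ha : ρa = ρt₁ ∪ ρt₂) :
      RunType Γ (.snd ρa C) τ₂
  | inl {Γ : Ctx M} {C : Chor M} {τ₁ τ₂ : CTy M} {ρ : LocSet L}
      (ht : Kinded Γ.kinds (.sum ρ τ₁ τ₂) ρ) (h : RunType Γ C τ₁) :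
      RunType Γ (.inl ρ C) (.sum ρ τ₁ τ₂)
  | inr {Γ : Ctx M} {C : Chor M} {τ₁ τ₂ : CTy M} {ρ : LocSet L}
      (ht : Kinded Γ.kinds (.sum ρ τ₁ τ₂) ρ) (h : RunType Γ C τ₂) :
      RunType Γ (.inr ρ C) (.sum ρ τ₁ τ₂)
  | case {Γ : Ctx M} {C C₁ C₂ : Chor M} {τ₁ τ₂ τ : CTy M} {ρ : LocSet L}
      (ht : Kinded Γ.kinds (.sum ρ τ₁ τ₂) ρ) (h : RunType Γ C (.sum ρ τ₁ τ₂))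
      (h₁ : RunType (Γ.bindPv τ₁) C₁ τ) (h₂ : RunType (Γ.bindPv τ₂) C₂ τ) :
      RunType Γ (.case ρ C C₁ C₂) τ
  | localCase {Γ : Ctx M} {C C₁ C₂ : Chor M} {s t₁ t₂ : M.Ty} {τ : CTy M}
      {ρ ρ' : LocSet L} (h : RunType Γ C (.located s ρ'))
      (hs : M.IsSum s t₁ t₂) (hρ : SetOk Γ.lctx .any ρ) (hsub : LocSet.Sub ρ ρ')
      (h₁ : RunType (Γ.bindLv ρ t₁) C₁ τ) (h₂ : RunType (Γ.bindLv ρ t₂) C₂ τ) :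
      RunType Γ (.localCase ρ C C₁ C₂) τ
  | letIn {Γ : Ctx M} {C₁ C₂ : Chor M} {t : M.Ty} {τ : CTy M} {ρ ρ' : LocSet L}
      (h₁ : RunType Γ C₁ (.located t ρ')) (hρ : SetOk Γ.lctx .any ρ)
      (hsub : LocSet.Sub ρ ρ') (h₂ : RunType (Γ.bindLv ρ t) C₂ τ) :
      RunType Γ (.letIn ρ t C₁ C₂) τ
  | letLoc {Γ : Ctx M} {C₁ C₂ : Chor M} {τ : CTy M} {ρ ρ' ρ'' ρt : LocSet L}
      (h₁ : RunType Γ C₁ (.located (M.locTy ρ'') ρ')) (hρ : SetOk Γ.lctx .fin ρ)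
      (hsub : LocSet.Sub ρ'' ρ) (hsub' : LocSet.Sub ρ ρ') (ht : Kinded Γ.kinds τ ρt)
      (h₂ : RunType (Γ.bindTy .loc) C₂ (τ.rename (Ren.shift .loc))) :
      RunType Γ (.letLoc ρ C₁ C₂) τ
  | letSet {Γ : Ctx M} {k : SetKind} {C₁ C₂ : Chor M} {τ : CTy M}
      {ρ ρ' ρ'' ρt : LocSet L} (h₁ : RunType Γ C₁ (.located (M.locsetTy ρ'') ρ'))
      (hρ : SetOk Γ.lctx .fin ρ) (hsub : LocSet.Sub ρ'' ρ) (hsub' : LocSet.Sub ρ ρ')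
      (ht : Kinded Γ.kinds τ ρt)
      (h₂ : RunType (Γ.bindTy (.set k)) C₂ (τ.rename (Ren.shift .set))) :
      RunType Γ (.letSet ρ k C₁ C₂) τ
  | send {Γ : Ctx M} {C : Chor M} {ℓ : Loc L} {t : M.Ty} {ρ ρ₁ : LocSet L}
      (h : RunType Γ C (.located t ρ₁)) (hℓ : LocOk Γ.lctx ℓ) (hm : LocSet.Mem ℓ ρ₁)
      (hρ : SetOk Γ.lctx .any ρ) :
      RunType Γ (.send C ℓ ρ) (.located t (ρ₁ ∪ ρ))
  | sync {Γ : Ctx M} {C : Chor M} {ℓ : Loc L} {d : Bool} {τ : CTy M} {ρ : LocSet L}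
      (hℓ : LocOk Γ.lctx ℓ) (hρ : SetOk Γ.lctx .any ρ) (h : RunType Γ C τ) :
      RunType Γ (.sync ℓ d ρ C) τ
  | fork {Γ : Ctx M} {C : Chor M} {ℓ : Loc L} {τ : CTy M} {ρt : LocSet L}
      (hℓ : LocOk Γ.lctx ℓ) (ht : Kinded Γ.kinds τ ρt)
      (h : RunType ((Γ.bindTy .loc).bindLv
          (LocSet.single (.var 0) ∪ LocSet.single (ℓ.rename (Ren.shift .loc)))
          (M.locTy (LocSet.single (.var 0)))) C (τ.rename (Ren.shift .loc))) :
      RunType Γ (.fork ℓ C) τ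
  | killAfter {Γ : Ctx M} {C : Chor M} {a : L} {τ : CTy M} (h : RunType Γ C τ) :
      RunType Γ (.killAfter a C) τ

theorem HasType.kills_eq_empty {Γ : Ctx M} {C : Chor M} {τ : CTy M} {ρ : LocSet L}
    (h : HasType Γ C τ ρ) : C.kills = ∅ := by
  induction h <;> simp_all [Chor.kills]

theorem HasType.parts_eq {Γ : Ctx M} {C : Chor M} {τ : CTy M} {ρ : LocSet L}
    (h : HasType Γ C τ ρ) : C.parts = ρ := by
  induction h <;> simp_all [Chor.parts]

theorem HasType.runType {Γ : Ctx M} {C : Chor M} {τ : CTy M} {ρ : LocSet L}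
    (h : HasType Γ C τ ρ) : RunType Γ C τ := by
  induction h with
  | var h => exact .var h
  | doneVal hρ h _ => exact .done hρ h
  | done hρ h _ => exact .done hρ h
  | func h₁ h₂ hρ h ih => exact .func h₁ h₂ hρ rfl h.parts_eq.subset ih
  | app _ _ ht₁ ht₂ ih₁ ih₂ => exact .app ih₁ ih₂ ht₁ ht₂ rfl
  | tfun ht h ih => exact .tfun ht h.parts_eq.subset ih
  | tapp _ ha ht ih => exact .tapp ih ha ht rfl rfl
  | fold ht _ ih => exact .fold ht ih
  | unfold ht _ ih => exact .unfold ht ih rfl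
  | pair _ _ ht₁ ht₂ ih₁ ih₂ => exact .pair ih₁ ih₂ ht₁ ht₂ rfl
  | fst _ ht₁ ht₂ ih => exact .fst ih ht₁ ht₂ rfl
  | snd _ ht₁ ht₂ ih => exact .snd ih ht₁ ht₂ rfl
  | inl ht _ ih => exact .inl ht ih
  | inr ht _ ih => exact .inr ht ih
  | case ht _ _ _ ih ih₁ ih₂ => exact .case ht ih ih₁ ih₂
  | localCase _ hs hρ hsub _ _ ih ih₁ ih₂ => exact .localCase ih hs hρ hsub ih₁ ih₂
  | letIn _ hρ hsub _ ih₁ ih₂ => exact .letIn ih₁ hρ hsub ih₂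
  | letLoc _ hρ hsub hsub' ht _ ih₁ ih₂ => exact .letLoc ih₁ hρ hsub hsub' ht ih₂
  | letSet _ hρ hsub hsub' ht _ ih₁ ih₂ => exact .letSet ih₁ hρ hsub hsub' ht ih₂
  | send _ hℓ hm hρ ih => exact .send ih hℓ hm hρ
  | sync hℓ hρ _ ih => exact .sync hℓ hρ ih
  | fork hℓ ht _ ih => exact .fork hℓ ht ih

/-! ### Local expressions in a typing context -/

theorem Ctx.proj_eq_some {Γ : Ctx M} {ρ : LocSet L} {i : ℕ} {t : M.Ty} :
    Γ.proj ρ i = some t ↔ ∃ ρ', Γ.lv[i]? = some (ρ', t) ∧ LocSet.Sub ρ ρ' := by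
  unfold Ctx.proj
  cases h : Γ.lv[i]? with
  | none => simp
  | some p =>
    obtain ⟨ρ', t'⟩ := p
    by_cases hs : LocSet.Sub ρ ρ' <;> simp [hs]

theorem LocalLang.Typed.weaken {Γ : KCtx L} {Δ Δ' : ℕ → Option M.Ty} {e : M.Exp} {t : M.Ty}
    (h : M.Typed Γ.toLCtx Δ e t) (hΔ : ∀ i s, Δ i = some s → Δ' i = some s) :
    M.Typed Γ.toLCtx Δ' e t := by
  have := M.typed_subst _ _ _ Δ' _ M.evar _ _ (LSub.Ok.id (M := M) Γ.toLCtx) ?_ h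
  · rwa [M.tySubst_id, M.expSubst_id] at this
  · intro i s hs
    rw [M.tySubst_id]
    exact M.typed_evar _ _ _ _ (hΔ i s hs)

/-- Fewer locations know more local variables. -/
theorem LocalLang.Typed.proj_mono {Γ : Ctx M} {ρ ρ' : LocSet L} {e : M.Exp} {t : M.Ty}
    (h : M.Typed Γ.lctx (Γ.proj ρ') e t) (hs : LocSet.Sub ρ ρ') :
    M.Typed Γ.lctx (Γ.proj ρ) e t := by
  refine LocalLang.Typed.weaken h fun i s hi => ?_
  obtain ⟨ρ₀, h₀, h₁⟩ := Ctx.proj_eq_some.1 hi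
  exact Ctx.proj_eq_some.2 ⟨ρ₀, h₀, hs.trans h₁⟩

/-- A closed expression of type `locTy ρ` has that type in every context. -/
theorem LocalLang.Typed.of_empty {Γ : LCtx} {Δ : ℕ → Option M.Ty} {e : M.Exp} {ρ : LocSet L}
    (h : M.Typed LCtx.empty (fun _ => none) e (M.locTy ρ)) :
    M.Typed Γ Δ e (M.locTy ρ) := by
  have hok : LSub.Ok M.WfTy LCtx.empty Γ (LSub.ofRen (L := L) M.tvar fun _ i => i) :=
    ⟨fun i hi => absurd hi (Nat.not_lt_zero i), fun i k hi => by simp [LCtx.empty] at hi,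
      fun i hi => absurd hi (Nat.not_lt_zero i)⟩
  have := M.typed_subst _ Γ _ Δ _ M.evar _ _ hok (by simp) h
  rwa [M.tySubst_id, M.expSubst_id] at this

theorem LocalLang.Typed.bindTy {Γ : Ctx M} {κ : Kind L} {ρ : LocSet L} {e : M.Exp} {t : M.Ty}
    (h : M.Typed Γ.lctx (Γ.proj ρ) e t) :
    M.Typed (Γ.bindTy κ).lctx ((Γ.bindTy κ).proj (ρ.rename (Ren.shift κ.sort)))
      (M.expRename (Ren.shift κ.sort) e) (M.tyRename (Ren.shift κ.sort) t) := by
  refine M.typed_subst _ _ _ _ _ _ _ _ (LSub.Ok.shift Γ.kinds κ) (fun i s hi => ?_) h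
  obtain ⟨ρ₀, h₀, h₁⟩ := Ctx.proj_eq_some.1 hi
  have : Ren.shift κ.sort .lv i = i := by cases κ <;> rfl
  rw [this]
  refine M.typed_evar _ _ _ _ (Ctx.proj_eq_some.2 ⟨ρ₀.rename (Ren.shift κ.sort), ?_, ?_⟩)
  · simp only [Ctx.bindTy, List.getElem?_map, h₀]; rfl
  · exact h₁.subst _ _

theorem LocalLang.Typed.bindLv {Γ : Ctx M} {ρ ρ' : LocSet L} {e : M.Exp} {t t' : M.Ty}
    (h : M.Typed Γ.lctx (Γ.proj ρ) e t) :
    M.Typed (Γ.bindLv ρ' t').lctx ((Γ.bindLv ρ' t').proj ρ)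
      (M.expRename (Ren.shift .lv) e) t := by
  have hid : LSub.ofRen (L := L) M.tvar (Ren.shift .lv) = LSub.ofRen M.tvar fun _ i => i := by
    simp [LSub.ofRen, Ren.shift]
  have := M.typed_subst _ Γ.lctx _ ((Γ.bindLv ρ' t').proj ρ) _
    (fun i => M.evar (Ren.shift .lv .lv i)) _ _ (LSub.Ok.id (M := M) Γ.lctx) (fun i s hi => ?_) h
  · rw [M.tySubst_id, ← hid] at this
    exact this
  · rw [M.tySubst_id]
    obtain ⟨ρ₀, h₀, h₁⟩ := Ctx.proj_eq_some.1 hi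
    exact M.typed_evar _ _ _ _ (Ctx.proj_eq_some.2 ⟨ρ₀, h₀, h₁⟩)

/-! ### Typed substitutions -/

/-- `σ` maps the variables of `Γ` to objects of the right kind and type over `Γ'`. -/
structure Sub.Ok (Γ Γ' : Ctx M) (σ : Sub M) : Prop where
  toTSub : TSub.Ok Γ.kinds Γ'.kinds σ.toTSub
  lv : ∀ i ρ t, Γ.lv[i]? = some (ρ, t) → M.Typed Γ'.lctx (Γ'.proj (ρ.subst σ.loc σ.set))
    (σ.lv i) (M.tySubst σ.toLSub t)
  pv : ∀ i τ, Γ.pv[i]? = some τ → RunType Γ' (σ.pv i) (τ.subst σ.toTSub)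
  tame : σ.Tame

theorem RunType.expSubst {Γ Γ' : Ctx M} {σ : Sub M} (hσ : Sub.Ok Γ Γ' σ) {ρ : LocSet L}
    {e : M.Exp} {t : M.Ty} (h : M.Typed Γ.lctx (Γ.proj ρ) e t) :
    M.Typed Γ'.lctx (Γ'.proj (ρ.subst σ.loc σ.set)) (M.expSubst σ.toLSub σ.lv e)
      (M.tySubst σ.toLSub t) := by
  refine M.typed_subst _ _ _ _ _ _ _ _ hσ.toTSub.toLSub (fun i s hi => ?_) h
  obtain ⟨ρ₀, h₀, h₁⟩ := Ctx.proj_eq_some.1 hi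
  exact LocalLang.Typed.proj_mono (hσ.lv i ρ₀ s h₀) (h₁.subst _ _)

/-- A typed substitution stays so under a choreography variable, if its choreographies can be
weakened. -/
theorem Sub.Ok.up_pv_of {Γ Γ' : Ctx M} {σ : Sub M} (hσ : Sub.Ok Γ Γ' σ) (τ : CTy M)
    (hw : ∀ i τ', RunType Γ' (σ.pv i) τ' →
      RunType (Γ'.bindPv (τ.subst σ.toTSub)) ((σ.pv i).rename (Ren.shift .pv)) τ') :
    Sub.Ok (Γ.bindPv τ) (Γ'.bindPv (τ.subst σ.toTSub)) (σ.up .pv) := by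
  have e : (σ.up .pv).toTSub = σ.toTSub := σ.toTSub.up_pv
  refine ⟨by rw [e]; exact hσ.toTSub, fun i ρ t hi => ?_, fun i τ' hi => ?_, hσ.tame.up _⟩
  · have he : (σ.up .pv).lv i = σ.lv i := by
      change M.expSubst (LSub.ofRen M.tvar (Ren.shift .pv)) _ _ = _
      have hid : LSub.ofRen (L := L) M.tvar (Ren.shift .pv) = LSub.ofRen M.tvar fun _ i => i := by
        simp [LSub.ofRen, Ren.shift]
      rw [hid]
      exact M.expSubst_id _
    rw [he, e]
    exact hσ.lv i ρ t hi
  · rw [e]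
    cases i with
    | zero =>
      obtain rfl := Option.some.inj hi
      exact .var rfl
    | succ i => exact hw i _ (hσ.pv i τ' hi)

/-- A typed substitution stays so under a local variable, if its choreographies can be
weakened. -/
theorem Sub.Ok.up_lv_of {Γ Γ' : Ctx M} {σ : Sub M} (hσ : Sub.Ok Γ Γ' σ) (ρ : LocSet L)
    (t : M.Ty)
    (hw : ∀ i τ', RunType Γ' (σ.pv i) τ' →
      RunType (Γ'.bindLv (ρ.subst σ.loc σ.set) (M.tySubst σ.toLSub t))
        ((σ.pv i).rename (Ren.shift .lv)) τ') :
    Sub.Ok (Γ.bindLv ρ t) (Γ'.bindLv (ρ.subst σ.loc σ.set) (M.tySubst σ.toLSub t))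
      (σ.up .lv) := by
  have e : (σ.up .lv).toTSub = σ.toTSub := σ.toTSub.up_lv
  refine ⟨by rw [e]; exact hσ.toTSub, fun i ρ t hi => ?_, fun i τ' hi => ?_, hσ.tame.up _⟩
  · rw [e]
    cases i with
    | zero =>
      obtain ⟨rfl, rfl⟩ := Prod.mk.inj (Option.some.inj hi)
      exact M.typed_evar _ _ _ _ (Ctx.proj_eq_some.2 ⟨_, rfl, LocSet.Sub.refl _⟩)
    | succ i => exact LocalLang.Typed.bindLv (hσ.lv i ρ t hi)
  · rw [e]
    exact hw i _ (hσ.pv i τ' hi)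

/-- A typed substitution stays so under a type-level variable, if its choreographies can be
weakened. -/
theorem Sub.Ok.up_ty_of {Γ Γ' : Ctx M} {σ : Sub M} (hσ : Sub.Ok Γ Γ' σ) (κ : Kind L)
    (hw : ∀ i τ', RunType Γ' (σ.pv i) τ' → RunType (Γ'.bindTy (κ.subst σ.loc σ.set))
      ((σ.pv i).rename (Ren.shift κ.sort)) (τ'.rename (Ren.shift κ.sort))) :
    Sub.Ok (Γ.bindTy κ) (Γ'.bindTy (κ.subst σ.loc σ.set)) (σ.up κ.sort) := by
  refine ⟨hσ.toTSub.up κ, fun i ρ t hi => ?_, fun i τ' hi => ?_, hσ.tame.up _⟩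
  · simp only [Ctx.bindTy, List.getElem?_map, Option.map_eq_some_iff, Prod.mk.injEq] at hi
    obtain ⟨⟨ρ₀, t₀⟩, h₀, rfl, rfl⟩ := hi
    have h := LocalLang.Typed.bindTy (κ := κ.subst σ.loc σ.set) (hσ.lv i _ _ h₀)
    rw [Kind.sort_subst, ← LocSet.subst_shift, ← LocalLang.subst_shift] at h
    have hl : (σ.up κ.sort).lv i = M.expRename (Ren.shift κ.sort) (σ.lv i) := by
      cases κ <;> rfl
    rw [hl]
    exact h
  · simp only [Ctx.bindTy, List.getElem?_map, Option.map_eq_some_iff] at hi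
    obtain ⟨τ₀, h₀, rfl⟩ := hi
    have h := hw i _ (hσ.pv i τ₀ h₀)
    rw [← CTy.subst_shift] at h
    have hp : (σ.up κ.sort).pv i = (σ.pv i).rename (Ren.shift κ.sort) := by
      cases κ <;> rfl
    rw [hp]
    exact h

/-- Typing is preserved by every class `S` of typed substitutions that is closed under
binders. Applied first to renamings, and then to all substitutions. -/
theorem RunType.subst_of_closed (S : Ctx M → Ctx M → Sub M → Prop)
    (hS : ∀ Γ Γ' σ, S Γ Γ' σ → Sub.Ok Γ Γ' σ)
    (hpv : ∀ Γ Γ' σ τ, S Γ Γ' σ →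
      S (Γ.bindPv τ) (Γ'.bindPv (τ.subst σ.toTSub)) (σ.up .pv))
    (hlv : ∀ Γ Γ' σ ρ t, S Γ Γ' σ → S (Γ.bindLv ρ t)
      (Γ'.bindLv (ρ.subst σ.loc σ.set) (M.tySubst σ.toLSub t)) (σ.up .lv))
    (hty : ∀ Γ Γ' σ κ, S Γ Γ' σ →
      S (Γ.bindTy κ) (Γ'.bindTy (κ.subst σ.loc σ.set)) (σ.up κ.sort))
    {Γ Γ' : Ctx M} {σ : Sub M} {C : Chor M} {τ : CTy M} (h : RunType Γ C τ)
    (hσ : S Γ Γ' σ) : RunType Γ' (C.subst σ) (τ.subst σ.toTSub) := by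
  have epv : ∀ σ : Sub M, (σ.up .pv).toTSub = σ.toTSub := fun σ => σ.toTSub.up_pv
  have elv : ∀ σ : Sub M, (σ.up .lv).toTSub = σ.toTSub := fun σ => σ.toTSub.up_lv
  induction h generalizing Γ' σ with
  | var h => exact (hS _ _ _ hσ).pv _ _ h
  | done hρ h =>
    exact .done (hρ.subst (hS _ _ _ hσ).toTSub.toLSub) (RunType.expSubst (hS _ _ _ hσ) h)
  | @func Γ C τ₁ τ₂ ρ₁ ρ₂ ρ ρa h₁ h₂ hρ ha hp _ ih =>
    have ok := (hS _ _ _ hσ).toTSub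
    have hσ' := hpv _ _ _ τ₁ (hpv _ _ _ (.arrow τ₁ ρ τ₂) hσ)
    have h := ih hσ'
    have hp' := (Chor.parts_subst (hS _ _ _ hσ').tame C).trans (LocSet.subst_mono _ _ hp)
    rw [epv, epv] at h hp'
    refine .func (h₁.subst ok) (h₂.subst ok) (hρ.subst ok.toLSub) ?_ hp' ?_
    · rw [ha, LocSet.subst_union, LocSet.subst_union]
    · rw [epv] at h; exact h
  | app _ _ ht₁ ht₂ ha ih₁ ih₂ =>
    have ok := (hS _ _ _ hσ).toTSub
    exact .app (ih₁ hσ) (ih₂ hσ) (ht₁.subst ok) (ht₂.subst ok)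
      (by rw [ha, LocSet.subst_union, LocSet.subst_union])
  | @tfun Γ κ C τ ρ ρt ht hp _ ih =>
    have ok := (hS _ _ _ hσ).toTSub
    have hσ' := hty _ _ _ κ (hpv _ _ _ (.all κ ρ τ) hσ)
    have h := ih hσ'
    have hp' := (Chor.parts_subst (hS _ _ _ hσ').tame C).trans (LocSet.subst_mono _ _ hp)
    have e : ((σ.up .pv).up κ.sort).toTSub = σ.toTSub.up κ.sort :=
      congrArg (TSub.up κ.sort) (epv σ)
    rw [e] at h hp'
    rw [epv] at h
    exact .tfun (ht.subst ok) hp' h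
  | @tapp Γ κ C a τ τ' ρ ρt ρa _ ha ht hτ hρ ih =>
    have ok := (hS _ _ _ hσ).toTSub
    refine .tapp (ih hσ) (ha.subst ok) (ht.subst ok) ?_ ?_
    · rw [hτ, CTy.inst_subst, ha.sort_eq]
    · rw [hρ, LocSet.subst_union, LocSet.inst_subst, ha.sort_eq]
  | @fold Γ C τ ρ ht _ ih =>
    have h := ih hσ
    rw [CTy.inst_subst] at h
    exact .fold (ht.subst (hS _ _ _ hσ).toTSub) h
  | unfold ht _ hτ ih =>
    refine .unfold (ht.subst (hS _ _ _ hσ).toTSub) (ih hσ) ?_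
    rw [hτ, CTy.inst_subst]; rfl
  | pair _ _ ht₁ ht₂ ha ih₁ ih₂ =>
    have ok := (hS _ _ _ hσ).toTSub
    exact .pair (ih₁ hσ) (ih₂ hσ) (ht₁.subst ok) (ht₂.subst ok)
      (by rw [ha, LocSet.subst_union])
  | fst _ ht₁ ht₂ ha ih =>
    have ok := (hS _ _ _ hσ).toTSub
    exact .fst (ih hσ) (ht₁.subst ok) (ht₂.subst ok) (by rw [ha, LocSet.subst_union])
  | snd _ ht₁ ht₂ ha ih =>
    have ok := (hS _ _ _ hσ).toTSub
    exact .snd (ih hσ) (ht₁.subst ok) (ht₂.subst ok) (by rw [ha, LocSet.subst_union])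
  | inl ht _ ih => exact .inl (ht.subst (hS _ _ _ hσ).toTSub) (ih hσ)
  | inr ht _ ih => exact .inr (ht.subst (hS _ _ _ hσ).toTSub) (ih hσ)
  | case ht _ _ _ ih ih₁ ih₂ =>
    have h₁ := ih₁ (hpv _ _ _ _ hσ)
    have h₂ := ih₂ (hpv _ _ _ _ hσ)
    rw [epv] at h₁ h₂
    exact .case (ht.subst (hS _ _ _ hσ).toTSub) (ih hσ) h₁ h₂
  | localCase _ hs hρ hsub _ _ ih ih₁ ih₂ =>
    have h₁ := ih₁ (hlv _ _ _ _ _ hσ)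
    have h₂ := ih₂ (hlv _ _ _ _ _ hσ)
    rw [elv] at h₁ h₂
    exact .localCase (ih hσ) (M.isSum_subst _ _ _ _ hs)
      (hρ.subst (hS _ _ _ hσ).toTSub.toLSub) (hsub.subst _ _) h₁ h₂
  | letIn _ hρ hsub _ ih₁ ih₂ =>
    have h₂ := ih₂ (hlv _ _ _ _ _ hσ)
    rw [elv] at h₂
    exact .letIn (ih₁ hσ) (hρ.subst (hS _ _ _ hσ).toTSub.toLSub) (hsub.subst _ _) h₂
  | letLoc _ hρ hsub hsub' ht _ ih₁ ih₂ =>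
    have ok := (hS _ _ _ hσ).toTSub
    have h₁ := ih₁ hσ
    have h₂ := ih₂ (hty _ _ _ .loc hσ)
    rw [CTy.subst, M.locTy_subst] at h₁
    exact .letLoc h₁ (hρ.subst ok.toLSub) (hsub.subst _ _) (hsub'.subst _ _) (ht.subst ok)
      ((CTy.subst_shift .loc σ.toTSub _) ▸ h₂)
  | @letSet Γ k _ _ _ _ _ _ _ _ hρ hsub hsub' ht _ ih₁ ih₂ =>
    have ok := (hS _ _ _ hσ).toTSub
    have h₁ := ih₁ hσ
    have h₂ := ih₂ (hty _ _ _ (.set k) hσ)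
    rw [CTy.subst, M.locsetTy_subst] at h₁
    exact .letSet h₁ (hρ.subst ok.toLSub) (hsub.subst _ _) (hsub'.subst _ _) (ht.subst ok)
      ((CTy.subst_shift .set σ.toTSub _) ▸ h₂)
  | send _ hℓ hm hρ ih =>
    have ok := (hS _ _ _ hσ).toTSub
    rw [CTy.subst, LocSet.subst_union]
    exact .send (ih hσ) (hℓ.subst ok.toLSub) (hm.subst _ _) (hρ.subst ok.toLSub)
  | sync hℓ hρ _ ih =>
    have ok := (hS _ _ _ hσ).toTSub
    exact .sync (hℓ.subst ok.toLSub) (hρ.subst ok.toLSub) (ih hσ)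
  | @fork Γ C ℓ τ ρt hℓ ht _ ih =>
    have ok := (hS _ _ _ hσ).toTSub
    have h := ih (hlv _ _ _ _ _ (hty _ _ _ .loc hσ))
    rw [elv, LocSet.subst_union, LocSet.subst_single, LocSet.subst_single, M.locTy_subst,
      LocSet.subst_single] at h
    have e₁ := CTy.subst_shift .loc σ.toTSub τ
    have e₂ := Loc.subst_shift (M := M) .loc σ.toLSub ℓ
    refine .fork (hℓ.subst ok.toLSub) (ht.subst ok) ?_
    rw [← e₁, ← e₂, Sub.up_lv_up_loc]
    exact h
  | killAfter _ ih => exact .killAfter (ih hσ)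

theorem RunType.var_inv {Γ : Ctx M} {i : ℕ} {τ : CTy M} (h : RunType Γ (.var i) τ) :
    Γ.pv[i]? = some τ := by
  cases h; assumption

theorem RunType.rename {Γ Γ' : Ctx M} {r : Ren} {C : Chor M} {τ : CTy M}
    (h : RunType Γ C τ) (hr : Sub.Ok Γ Γ' (Sub.ofRen r : Sub M)) :
    RunType Γ' (C.rename r) (τ.rename r) := by
  rw [CTy.rename_eq_subst, Chor.rename_eq_subst]
  refine h.subst_of_closed (fun Γ Γ' σ => Sub.Ok Γ Γ' σ ∧ ∃ r, σ = Sub.ofRen r)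
    (fun _ _ _ h => h.1) ?_ ?_ ?_ ⟨hr, r, rfl⟩
  · rintro Γ Γ' _ τ ⟨ok, r, rfl⟩
    exact ⟨ok.up_pv_of τ fun i τ' hi => .var hi.var_inv, _, Sub.up_ofRen _ _⟩
  · rintro Γ Γ' _ ρ t ⟨ok, r, rfl⟩
    exact ⟨ok.up_lv_of ρ t fun i τ' hi => .var hi.var_inv, _, Sub.up_ofRen _ _⟩
  · rintro Γ Γ' _ κ ⟨ok, r, rfl⟩
    refine ⟨ok.up_ty_of κ fun i τ' hi => .var ?_, _, Sub.up_ofRen _ _⟩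
    have : Ren.shift κ.sort .pv (r .pv i) = r .pv i := by cases κ <;> rfl
    rw [this]
    simp only [Ctx.bindTy, List.getElem?_map, hi.var_inv, Kind.sort_subst]
    rfl

theorem Sub.Tame.id : (Sub.id : Sub M).Tame := Sub.Tame.ofRen fun _ i => i

theorem Sub.Ok.id (Γ : Ctx M) : Sub.Ok Γ Γ (Sub.id : Sub M) where
  toTSub := TSub.Ok.id Γ.kinds
  lv i ρ t hi := by
    refine M.typed_evar _ _ _ _ (Ctx.proj_eq_some.2 ⟨ρ, ?_, ?_⟩)
    · rw [hi]
      exact congrArg (fun t => some (ρ, t)) (M.tySubst_id t).symm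
    · have : ρ.subst (Sub.id : Sub M).loc (Sub.id : Sub M).set = ρ := LocSet.subst_var ρ
      rw [this]
      exact LocSet.Sub.refl ρ
  pv i τ hi := .var (hi.trans (congrArg some (CTy.subst_id τ).symm))
  tame := Sub.Tame.id

theorem Sub.ofRen_shift_toTSub {s : BSort} (h : s = .lv ∨ s = .pv) :
    (Sub.ofRen (Ren.shift s) : Sub M).toTSub = TSub.id := by
  refine TSub.ofRen_eq_id fun s' h₁ h₂ => Ren.shift_of_ne ?_
  rcases h with rfl | rfl <;> assumption

theorem RunType.shift_pv {Γ : Ctx M} {C : Chor M} {τ : CTy M} (h : RunType Γ C τ)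
    (τ' : CTy M) : RunType (Γ.bindPv τ') (C.rename (Ren.shift .pv)) τ := by
  have hid := Sub.Ok.id Γ
  have e : (Sub.ofRen (Ren.shift .pv) : Sub M).toTSub = (Sub.id : Sub M).toTSub :=
    Sub.ofRen_shift_toTSub (.inr rfl)
  have := h.rename (Γ' := Γ.bindPv τ') (r := Ren.shift .pv)
    ⟨by rw [e]; exact hid.toTSub, by rw [e]; exact hid.lv,
      by rw [e]; exact fun i τ hi => .var ((hid.pv i τ hi).var_inv), Sub.Tame.ofRen _⟩
  rwa [CTy.rename_eq_self fun s _ h => Ren.shift_of_ne h] at this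

theorem RunType.shift_lv {Γ : Ctx M} {C : Chor M} {τ : CTy M} (h : RunType Γ C τ)
    (ρ : LocSet L) (t : M.Ty) : RunType (Γ.bindLv ρ t) (C.rename (Ren.shift .lv)) τ := by
  have hid := Sub.Ok.id Γ
  have e : (Sub.ofRen (Ren.shift .lv) : Sub M).toTSub = (Sub.id : Sub M).toTSub :=
    Sub.ofRen_shift_toTSub (.inl rfl)
  have := h.rename (Γ' := Γ.bindLv ρ t) (r := Ren.shift .lv)
    ⟨by rw [e]; exact hid.toTSub, ?_,
      by rw [e]; exact fun i τ hi => .var ((hid.pv i τ hi).var_inv), Sub.Tame.ofRen _⟩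
  · rwa [CTy.rename_eq_self fun s h _ => Ren.shift_of_ne h] at this
  · rw [e]
    intro i ρ' t' hi
    have h' := LocalLang.Typed.bindLv (ρ' := ρ) (t' := t) (hid.lv i ρ' t' hi)
    have hv : M.expRename (Ren.shift .lv) ((Sub.id : Sub M).lv i) =
      (Sub.ofRen (Ren.shift .lv)).lv i := M.expSubst_evar _ _ _
    rwa [hv] at h'

theorem RunType.shift_ty {Γ : Ctx M} {C : Chor M} {τ : CTy M} (h : RunType Γ C τ)
    (κ : Kind L) :
    RunType (Γ.bindTy κ) (C.rename (Ren.shift κ.sort)) (τ.rename (Ren.shift κ.sort)) := by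
  refine h.rename ⟨TSub.Ok.shift Γ.kinds κ, fun i ρ t hi => ?_, fun i τ hi => ?_,
    Sub.Tame.ofRen _⟩
  · have h₀ : M.Typed Γ.lctx (Γ.proj ρ) (M.evar i) t :=
      M.typed_evar _ _ _ _ (Ctx.proj_eq_some.2 ⟨ρ, hi, LocSet.Sub.refl ρ⟩)
    have h' := LocalLang.Typed.bindTy (κ := κ) h₀
    have hv : M.expRename (Ren.shift κ.sort) (M.evar i) =
      (Sub.ofRen (Ren.shift κ.sort)).lv i := M.expSubst_evar _ _ _
    rw [hv] at h'
    exact h'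
  · refine .var ?_
    have : Ren.shift κ.sort .pv i = i := by cases κ <;> rfl
    rw [this]
    simp only [Ctx.bindTy, List.getElem?_map, hi]
    exact congrArg some (CTy.rename_eq_subst _ _)

/-- Substitution preserves types. -/
theorem RunType.subst {Γ Γ' : Ctx M} {σ : Sub M} {C : Chor M} {τ : CTy M}
    (h : RunType Γ C τ) (hσ : Sub.Ok Γ Γ' σ) :
    RunType Γ' (C.subst σ) (τ.subst σ.toTSub) := by
  refine h.subst_of_closed Sub.Ok (fun _ _ _ h => h) ?_ ?_ ?_ hσ
  · exact fun Γ Γ' σ τ ok => ok.up_pv_of τ fun i τ' hi => hi.shift_pv _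
  · exact fun Γ Γ' σ ρ t ok => ok.up_lv_of ρ t fun i τ' hi => hi.shift_lv _ _
  · refine fun Γ Γ' σ κ ok => ok.up_ty_of κ fun i τ' hi => ?_
    simpa only [Kind.sort_subst] using hi.shift_ty (κ.subst σ.loc σ.set)

theorem Sub.Tame.consLv {σ : Sub M} (hσ : σ.Tame) {e : M.Exp} (he : M.Val e) :
    ({ σ with lv := cons e σ.lv } : Sub M).Tame :=
  ⟨hσ.parts, hσ.kills, fun i => by cases i with
    | zero => exact .inl he
    | succ i => exact hσ.lv i⟩

theorem Sub.Tame.consPv {σ : Sub M} (hσ : σ.Tame) {C : Chor M} (hp : C.parts = ∅)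
    (hk : C.kills = ∅) : ({ σ with pv := cons C σ.pv } : Sub M).Tame :=
  ⟨fun i => by cases i with
    | zero => exact hp
    | succ i => exact hσ.parts i,
  fun i => by cases i with
    | zero => exact hk
    | succ i => exact hσ.kills i, hσ.lv⟩

/-- Extend a substitution by a local value. -/
theorem Sub.Ok.consLv {Γ Γ' : Ctx M} {σ : Sub M} (hσ : Sub.Ok Γ Γ' σ) {ρ : LocSet L}
    {t : M.Ty} {e : M.Exp} (he : M.Val e)
    (ht : M.Typed Γ'.lctx (Γ'.proj (ρ.subst σ.loc σ.set)) e (M.tySubst σ.toLSub t)) :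
    Sub.Ok (Γ.bindLv ρ t) Γ' { σ with lv := cons e σ.lv } := by
  refine ⟨hσ.toTSub, fun i ρ' t' hi => ?_, hσ.pv, hσ.tame.consLv he⟩
  cases i with
  | zero =>
    obtain ⟨rfl, rfl⟩ := Prod.mk.inj (Option.some.inj hi)
    exact ht
  | succ i => exact hσ.lv i ρ' t' hi

/-- Extend a substitution by a choreography without participants and threads. -/
theorem Sub.Ok.consPv {Γ Γ' : Ctx M} {σ : Sub M} (hσ : Sub.Ok Γ Γ' σ) {τ : CTy M}
    {C : Chor M} (hp : C.parts = ∅) (hk : C.kills = ∅)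
    (hC : RunType Γ' C (τ.subst σ.toTSub)) :
    Sub.Ok (Γ.bindPv τ) Γ' { σ with pv := cons C σ.pv } := by
  refine ⟨hσ.toTSub, hσ.lv, fun i τ' hi => ?_, hσ.tame.consPv hp hk⟩
  cases i with
  | zero =>
    obtain rfl := Option.some.inj hi
    exact hC
  | succ i => exact hσ.pv i τ' hi

theorem Sub.Tame.tinst (a : TArg M) : (Sub.tinst a).Tame :=
  ⟨fun _ => rfl, fun _ => rfl, fun _ => .inr ⟨_, rfl⟩⟩

theorem Sub.Ok.tinst {Γ : Ctx M} {a : TArg M} {κ : Kind L} (ha : TArgOk Γ.kinds a κ) :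
    Sub.Ok (Γ.bindTy κ) Γ (Sub.tinst a) := by
  refine ⟨ha.inst, fun i ρ t hi => ?_, fun i τ hi => ?_, Sub.Tame.tinst a⟩
  · simp only [Ctx.bindTy, List.getElem?_map, Option.map_eq_some_iff, Prod.mk.injEq] at hi
    obtain ⟨⟨ρ₀, t₀⟩, h₀, rfl, rfl⟩ := hi
    rw [← ha.sort_eq]
    refine M.typed_evar _ _ _ _ (Ctx.proj_eq_some.2 ⟨ρ₀, ?_, ?_⟩)
    · exact h₀.trans (congrArg (fun t => some (ρ₀, t)) (LocalLang.shift_inst a t₀).symm)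
    · exact .inr (LocSet.shift_inst a ρ₀).subset
  · simp only [Ctx.bindTy, List.getElem?_map, Option.map_eq_some_iff] at hi
    obtain ⟨τ₀, h₀, rfl⟩ := hi
    refine .var (h₀.trans (congrArg some ?_))
    rw [← ha.sort_eq]
    exact (CTy.shift_inst a τ₀).symm

end Typing

/-! ### Steps preserve types -/

section Preservation

variable {L : Type u} [DecidableEq L] {M : LocalLang.{u, v, w} L}

theorem LocSet.mem_const_rename {r : Ren} {ρ : LocSet L} {a : L}
    (h : Mem (.const a) (ρ.rename r)) : Mem (.const a) ρ := by
  refine h.imp const_mem_rename.1 fun h => ?_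
  obtain ⟨y, hy, hxy⟩ := mem_subst.1 h
  cases y with
  | top => exact hy
  | _ => simp [Atom.subst] at hxy

theorem Redex.rloc_rename (r : Ren) (R : Redex M) : (R.rename r).rloc = R.rloc.rename r := by
  induction R with
  | sendV a m ρ =>
    cases m <;> simp only [rename, rloc, LocSet.rename, LocSet.subst_union,
      LocSet.subst_single] <;> rfl
  | fork a b C => exact (LocSet.subst_single (L := L) _ _ (.const a)).symm
  | kill a => exact (LocSet.subst_single (L := L) _ _ (.const a)).symm
  | func R ih => exact ih
  | arg R ih => exact ih
  | pairL R ih => exact ih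
  | pairR R ih => exact ih
  | _ => rfl

theorem Frame.rloc_label (η : Frame M) (R : Redex M) : (η.label R).rloc = R.rloc := by
  cases η <;> rfl

/-- No local variable of `Γ` is known to a location that takes part in `R`. -/
def Ctx.Apart (Γ : Ctx M) (R : Redex M) : Prop :=
  ∀ p ∈ Γ.lv, ∀ a, LocSet.Mem (.const a) R.rloc → ¬ LocSet.Mem (.const a) p.1

theorem Ctx.Apart.of_lower {Γ : Ctx M} {R : Redex M} {s : BSort} (h : Γ.Apart (R.lower s)) :
    Γ.Apart R := fun p hp a ha => h p hp a <| by
  rw [Redex.lower, Redex.rloc_rename]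
  exact ha.subst _ _

theorem Ctx.Apart.bindTy {Γ : Ctx M} {R : Redex M} (h : Γ.Apart R) (κ : Kind L) :
    (Γ.bindTy κ).Apart R := by
  intro p hp a ha hm
  obtain ⟨q, hq, rfl⟩ := List.mem_map.1 hp
  exact h q hq a ha (LocSet.mem_const_rename hm)

theorem Ctx.Apart.bindLv {Γ : Ctx M} {R : Redex M} (h : Γ.Apart R) {ρ : LocSet L} (t : M.Ty)
    (hρ : ∀ a, LocSet.Mem (.const a) R.rloc → ¬ LocSet.Mem (.const a) ρ) :
    (Γ.bindLv ρ t).Apart R := by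
  intro p hp
  rcases List.mem_cons.1 hp with rfl | hp
  · exact hρ
  · exact h p hp

theorem LocSet.Disj.not_mem_right {ρ ρ₁ ρ₂ : LocSet L} (h : Disj ρ (ρ₁ ∪ ρ₂)) (a : L)
    (ha : Mem (.const a) ρ) : ¬ Mem (.const a) ρ₂ := fun hm =>
  h _ ⟨ha, hm.imp (Finset.mem_union_right _) (Finset.mem_union_right _)⟩

theorem RunType.subst_id {Γ Γ' : Ctx M} {σ : Sub M} (hσ : Sub.Ok Γ Γ' σ)
    (he : σ.toTSub = TSub.id) {C : Chor M} {τ : CTy M} (h : RunType Γ C τ) :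
    RunType Γ' (C.subst σ) τ := by
  have := h.subst hσ
  rwa [he, CTy.subst_id] at this

theorem Sub.Ok.chor₁ {Γ : Ctx M} {V : Chor M} {τ : CTy M} (h : RunType Γ V τ) (hV : V.Value)
    (hl : V.Lin) : Sub.Ok (Γ.bindPv τ) Γ (Sub.chor₁ V) :=
  (Sub.Ok.id Γ).consPv hV.parts_eq_empty (hV.kills_eq_empty hl) <| by
    rwa [show (Sub.id : Sub M).toTSub = TSub.id from rfl, CTy.subst_id]

theorem Sub.Ok.chor₂ {Γ : Ctx M} {V₀ V₁ : Chor M} {τ₀ τ₁ : CTy M} (h₀ : RunType Γ V₀ τ₀)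
    (hV₀ : V₀.Value) (hl₀ : V₀.Lin) (h₁ : RunType Γ V₁ τ₁) (hV₁ : V₁.Value) (hl₁ : V₁.Lin) :
    Sub.Ok ((Γ.bindPv τ₁).bindPv τ₀) Γ (Sub.chor₂ V₀ V₁) :=
  (Sub.Ok.chor₁ h₁ hV₁ hl₁).consPv hV₀.parts_eq_empty (hV₀.kills_eq_empty hl₀) <| by
    rwa [show (Sub.chor₁ V₁).toTSub = TSub.id from rfl, CTy.subst_id]

theorem Sub.Ok.local₁ {Γ : Ctx M} {v : M.Exp} {ρ ρ' : LocSet L} {t : M.Ty} (hv : M.Val v)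
    (h : M.Typed Γ.lctx (Γ.proj ρ') v t) (hs : LocSet.Sub ρ ρ') :
    Sub.Ok (Γ.bindLv ρ t) Γ (Sub.local₁ v) :=
  (Sub.Ok.id Γ).consLv hv <| by
    have h₁ : ρ.subst (Sub.id : Sub M).loc (Sub.id : Sub M).set = ρ := LocSet.subst_var ρ
    have h₂ : M.tySubst (Sub.id : Sub M).toLSub t = t := M.tySubst_id t
    rw [h₁, h₂]
    exact LocalLang.Typed.proj_mono h hs

theorem Sub.Ok.fork {Γ : Ctx M} {b : L} {v : M.Exp} (ρ : LocSet L) (hr : M.RepLoc v b) :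
    Sub.Ok ((Γ.bindTy .loc).bindLv ρ (M.locTy (LocSet.single (.var 0)))) Γ
      { (Sub.tinst (.loc (.const b)) : Sub M) with lv := cons v M.evar } := by
  refine (Sub.Ok.tinst (κ := .loc) (a := .loc (.const b)) (.loc trivial)).consLv
    (M.repLoc_val v b hr) ?_
  rw [M.locTy_subst, LocSet.subst_single]
  exact LocalLang.Typed.of_empty (M.repLoc_typed v b hr)

theorem ofFinset_setOk {Γ : LCtx} (k : SetKind) (s : Finset L) :
    SetOk Γ k (LocSet.ofFinset s) := by
  intro x hx
  obtain ⟨a, _, rfl⟩ := Finset.mem_image.1 hx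
  trivial

/-- Steps preserve types, also under binders, where the local variables in scope must not be
known to the acting locations: otherwise an out-of-order send could move a value that
contains a variable to locations that do not know it. -/
theorem Step.runType {c c' : Config M} {R : Redex M} (h : Step c R c') {Γ : Ctx M} {τ : CTy M}
    (ht : RunType Γ c.1 τ) (hl : c.1.Lin) (ha : Γ.Apart R) : RunType Γ c'.1 τ := by
  induction h generalizing Γ τ with
  | @ctx η C C' Ω Ω' R hη _ ih =>
    have ha : Γ.Apart R := fun p hp a h => ha p hp a (by rwa [Frame.rloc_label])
    cases η with
    | appL => cases ht with | app h₁ h₂ a b c => exact .app (ih h₁ hl.1 ha) h₂ a b c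
    | appR => cases ht with | app h₁ h₂ a b c => exact .app h₁ (ih h₂ hl.2.1 ha) a b c
    | tapp => cases ht with | tapp h a b c d => exact .tapp (ih h hl.1 ha) a b c d
    | fold => cases ht with | fold a h => exact .fold a (ih h hl.1 ha)
    | unfold => cases ht with | unfold a h b => exact .unfold a (ih h hl.1 ha) b
    | pairL => cases ht with | pair h₁ h₂ a b c => exact .pair (ih h₁ hl.1 ha) h₂ a b c
    | pairR => cases ht with | pair h₁ h₂ a b c => exact .pair h₁ (ih h₂ hl.2.1 ha) a b c
    | fst => cases ht with | fst h a b c => exact .fst (ih h hl.1 ha) a b c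
    | snd => cases ht with | snd h a b c => exact .snd (ih h hl.1 ha) a b c
    | inl => cases ht with | inl a h => exact .inl a (ih h hl.1 ha)
    | inr => cases ht with | inr a h => exact .inr a (ih h hl.1 ha)
    | case => cases ht with | case a h h₁ h₂ => exact .case a (ih h hl.1 ha) h₁ h₂
    | localCase =>
      cases ht with | localCase h a b c h₁ h₂ => exact .localCase (ih h hl.1 ha) a b c h₁ h₂
    | letIn => cases ht with | letIn h a b h₂ => exact .letIn (ih h hl.1 ha) a b h₂
    | letLoc =>
      cases ht with | letLoc h a b c d h₂ => exact .letLoc (ih h hl.1 ha) a b c d h₂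
    | letSet =>
      cases ht with | letSet h a b c d h₂ => exact .letSet (ih h hl.1 ha) a b c d h₂
    | send => cases ht with | send h a b c => exact .send (ih h hl.1 ha) a b c
    | killAfter => cases ht with | killAfter h => exact .killAfter (ih h hl.1 ha)
  | done _ hs => cases ht with | done hρ h => exact .done hρ (M.preservation _ _ _ _ _ h hs)
  | app _ hV =>
    cases ht with
    | app h₁ h₂ =>
      have hf := h₁
      cases h₁ with
      | func _ _ _ _ _ hC =>
        exact hC.subst_id (Sub.Ok.chor₂ h₂ hV hl.2.1 hf .func hl.1) rfl
  | @tapp ρ κ C a Ω _ =>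
    cases ht with
    | tapp h hk _ hτ _ =>
      have hf := h
      cases h with
      | tfun _ _ hC =>
        have h₁ := hC.subst (Sub.Ok.tinst hk)
        subst hτ
        exact h₁.subst_id (Sub.Ok.chor₁ hf .tfun hl.1) rfl
  | unfoldFold _ _ =>
    cases ht with
    | unfold _ h hτ => cases h with | fold _ h => exact hτ ▸ h
  | fstPair _ _ _ => cases ht with | fst h => cases h with | pair h₁ _ => exact h₁
  | sndPair _ _ _ => cases ht with | snd h => cases h with | pair _ h₂ => exact h₂
  | caseInl _ hV =>
    cases ht with
    | case _ h h₁ _ =>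
      cases h with | inl _ h => exact h₁.subst_id (Sub.Ok.chor₁ h hV hl.1.1) rfl
  | caseInr _ hV =>
    cases ht with
    | case _ h _ h₂ =>
      cases h with | inr _ h => exact h₂.subst_id (Sub.Ok.chor₁ h hV hl.1.1) rfl
  | localCaseInl _ hs hv hc =>
    cases ht with
    | localCase h hsum _ _ h₁ _ =>
      cases h with
      | done _ h =>
        obtain ⟨hv₁, h'⟩ := M.getCase_inl _ _ _ _ _ _ _ hsum hv h hc
        exact h₁.subst_id (Sub.Ok.local₁ hv₁ h' hs) rfl
  | localCaseInr _ hs hv hc =>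
    cases ht with
    | localCase h hsum _ _ _ h₂ =>
      cases h with
      | done _ h =>
        obtain ⟨hv₁, h'⟩ := M.getCase_inr _ _ _ _ _ _ _ hsum hv h hc
        exact h₂.subst_id (Sub.Ok.local₁ hv₁ h' hs) rfl
  | letV _ hs hv =>
    cases ht with
    | letIn h _ _ h₂ => cases h with | done _ h => exact h₂.subst_id (Sub.Ok.local₁ hv h hs) rfl
  | @letLocV ρ ρ' v a C Ω _ hs hv hr =>
    cases ht with
    | letLoc h _ _ _ _ h₂ =>
      have := h₂.subst (Sub.Ok.tinst (κ := .loc) (a := .loc (.const a)) (.loc trivial))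
      have e := CTy.shift_inst (.loc (.const a)) τ
      exact e ▸ this
  | @letSetV ρ ρ' k v s C Ω _ hs hv hr =>
    cases ht with
    | letSet h _ _ _ _ h₂ =>
      have := h₂.subst (Sub.Ok.tinst (κ := .set k) (a := .set (LocSet.ofFinset s))
        (.set (ofFinset_setOk k s)))
      have e := CTy.shift_inst (.set (LocSet.ofFinset s)) τ
      exact e ▸ this
  | @sendV ρ₁ ρ₂ a v Ω _ _ hm hv =>
    cases ht with
    | send h _ _ hρ =>
      cases h with
      | done hρ₁ h =>
        -- no local variable is known to the sender `a`, so `v` is closed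
        refine .done (hρ₁.union hρ) (LocalLang.Typed.weaken h fun i s hi => ?_)
        obtain ⟨ρ', h', hs⟩ := Ctx.proj_eq_some.1 hi
        refine absurd (hm.of_sub hs) (ha _ (List.mem_of_getElem? h') a (.inl ?_))
        exact Finset.mem_union_left _ (Finset.mem_singleton_self _)
  | sync _ _ => cases ht with | sync _ _ h => exact h
  | @fork a b v C Ω _ _ hr =>
    cases ht with
    | fork _ _ h =>
      have := h.subst (Sub.Ok.fork _ hr)
      have e := CTy.shift_inst (.loc (.const b)) τ
      exact .killAfter (e ▸ this)
  | kill _ _ => cases ht with | killAfter h => exact h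
  | appI _ _ ih => cases ht with | app h₁ h₂ a b c => exact .app h₁ (ih h₂ hl.2.1 ha) a b c
  | pairI _ _ ih => cases ht with | pair h₁ h₂ a b c => exact .pair h₁ (ih h₂ hl.2.1 ha) a b c
  | caseI _ _ _ ih₁ ih₂ =>
    cases ht with
    | case a h h₁ h₂ =>
      exact .case a h (ih₁ h₁ hl.2.1 ha.of_lower) (ih₂ h₂ hl.2.2.1 ha.of_lower)
  | localCaseI _ _ hd ih₁ ih₂ =>
    cases ht with
    | localCase h a b c h₁ h₂ =>
      exact .localCase h a b c (ih₁ h₁ hl.2.1 (ha.of_lower.bindLv _ hd.not_mem_right))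
        (ih₂ h₂ hl.2.2.1 (ha.of_lower.bindLv _ hd.not_mem_right))
  | letLocI _ _ ih =>
    cases ht with
    | letLoc h a b c d h₂ => exact .letLoc h a b c d (ih h₂ hl.2.1 (ha.of_lower.bindTy _))
  | letSetI _ _ ih =>
    cases ht with
    | letSet h a b c d h₂ => exact .letSet h a b c d (ih h₂ hl.2.1 (ha.of_lower.bindTy _))
  | syncI _ _ ih => cases ht with | sync a b h => exact .sync a b (ih h hl.1 ha)
  | forkI _ hd ih =>
    cases ht with
    | fork a b h =>
      refine .fork a b (ih h hl.1 ((ha.of_lower.of_lower.bindTy _).bindLv _ fun c hc hm => ?_))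
      rcases hm with hm | hm
      · rcases Finset.mem_union.1 hm with hm | hm
        · -- the forked location is a variable, and not a constant
          simp [LocSet.single] at hm
        · exact hd ((Atom.loc.inj (Finset.mem_singleton.1 hm)) ▸ hc)
      · simp [LocSet.single] at hm
  | killI _ _ => cases ht with | killAfter h => exact h
  | _ =>
    -- the out-of-order step in the body of a `letIn`, whose constructor is named by a keyword
    rename_i hd ih
    cases ht with
    | letIn h a b h₂ => exact .letIn h a b (ih h₂ hl.2.1 (ha.of_lower.bindLv _ hd.not_mem_right))

/-! ### Steps preserve the use of threads -/

/-- All participants and all running threads of `C` are live. -/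
structure Chor.Within (Ω : Finset L) (C : Chor M) : Prop where
  parts : ∀ a, Atom.loc (.const a) ∈ C.parts → a ∈ Ω
  kills : C.kills ⊆ Ω

theorem Chor.Within.of_subset {Ω : Finset L} {C D : Chor M} (h : D.Within Ω)
    (hp : ∀ a, Atom.loc (.const a) ∈ C.parts → Atom.loc (.const a) ∈ D.parts)
    (hk : C.kills ⊆ D.kills) : C.Within Ω :=
  ⟨fun a ha => h.parts a (hp a ha), hk.trans h.kills⟩

/-- How the participants, the running threads and the live locations change in a step: no
participants are added, new running threads are freshly spawned, and only locations that were
running threads die. -/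
structure Evolves (C : Chor M) (Ω : Finset L) (C' : Chor M) (Ω' : Finset L) : Prop where
  lin : C'.Lin
  parts : C'.parts ⊆ C.parts
  kills : C'.kills ⊆ C.kills ∪ (Ω' \ Ω)
  live : C'.kills ⊆ Ω'
  alive : Ω ⊆ Ω' ∪ C.kills

theorem Evolves.within {C C' : Chor M} {Ω Ω' : Finset L} (h : Evolves C Ω C' Ω')
    (hl : C.Lin) (hw : C.Within Ω) : C'.Within Ω' := by
  refine ⟨fun a ha => ?_, h.live⟩
  have ha := h.parts ha
  rcases Finset.mem_union.1 (h.alive (hw.parts a ha)) with h' | h'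
  · exact h'
  · exact absurd ha (hl.sep a h')

/-- If some of the threads of `D` evolve from `k` to `k'` and the other ones, `K`, are left
alone, then `D` evolves. -/
theorem Evolves.node {D D' : Chor M} {Ω Ω' k k' K : Finset L} (hD : D.Lin)
    (hw : D.Within Ω) (h₁ : k' ⊆ k ∪ (Ω' \ Ω)) (h₂ : k' ⊆ Ω') (h₃ : Ω ⊆ Ω' ∪ k)
    (hk : D.kills = k ∪ K) (hk' : D'.kills = k' ∪ K) (hp : D'.parts ⊆ D.parts)
    (hd : Disjoint k K) (hlin : Disjoint k' K → D'.Sep → D'.Lin) : Evolves D Ω D' Ω' := by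
  have hKΩ : ∀ a ∈ K, a ∈ Ω := fun a ha =>
    hw.kills (by rw [hk]; exact Finset.mem_union_right _ ha)
  have hd' : Disjoint k' K := by
    refine Finset.disjoint_left.2 fun a ha hK => ?_
    rcases Finset.mem_union.1 (h₁ ha) with h | h
    · exact Finset.disjoint_left.1 hd h hK
    · exact (Finset.mem_sdiff.1 h).2 (hKΩ a hK)
  refine ⟨hlin hd' fun a ha hpa => ?_, hp, fun a ha => ?_, fun a ha => ?_, fun a ha => ?_⟩
  · have hpa := hp hpa
    rw [hk'] at ha
    rcases Finset.mem_union.1 ha with ha | ha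
    · rcases Finset.mem_union.1 (h₁ ha) with h | h
      · exact hD.sep a (by rw [hk]; exact Finset.mem_union_left _ h) hpa
      · exact (Finset.mem_sdiff.1 h).2 (hw.parts a hpa)
    · exact hD.sep a (by rw [hk]; exact Finset.mem_union_right _ ha) hpa
  · rw [hk'] at ha
    rw [hk]
    have := @h₁ a
    simp only [Finset.mem_union] at ha this ⊢
    tauto
  · rw [hk'] at ha
    rcases Finset.mem_union.1 ha with ha | ha
    · exact h₂ ha
    · rcases Finset.mem_union.1 (h₃ (hKΩ a ha)) with h | h
      · exact h
      · exact absurd ha (Finset.disjoint_left.1 hd h)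
  · rw [hk]
    have := h₃ ha
    simp only [Finset.mem_union] at this ⊢
    tauto

/-- A step of an immediate subterm, next to which the threads `K` are running. -/
theorem Evolves.child {C C' D D' : Chor M} {Ω Ω' : Finset L} (K : Finset L)
    (h : Evolves C Ω C' Ω') (hD : D.Lin) (hw : D.Within Ω)
    (hk : D.kills = C.kills ∪ K) (hk' : D'.kills = C'.kills ∪ K) (hp : D'.parts ⊆ D.parts)
    (hd : Disjoint C.kills K) (hlin : Disjoint C'.kills K → D'.Sep → D'.Lin) :
    Evolves D Ω D' Ω' :=
  Evolves.node hD hw h.kills h.live h.alive hk hk' hp hd hlin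

/-- A step of the only subterm that can have running threads. -/
theorem Evolves.only {C C' D D' : Chor M} {Ω Ω' : Finset L} (h : Evolves C Ω C' Ω')
    (hD : D.Lin) (hw : D.Within Ω) (hk : D.kills = C.kills) (hk' : D'.kills = C'.kills)
    (hp : D'.parts ⊆ D.parts) (hlin : D'.Sep → D'.Lin) : Evolves D Ω D' Ω' :=
  h.child ∅ hD hw (by simp [hk]) (by simp [hk']) hp (by simp) fun _ => hlin

/-- A step of the left one of two subterms. -/
theorem Evolves.left {C C' E D D' : Chor M} {Ω Ω' : Finset L} (h : Evolves C Ω C' Ω')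
    (hD : D.Lin) (hw : D.Within Ω) (hk : D.kills = C.kills ∪ E.kills)
    (hk' : D'.kills = C'.kills ∪ E.kills) (hp : D'.parts ⊆ D.parts)
    (hd : Disjoint C.kills E.kills)
    (hlin : Disjoint C'.kills E.kills → D'.Sep → D'.Lin) : Evolves D Ω D' Ω' :=
  h.child E.kills hD hw hk hk' hp hd hlin

/-- A step of the right one of two subterms. -/
theorem Evolves.right {C C' E D D' : Chor M} {Ω Ω' : Finset L} (h : Evolves C Ω C' Ω')
    (hD : D.Lin) (hw : D.Within Ω) (hk : D.kills = E.kills ∪ C.kills)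
    (hk' : D'.kills = E.kills ∪ C'.kills) (hp : D'.parts ⊆ D.parts)
    (hd : Disjoint E.kills C.kills)
    (hlin : Disjoint E.kills C'.kills → D'.Sep → D'.Lin) : Evolves D Ω D' Ω' :=
  h.child E.kills hD hw (by rw [hk, Finset.union_comm]) (by rw [hk', Finset.union_comm]) hp
    hd.symm fun h => hlin h.symm

/-- A reduction that leaves the live locations alone. -/
theorem Evolves.reduce {D D' : Chor M} {Ω : Finset L} (hw : D.Within Ω) (hl : D'.Lin)
    (hp : D'.parts ⊆ D.parts) (hk : D'.kills ⊆ D.kills) : Evolves D Ω D' Ω :=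
  ⟨hl, hp, hk.trans Finset.subset_union_left, hk.trans hw.kills, Finset.subset_union_left⟩

theorem Chor.parts_subst_id {σ : Sub M} (hσ : σ.Tame) (he : σ.toTSub = TSub.id) (C : Chor M) :
    (C.subst σ).parts ⊆ C.parts := by
  have := C.parts_subst hσ
  rw [he] at this
  exact this.trans (LocSet.subst_var _).subset

theorem Chor.Lin.subst_id {σ : Sub M} (hσ : σ.Tame) (he : σ.toTSub = TSub.id) {C : Chor M}
    (h : C.Lin) : (C.subst σ).Lin := by
  refine h.subst hσ ?_
  rw [he]
  exact ⟨fun i a _ h => by simp [TSub.id, LSub.ofRen] at h,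
    fun i a _ h => by simp [TSub.id, LSub.ofRen] at h⟩

/-- A reduction to an instance of a subterm that does not touch the type-level variables. -/
theorem Evolves.reduce_subst {C D : Chor M} {Ω : Finset L} {σ : Sub M} (hσ : σ.Tame)
    (he : σ.toTSub = TSub.id) (hw : D.Within Ω) (hl : C.Lin) (hp : C.parts ⊆ D.parts)
    (hk : C.kills ⊆ D.kills) : Evolves D Ω (C.subst σ) Ω :=
  Evolves.reduce hw (hl.subst_id hσ he) ((C.parts_subst_id hσ he).trans hp)
    ((Chor.kills_subst hσ C).subset.trans hk)

theorem Sub.Tame.chor₁ {V : Chor M} (hV : V.Value) (hl : V.Lin) : (Sub.chor₁ V).Tame :=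
  Sub.Tame.id.consPv hV.parts_eq_empty (hV.kills_eq_empty hl)

theorem Sub.Tame.local₁ {v : M.Exp} (hv : M.Val v) : (Sub.local₁ v).Tame :=
  Sub.Tame.id.consLv hv

theorem LocSet.mem_of_sub_fin {Γ : LCtx} {ρ ρ' : LocSet L} {a : L} (hρ : SetOk Γ .fin ρ)
    (h : Mem (.const a) ρ') (hs : Sub ρ' ρ) : Atom.loc (.const a) ∈ ρ := by
  rcases h.of_sub hs with h | h
  · exact h
  · exact absurd (hρ _ h) (by simp)

theorem LSub.Avoids.inst_loc {K : Finset L} {a : L} (h : a ∉ K) :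
    LSub.Avoids K (TArg.loc (.const a) : TArg M).inst.toLSub := by
  refine ⟨fun i b hb he => ?_, fun i b _ he => by simp [TArg.inst, TSub.id, LSub.ofRen] at he⟩
  cases i with
  | zero => exact h (Loc.const.inj he ▸ hb)
  | succ i => simp [TArg.inst, cons] at he

theorem LSub.Avoids.inst_set {K : Finset L} {ρ : LocSet L}
    (h : ∀ a ∈ K, Atom.loc (.const a) ∉ ρ) :
    LSub.Avoids K (TArg.set ρ : TArg M).inst.toLSub := by
  refine ⟨fun i b _ he => by simp [TArg.inst, TSub.id, LSub.ofRen] at he, fun i b hb he => ?_⟩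
  cases i with
  | zero => exact h b hb he
  | succ i => simp [TArg.inst, cons] at he

end Preservation

section Soundness

variable {L : Type u} [DecidableEq L] {M : LocalLang.{u, v, w} L}

open Finset in
/-- Steps of typed choreographies use threads linearly, also under binders. Typing bounds the
participants of an applied function by the annotation of the application, and the locations
that are substituted for a variable by the location set of its `let`. -/
theorem Step.evolves {c c' : Config M} {R : Redex M} (h : Step c R c') {Γ : Ctx M} {τ : CTy M}
    (ht : RunType Γ c.1 τ) (hl : c.1.Lin) (hw : c.1.Within c.2) :
    Evolves c.1 c.2 c'.1 c'.2 := by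
  induction h generalizing Γ τ with
  | @ctx η C C' Ω Ω' R hη _ ih =>
    have sub : ∀ {C D : Chor M}, D.Within Ω → C.parts ⊆ D.parts → C.kills ⊆ D.kills →
        C.Within Ω := fun h hp hk => h.of_subset (fun _ h => hp h) hk
    cases η with
    | appL ρ C₂ =>
      cases ht with
      | app h₁ =>
        have e := ih h₁ hl.1 (sub hw (by simp [Frame.plug, Chor.parts, union_assoc])
          (by simp [Frame.plug, Chor.kills]))
        exact e.left hl hw rfl rfl (by dsimp [Frame.plug, Chor.parts]; gcongr; exact e.parts)
          hl.2.2.1 fun hd hs => ⟨e.lin, hl.2.1, hd, hs⟩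
    | appR ρ V =>
      cases ht with
      | app _ h₂ =>
        have e := ih h₂ hl.2.1 (sub hw
          (subset_union_right.trans subset_union_left) subset_union_right)
        exact e.right hl hw rfl rfl (by dsimp [Frame.plug, Chor.parts]; gcongr; exact e.parts)
          hl.2.2.1 fun hd hs => ⟨hl.1, e.lin, hd, hs⟩
    | tapp ρ a =>
      cases ht with
      | tapp h =>
        have e := ih h hl.1 (sub hw subset_union_left (Subset.refl _))
        exact e.only hl hw rfl rfl (by dsimp [Frame.plug, Chor.parts]; gcongr; exact e.parts)
          fun hs => ⟨e.lin, hs⟩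
    | fold ρ =>
      cases ht with
      | fold _ h =>
        have e := ih h hl.1 (sub hw (Subset.refl _) (Subset.refl _))
        exact e.only hl hw rfl rfl e.parts fun hs => ⟨e.lin, hs⟩
    | unfold ρ =>
      cases ht with
      | unfold _ h =>
        have e := ih h hl.1 (sub hw subset_union_left (Subset.refl _))
        exact e.only hl hw rfl rfl (by dsimp [Frame.plug, Chor.parts]; gcongr; exact e.parts)
          fun hs => ⟨e.lin, hs⟩
    | pairL ρ C₂ =>
      cases ht with
      | pair h₁ =>
        have e := ih h₁ hl.1 (sub hw subset_union_left subset_union_left)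
        exact e.left hl hw rfl rfl (by dsimp [Frame.plug, Chor.parts]; gcongr; exact e.parts)
          hl.2.2.1 fun hd hs => ⟨e.lin, hl.2.1, hd, hs⟩
    | pairR ρ V =>
      cases ht with
      | pair _ h₂ =>
        have e := ih h₂ hl.2.1 (sub hw subset_union_right subset_union_right)
        exact e.right hl hw rfl rfl (by dsimp [Frame.plug, Chor.parts]; gcongr; exact e.parts)
          hl.2.2.1 fun hd hs => ⟨hl.1, e.lin, hd, hs⟩
    | fst ρ =>
      cases ht with
      | fst h =>
        have e := ih h hl.1 (sub hw subset_union_left (Subset.refl _))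
        exact e.only hl hw rfl rfl (by dsimp [Frame.plug, Chor.parts]; gcongr; exact e.parts)
          fun hs => ⟨e.lin, hs⟩
    | snd ρ =>
      cases ht with
      | snd h =>
        have e := ih h hl.1 (sub hw subset_union_left (Subset.refl _))
        exact e.only hl hw rfl rfl (by dsimp [Frame.plug, Chor.parts]; gcongr; exact e.parts)
          fun hs => ⟨e.lin, hs⟩
    | inl ρ =>
      cases ht with
      | inl _ h =>
        have e := ih h hl.1 (sub hw (Subset.refl _) (Subset.refl _))
        exact e.only hl hw rfl rfl e.parts fun hs => ⟨e.lin, hs⟩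
    | inr ρ =>
      cases ht with
      | inr _ h =>
        have e := ih h hl.1 (sub hw (Subset.refl _) (Subset.refl _))
        exact e.only hl hw rfl rfl e.parts fun hs => ⟨e.lin, hs⟩
    | case ρ C₁ C₂ =>
      cases ht with
      | case _ h =>
        have e := ih h hl.1 (sub hw
          (subset_union_left.trans (subset_union_left.trans subset_union_left))
          subset_union_left)
        exact e.child (C₁.kills ∪ C₂.kills) hl hw rfl rfl
          (by dsimp [Frame.plug, Chor.parts]; gcongr; exact e.parts)
          hl.2.2.2.1 fun hd hs => ⟨e.lin, hl.2.1, hl.2.2.1, hd, hs⟩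
    | localCase ρ C₁ C₂ =>
      cases ht with
      | localCase h =>
        have e := ih h hl.1 (sub hw
          (subset_union_left.trans (subset_union_left.trans subset_union_left))
          subset_union_left)
        exact e.child (C₁.kills ∪ C₂.kills) hl hw rfl rfl
          (by dsimp [Frame.plug, Chor.parts]; gcongr; exact e.parts)
          hl.2.2.2.1 fun hd hs => ⟨e.lin, hl.2.1, hl.2.2.1, hd, hs⟩
    | letIn ρ t C₂ =>
      cases ht with
      | letIn h₁ =>
        have e := ih h₁ hl.1 (sub hw (subset_union_left.trans subset_union_left)
          subset_union_left)
        exact e.left hl hw rfl rfl (by dsimp [Frame.plug, Chor.parts]; gcongr; exact e.parts)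
          hl.2.2.1 fun hd hs => ⟨e.lin, hl.2.1, hd, hs⟩
    | letLoc ρ C₂ =>
      cases ht with
      | letLoc h₁ =>
        have e := ih h₁ hl.1 (sub hw (subset_union_left.trans subset_union_left)
          subset_union_left)
        exact e.left hl hw rfl rfl (by dsimp [Frame.plug, Chor.parts]; gcongr; exact e.parts)
          hl.2.2.1 fun hd hs => ⟨e.lin, hl.2.1, hd, hs⟩
    | letSet ρ k C₂ =>
      cases ht with
      | letSet h₁ =>
        have e := ih h₁ hl.1 (sub hw (subset_union_left.trans subset_union_left)
          subset_union_left)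
        exact e.left hl hw rfl rfl (by dsimp [Frame.plug, Chor.parts]; gcongr; exact e.parts)
          hl.2.2.1 fun hd hs => ⟨e.lin, hl.2.1, hd, hs⟩
    | send ℓ ρ =>
      cases ht with
      | send h =>
        have e := ih h hl.1 (sub hw (subset_union_left.trans subset_union_left) (Subset.refl _))
        exact e.only hl hw rfl rfl (by dsimp [Frame.plug, Chor.parts]; gcongr; exact e.parts)
          fun hs => ⟨e.lin, hs⟩
    | killAfter a =>
      cases ht with
      | killAfter h =>
        have hwC : C.Within Ω := by
          refine ⟨fun b hb => ?_, (subset_insert _ _).trans hw.kills⟩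
          by_cases hab : b = a
          · exact hab ▸ hw.kills (mem_insert_self a _)
          · exact hw.parts b (mem_erase.2 ⟨by simpa using hab, hb⟩)
        have e := ih h hl.1 hwC
        have hins : ∀ C : Chor M, (Chor.killAfter a C).kills = C.kills ∪ {a} := fun C => by
          rw [Chor.kills, insert_eq, union_comm]
        exact e.child {a} hl hw (hins C) (hins C') (erase_subset_erase _ e.parts)
          (disjoint_singleton_right.2 hl.2.1)
          fun hd hs => ⟨e.lin, disjoint_singleton_right.1 hd, hs⟩
  | @done ρ e e' Ω _ hs =>
    -- `e` is not a value, since it steps; `e'` may be one, which removes participants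
    refine Evolves.reduce hw trivial ?_ (Subset.refl _)
    have : ¬ M.Val e := fun hv => M.val_not_step _ _ hv hs
    by_cases h' : M.Val e' <;> simp [Chor.parts, this, h']
  | @app ρ C V Ω _ hV =>
    cases ht with
    | app h₁ h₂ _ _ hann =>
      cases h₁ with
      | func _ _ _ _ hp _ =>
        have hk : C.kills = ∅ := hl.1
        refine Evolves.reduce_subst ?_ rfl hw (Chor.Lin.of_kills_eq_empty hk) ?_ (by simp [hk])
        · exact (Sub.Tame.chor₁ .func hl.1).consPv hV.parts_eq_empty (hV.kills_eq_empty hl.2.1)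
        · rw [hann]
          exact hp.trans (subset_union_right.trans subset_union_right)
  | @tapp ρ κ C a Ω _ =>
    cases ht with
    | tapp h _ _ _ hρ =>
      cases h with
      | tfun _ hp _ =>
        have hk : C.kills = ∅ := hl.1
        have hk' : (C.subst (Sub.tinst a)).kills = ∅ :=
          (Chor.kills_subst (Sub.Tame.tinst a) C).trans hk
        refine Evolves.reduce_subst (Sub.Tame.chor₁ .tfun hl.1) rfl hw
          (Chor.Lin.of_kills_eq_empty hk') ?_ (by simp [hk'])
        refine (Chor.parts_subst (Sub.Tame.tinst a) C).trans ((LocSet.subst_mono _ _ hp).trans ?_)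
        rw [hρ]
        exact subset_union_right.trans subset_union_right
  | unfoldFold _ _ => exact Evolves.reduce hw hl.1.1 subset_union_left (Subset.refl _)
  | fstPair _ _ _ =>
    exact Evolves.reduce hw hl.1.1 (subset_union_left.trans subset_union_left)
      subset_union_left
  | sndPair _ _ _ =>
    exact Evolves.reduce hw hl.1.2.1 (subset_union_right.trans subset_union_left)
      subset_union_right
  | caseInl _ hV =>
    exact Evolves.reduce_subst (Sub.Tame.chor₁ hV hl.1.1) rfl hw hl.2.1
      (subset_union_right.trans (subset_union_left.trans subset_union_left))
      (subset_union_left.trans subset_union_right)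
  | caseInr _ hV =>
    exact Evolves.reduce_subst (Sub.Tame.chor₁ hV hl.1.1) rfl hw hl.2.2.1
      (subset_union_right.trans subset_union_left)
      (subset_union_right.trans subset_union_right)
  | localCaseInl _ _ hv hc =>
    cases ht with
    | localCase h hsum =>
      cases h with
      | done _ h =>
        have hv₁ := (M.getCase_inl _ _ _ _ _ _ _ hsum hv h hc).1
        exact Evolves.reduce_subst (Sub.Tame.local₁ hv₁) rfl hw hl.2.1
          (subset_union_right.trans (subset_union_left.trans subset_union_left))
          (subset_union_left.trans subset_union_right)
  | localCaseInr _ _ hv hc =>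
    cases ht with
    | localCase h hsum =>
      cases h with
      | done _ h =>
        have hv₁ := (M.getCase_inr _ _ _ _ _ _ _ hsum hv h hc).1
        exact Evolves.reduce_subst (Sub.Tame.local₁ hv₁) rfl hw hl.2.2.1
          (subset_union_right.trans subset_union_left)
          (subset_union_right.trans subset_union_right)
  | letV _ _ hv =>
    exact Evolves.reduce_subst (Sub.Tame.local₁ hv) rfl hw hl.2.1
      (subset_union_right.trans subset_union_left) subset_union_right
  | @letLocV ρ ρ' v a C Ω _ _ _ hr =>
    cases ht with
    | letLoc h hρ hsub =>
      cases h with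
      | done _ h =>
        have hm := LocSet.mem_of_sub_fin hρ (M.repLoc_sound _ _ _ _ _ h hr) hsub
        have tame := Sub.Tame.tinst (M := M) (.loc (.const a))
        have hk : a ∉ C.kills := fun ha =>
          hl.2.2.2 a (mem_union_right _ ha) (mem_union_right _ hm)
        refine Evolves.reduce hw (hl.2.1.subst tame (LSub.Avoids.inst_loc hk)) ?_
          ((Chor.kills_subst tame C).subset.trans subset_union_right)
        refine (Chor.parts_subst tame C).trans
          ((LocSet.subst_inst_loc_subset (M := M) a C.parts).trans (union_subset ?_ ?_))
        · exact subset_union_right.trans subset_union_left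
        · exact singleton_subset_iff.2 (mem_union_right _ hm)
  | @letSetV ρ ρ' k v s C Ω _ _ _ hr =>
    cases ht with
    | letSet h hρ hsub =>
      cases h with
      | done _ h =>
        have hm : LocSet.ofFinset s ⊆ ρ := fun x hx => by
          obtain ⟨a, ha, rfl⟩ := mem_image.1 hx
          exact LocSet.mem_of_sub_fin hρ (M.repSet_sound _ _ _ _ _ h hr a ha) hsub
        have tame := Sub.Tame.tinst (M := M) (.set (LocSet.ofFinset s))
        have hk : ∀ a ∈ C.kills, Atom.loc (.const a) ∉ LocSet.ofFinset s := fun a ha h =>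
          hl.2.2.2 a (mem_union_right _ ha) (mem_union_right _ (hm h))
        refine Evolves.reduce hw (hl.2.1.subst tame (LSub.Avoids.inst_set hk)) ?_
          ((Chor.kills_subst tame C).subset.trans subset_union_right)
        refine (Chor.parts_subst tame C).trans
          ((LocSet.subst_inst_set_subset (M := M) _ C.parts).trans (union_subset ?_ ?_))
        · exact subset_union_right.trans subset_union_left
        · exact hm.trans subset_union_right
  | @sendV ρ₁ ρ₂ a v Ω _ _ _ hv =>
    exact Evolves.reduce hw trivial (by simp [Chor.parts, hv]) (Subset.refl _)
  | sync _ _ => exact Evolves.reduce hw hl.1 subset_union_right (Subset.refl _)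
  | @fork a b v C Ω _ hb hr =>
    have tame : ({ (Sub.tinst (.loc (.const b)) : Sub M) with lv := cons v M.evar } : Sub M).Tame :=
      (Sub.Tame.tinst (.loc (.const b))).consLv (M.repLoc_val v b hr)
    have hk : (C.substFork b v).kills = C.kills := Chor.kills_subst tame C
    have hbk : b ∉ C.kills := fun h => hb (hw.kills h)
    have hp : (Chor.killAfter b (C.substFork b v)).parts ⊆ (Chor.fork (.const a) C).parts := by
      intro x hx
      obtain ⟨hne, hx⟩ := mem_erase.1 hx
      have := LocSet.subst_inst_loc_subset (M := M) b C.parts (Chor.parts_subst tame C hx)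
      rcases mem_union.1 this with h | h
      · exact mem_union_right _ h
      · exact absurd (mem_singleton.1 h) hne
    refine ⟨⟨hl.1.subst tame (LSub.Avoids.inst_loc hbk), by rwa [hk], ?_⟩, hp, ?_, ?_, ?_⟩
    · intro c hc hpc
      rw [Chor.kills, hk] at hc
      rcases mem_insert.1 hc with rfl | hc
      · exact ne_of_mem_erase hpc rfl
      · exact hl.2 c hc (hp hpc)
    · change insert b (C.substFork b v).kills ⊆ C.kills ∪ (insert b Ω \ Ω)
      rw [hk]
      refine insert_subset ?_ subset_union_left
      exact mem_union_right _ (mem_sdiff.2 ⟨mem_insert_self _ _, hb⟩)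
    · rw [Chor.kills, hk]
      exact insert_subset_insert _ hw.kills
    · exact (subset_insert _ _).trans subset_union_left
  | @kill a V Ω _ hV =>
    have hk := hV.kills_eq_empty hl.1
    have hp := hV.parts_eq_empty
    refine ⟨hl.1, by simp [hp], by simp [hk], by simp [hk], fun b hb => ?_⟩
    by_cases hab : b = a <;> simp [hab, hb, Chor.kills]
  | appI _ _ ih =>
    cases ht with
    | app _ h₂ =>
      have e := ih h₂ hl.2.1 (hw.of_subset (fun _ h =>
        mem_union_left _ (mem_union_right _ h)) subset_union_right)
      exact e.right hl hw rfl rfl (by dsimp [Chor.parts]; gcongr; exact e.parts)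
        hl.2.2.1 fun hd hs => ⟨hl.1, e.lin, hd, hs⟩
  | pairI _ _ ih =>
    cases ht with
    | pair _ h₂ =>
      have e := ih h₂ hl.2.1 (hw.of_subset (fun _ h => mem_union_right _ h) subset_union_right)
      exact e.right hl hw rfl rfl (by dsimp [Chor.parts]; gcongr; exact e.parts)
        hl.2.2.1 fun hd hs => ⟨hl.1, e.lin, hd, hs⟩
  | @caseI ρ C C₁ C₁' C₂ C₂' Ω Ω' R _ _ _ ih₁ ih₂ =>
    cases ht with
    | case _ _ h₁ h₂ =>
      have e₁ := ih₁ h₁ hl.2.1 (hw.of_subset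
        (fun _ h => mem_union_left _ (mem_union_left _ (mem_union_right _ h)))
        (subset_union_left.trans subset_union_right))
      have e₂ := ih₂ h₂ hl.2.2.1 (hw.of_subset
        (fun _ h => mem_union_left _ (mem_union_right _ h))
        (subset_union_right.trans subset_union_right))
      refine Evolves.node (k := C₁.kills ∪ C₂.kills) (k' := C₁'.kills ∪ C₂'.kills)
        (K := C.kills) hl hw ?_ (union_subset e₁.live e₂.live) ?_ (union_comm _ _)
        (union_comm _ _) ?_ hl.2.2.2.1.symm fun hd hs => ⟨hl.1, e₁.lin, e₂.lin, hd.symm, hs⟩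
      · refine union_subset (e₁.kills.trans ?_) (e₂.kills.trans ?_)
        · exact union_subset_union_left subset_union_left
        · exact union_subset_union_left subset_union_right
      · exact e₁.alive.trans (union_subset_union_right subset_union_left)
      · dsimp [Chor.parts]
        gcongr
        · exact e₁.parts
        · exact e₂.parts
  | @localCaseI ρ C C₁ C₁' C₂ C₂' Ω Ω' R _ _ _ ih₁ ih₂ =>
    cases ht with
    | localCase _ _ _ _ h₁ h₂ =>
      have e₁ := ih₁ h₁ hl.2.1 (hw.of_subset
        (fun _ h => mem_union_left _ (mem_union_left _ (mem_union_right _ h)))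
        (subset_union_left.trans subset_union_right))
      have e₂ := ih₂ h₂ hl.2.2.1 (hw.of_subset
        (fun _ h => mem_union_left _ (mem_union_right _ h))
        (subset_union_right.trans subset_union_right))
      refine Evolves.node (k := C₁.kills ∪ C₂.kills) (k' := C₁'.kills ∪ C₂'.kills)
        (K := C.kills) hl hw ?_ (union_subset e₁.live e₂.live) ?_ (union_comm _ _)
        (union_comm _ _) ?_ hl.2.2.2.1.symm fun hd hs => ⟨hl.1, e₁.lin, e₂.lin, hd.symm, hs⟩
      · refine union_subset (e₁.kills.trans ?_) (e₂.kills.trans ?_)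
        · exact union_subset_union_left subset_union_left
        · exact union_subset_union_left subset_union_right
      · exact e₁.alive.trans (union_subset_union_right subset_union_left)
      · dsimp [Chor.parts]
        gcongr
        · exact e₁.parts
        · exact e₂.parts
  | letLocI _ _ ih =>
    cases ht with
    | letLoc _ _ _ _ _ h₂ =>
      have e := ih h₂ hl.2.1 (hw.of_subset (fun _ h => mem_union_left _
        (mem_union_right _ (LocSet.const_mem_drop.2 h))) subset_union_right)
      exact e.right hl hw rfl rfl
        (by dsimp [Chor.parts]; gcongr; exact LocSet.drop_mono _ e.parts)
        hl.2.2.1 fun hd hs => ⟨hl.1, e.lin, hd, hs⟩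
  | letSetI _ _ ih =>
    cases ht with
    | letSet _ _ _ _ _ h₂ =>
      have e := ih h₂ hl.2.1 (hw.of_subset (fun _ h => mem_union_left _
        (mem_union_right _ (LocSet.const_mem_drop.2 h))) subset_union_right)
      exact e.right hl hw rfl rfl
        (by dsimp [Chor.parts]; gcongr; exact LocSet.drop_mono _ e.parts)
        hl.2.2.1 fun hd hs => ⟨hl.1, e.lin, hd, hs⟩
  | syncI _ _ ih =>
    cases ht with
    | sync _ _ h =>
      have e := ih h hl.1 (hw.of_subset (fun _ h => mem_union_right _ h) (Subset.refl _))
      exact e.only hl hw rfl rfl (by dsimp [Chor.parts]; gcongr; exact e.parts)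
        fun hs => ⟨e.lin, hs⟩
  | forkI _ _ ih =>
    cases ht with
    | fork _ _ h =>
      have e := ih h hl.1 (hw.of_subset (fun _ h =>
        mem_union_right _ (LocSet.const_mem_drop.2 h)) (Subset.refl _))
      exact e.only hl hw rfl rfl
        (by dsimp [Chor.parts]; gcongr; exact LocSet.drop_mono _ e.parts)
        fun hs => ⟨e.lin, hs⟩
  | @killI a C Ω _ hd =>
    -- the step is enabled only if `a` does not occur in `C`, so erasing `a` changes nothing
    have hp : Atom.loc (.const a) ∉ C.parts := fun h => hd (.inl (C.parts_subset_cloc h))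
    refine ⟨hl.1, ?_, (subset_insert _ _).trans subset_union_left, fun b hb => ?_, fun b hb => ?_⟩
    · exact subset_erase.2 ⟨Subset.refl _, hp⟩
    · exact mem_erase.2 ⟨fun h => hl.2.1 (h ▸ hb), hw.kills (mem_insert_of_mem hb)⟩
    · by_cases hab : b = a <;> simp [hab, hb, Chor.kills]
  | _ =>
    -- the out-of-order step in the body of a `letIn`, whose constructor is named by a keyword
    rename_i ih
    cases ht with
    | letIn _ _ _ h₂ =>
      have e := ih h₂ hl.2.1 (hw.of_subset (fun _ h => mem_union_left _
        (mem_union_right _ h)) subset_union_right)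
      exact e.right hl hw rfl rfl (by dsimp [Chor.parts]; gcongr; exact e.parts)
        hl.2.2.1 fun hd hs => ⟨hl.1, e.lin, hd, hs⟩

/-! ### Progress -/

theorem LocSet.live_of_setOk {k : SetKind} {ρ : LocSet L} {Ω : Finset L}
    (h : SetOk LCtx.empty k ρ) (hΩ : ∀ a, Atom.loc (.const a) ∈ ρ → a ∈ Ω) : Live Ω ρ := by
  intro x hx
  have := h x hx
  rcases x with (i | a) | i | _
  · exact absurd this (Nat.not_lt_zero i)
  · exact .inr ⟨a, hΩ a hx, rfl⟩
  · simp [LCtx.empty] at this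
  · exact .inl rfl

theorem Kinded.setOk_empty {τ : CTy M} {ρ : LocSet L}
    (h : Kinded (Ctx.empty : Ctx M).kinds τ ρ) : SetOk LCtx.empty .any ρ :=
  h.setOk fun _ h => absurd h List.not_mem_nil

theorem LocOk.exists_const {ℓ : Loc L} (h : LocOk LCtx.empty ℓ) : ∃ a, ℓ = .const a := by
  cases ℓ with
  | var i => exact absurd h (Nat.not_lt_zero i)
  | const a => exact ⟨a, rfl⟩

/-- A closed well-typed choreography all of whose participants and threads are live is a value
or can take a step. -/
theorem RunType.progress [Infinite L] {C : Chor M} {τ : CTy M} {Ω : Finset L}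
    (h : RunType Ctx.empty C τ) (hw : C.Within Ω) :
    C.Value ∨ ∃ R C' Ω', Step (C, Ω) R (C', Ω') := by
  generalize hΓ : (Ctx.empty : Ctx M) = Γ at h
  have frame : ∀ (η : Frame M) {C : Chor M}, η.Ok → (∃ R C' Ω', Step (C, Ω) R (C', Ω')) →
      ∃ R C' Ω', Step (η.plug C, Ω) R (C', Ω') := by
    rintro η C hη ⟨R, C', Ω', h⟩
    exact ⟨_, _, _, .ctx hη h⟩
  induction h with
  | var h => subst hΓ; simp [Ctx.empty] at h
  | @done Γ ρ e t hρ h =>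
    subst hΓ
    by_cases hv : M.Val e
    · exact .inl (.done hv)
    · obtain ⟨e', he⟩ := (M.progress e t h).resolve_left hv
      refine .inr ⟨_, _, _, .done (LocSet.live_of_setOk hρ fun a ha => hw.parts a ?_) he⟩
      simpa [Chor.parts, hv] using ha
  | func => exact .inl .func
  | tfun => exact .inl .tfun
  | @app Γ C₁ C₂ τ₁ τ₂ ρ ρt₁ ρt₂ ρa h₁ h₂ ht₁ ht₂ hann ih₁ ih₂ =>
    subst hΓ
    rcases ih₁ (hw.of_subset (fun _ h => by simp [Chor.parts, h]) (by simp [Chor.kills])) rfl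
      with v₁ | s
    swap; · exact .inr (frame (.appL _ _) trivial s)
    rcases ih₂ (hw.of_subset (fun _ h => by simp [Chor.parts, h]) (by simp [Chor.kills])) rfl
      with v₂ | s
    swap; · exact .inr (frame (.appR _ _) v₁ s)
    cases h₁ with
    | func k₁ k₂ hρ ha =>
      obtain rfl := k₁.unique ht₁
      obtain rfl := k₂.unique ht₂
      rw [← hann] at ha
      subst ha
      refine .inr ⟨_, _, _, .app (LocSet.live_of_setOk (k := .any) ?_ fun a ha => ?_) v₂⟩
      · rw [hann]
        exact (ht₁.setOk_empty.union ht₂.setOk_empty).union hρ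
      · exact hw.parts a (by simp [Chor.parts, ha])
    | _ => cases v₁
  | @tapp Γ κ C a τ τ' ρ ρt ρa h ha ht hτ hρ ih =>
    subst hΓ
    rcases ih (hw.of_subset (fun _ h => by simp [Chor.parts, h]) (by simp [Chor.kills])) rfl
      with v | s
    swap; · exact .inr (frame (.tapp _ _) trivial s)
    cases h with
    | tfun hk =>
      have hok : SetOk ((Ctx.empty : Ctx M).kinds.bind κ).toLCtx .any ρ := by
        cases hk <;> assumption
      refine .inr ⟨_, _, _, .tapp (LocSet.live_of_setOk (k := .any) ?_ fun a ha => ?_)⟩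
      · rw [hρ]
        exact ht.setOk_empty.union (hok.subst ha.inst.toLSub)
      · exact hw.parts a (by simp [Chor.parts, ha])
    | _ => cases v
  | fold _ _ ih =>
    rcases ih (hw.of_subset (fun _ h => h) (Finset.Subset.refl _)) hΓ with v | s
    · exact .inl (.fold v)
    · exact .inr (frame (.fold _) trivial s)
  | unfold ht h hτ ih =>
    subst hΓ
    rcases ih (hw.of_subset (fun _ h => by simp [Chor.parts, h]) (by simp [Chor.kills])) rfl
      with v | s
    swap; · exact .inr (frame (.unfold _) trivial s)
    cases h with
    | fold =>
      cases v with
      | fold v =>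
        exact .inr ⟨_, _, _, .unfoldFold (LocSet.live_of_setOk ht.setOk_empty fun a ha =>
          hw.parts a (by simp [Chor.parts, ha])) v⟩
    | _ => cases v
  | pair _ _ _ _ _ ih₁ ih₂ =>
    rcases ih₁ (hw.of_subset (fun _ h => by simp [Chor.parts, h]) (by simp [Chor.kills])) hΓ
      with v₁ | s
    swap; · exact .inr (frame (.pairL _ _) trivial s)
    rcases ih₂ (hw.of_subset (fun _ h => by simp [Chor.parts, h]) (by simp [Chor.kills])) hΓ
      with v₂ | s
    · exact .inl (.pair v₁ v₂)
    · exact .inr (frame (.pairR _ _) v₁ s)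
  | fst h ht₁ ht₂ ha ih =>
    subst hΓ
    rcases ih (hw.of_subset (fun _ h => by simp [Chor.parts, h]) (by simp [Chor.kills])) rfl
      with v | s
    swap; · exact .inr (frame (.fst _) trivial s)
    cases h with
    | pair _ _ k₁ k₂ ha' =>
      obtain rfl := k₁.unique ht₁
      obtain rfl := k₂.unique ht₂
      rw [← ha] at ha'
      subst ha'
      cases v with
      | pair v₁ v₂ =>
        refine .inr ⟨_, _, _, .fstPair (LocSet.live_of_setOk (k := .any) ?_ fun a ha =>
          hw.parts a (by simp [Chor.parts, ha])) v₁ v₂⟩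
        rw [ha]
        exact ht₁.setOk_empty.union ht₂.setOk_empty
    | _ => cases v
  | snd h ht₁ ht₂ ha ih =>
    subst hΓ
    rcases ih (hw.of_subset (fun _ h => by simp [Chor.parts, h]) (by simp [Chor.kills])) rfl
      with v | s
    swap; · exact .inr (frame (.snd _) trivial s)
    cases h with
    | pair _ _ k₁ k₂ ha' =>
      obtain rfl := k₁.unique ht₁
      obtain rfl := k₂.unique ht₂
      rw [← ha] at ha'
      subst ha'
      cases v with
      | pair v₁ v₂ =>
        refine .inr ⟨_, _, _, .sndPair (LocSet.live_of_setOk (k := .any) ?_ fun a ha =>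
          hw.parts a (by simp [Chor.parts, ha])) v₁ v₂⟩
        rw [ha]
        exact ht₁.setOk_empty.union ht₂.setOk_empty
    | _ => cases v
  | inl _ _ ih =>
    rcases ih (hw.of_subset (fun _ h => h) (Finset.Subset.refl _)) hΓ with v | s
    · exact .inl (.inl v)
    · exact .inr (frame (.inl _) trivial s)
  | inr _ _ ih =>
    rcases ih (hw.of_subset (fun _ h => h) (Finset.Subset.refl _)) hΓ with v | s
    · exact .inl (.inr v)
    · exact .inr (frame (.inr _) trivial s)
  | case ht h _ _ ih =>
    subst hΓ
    rcases ih (hw.of_subset (fun _ h => by simp [Chor.parts, h])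
      (by simp [Chor.kills])) rfl with v | s
    swap; · exact .inr (frame (.case _ _ _) trivial s)
    have hlive := LocSet.live_of_setOk (Ω := Ω) ht.setOk_empty fun a ha =>
      hw.parts a (by simp [Chor.parts, ha])
    cases h with
    | inl =>
      cases v with
      | inl v => exact .inr ⟨_, _, _, .caseInl hlive v⟩
    | inr =>
      cases v with
      | inr v => exact .inr ⟨_, _, _, .caseInr hlive v⟩
    | _ => cases v
  | localCase h hs hρ hsub _ _ ih =>
    subst hΓ
    rcases ih (hw.of_subset (fun _ h => by simp [Chor.parts, h])
      (by simp [Chor.kills])) rfl with v | s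
    swap; · exact .inr (frame (.localCase _ _ _) trivial s)
    have hlive := LocSet.live_of_setOk (Ω := Ω) hρ fun a ha =>
      hw.parts a (by simp [Chor.parts, ha])
    cases h with
    | done _ h =>
      cases v with
      | done v =>
        obtain ⟨c | c, hc⟩ := M.getCase_total _ _ _ _ hs v h
        · exact .inr ⟨_, _, _, .localCaseInl hlive hsub v hc⟩
        · exact .inr ⟨_, _, _, .localCaseInr hlive hsub v hc⟩
    | _ => cases v
  | letIn h hρ hsub _ ih =>
    subst hΓ
    rcases ih (hw.of_subset (fun _ h => by simp [Chor.parts, h]) (by simp [Chor.kills])) rfl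
      with v | s
    swap; · exact .inr (frame (.letIn _ _ _) trivial s)
    have hlive := LocSet.live_of_setOk (Ω := Ω) hρ fun a ha =>
      hw.parts a (by simp [Chor.parts, ha])
    cases h with
    | done _ h => cases v with | done v => exact .inr ⟨_, _, _, .letV hlive hsub v⟩
    | _ => cases v
  | letLoc h hρ _ hsub _ _ ih =>
    subst hΓ
    rcases ih (hw.of_subset (fun _ h => by simp [Chor.parts, h]) (by simp [Chor.kills])) rfl
      with v | s
    swap; · exact .inr (frame (.letLoc _ _) trivial s)
    have hlive := LocSet.live_of_setOk (Ω := Ω) hρ fun a ha =>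
      hw.parts a (by simp [Chor.parts, ha])
    cases h with
    | done _ h =>
      cases v with
      | done v =>
        obtain ⟨a, ha⟩ := M.repLoc_total _ _ v h
        exact .inr ⟨_, _, _, .letLocV hlive hsub v ha⟩
    | _ => cases v
  | letSet h hρ _ hsub _ _ ih =>
    subst hΓ
    rcases ih (hw.of_subset (fun _ h => by simp [Chor.parts, h]) (by simp [Chor.kills])) rfl
      with v | s
    swap; · exact .inr (frame (.letSet _ _ _) trivial s)
    have hlive := LocSet.live_of_setOk (Ω := Ω) hρ fun a ha =>
      hw.parts a (by simp [Chor.parts, ha])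
    cases h with
    | done _ h =>
      cases v with
      | done v =>
        obtain ⟨s, hs⟩ := M.repSet_total _ _ v h
        exact .inr ⟨_, _, _, .letSetV hlive hsub v hs⟩
    | _ => cases v
  | send h hℓ hm hρ ih =>
    subst hΓ
    rcases ih (hw.of_subset (fun _ h => by simp [Chor.parts, h]) (by simp [Chor.kills])) rfl
      with v | s
    swap; · exact .inr (frame (.send _ _) trivial s)
    have hlive := LocSet.live_of_setOk (Ω := Ω) hρ fun a ha =>
      hw.parts a (by simp [Chor.parts, ha])
    obtain ⟨a, rfl⟩ := hℓ.exists_const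
    have ha := hw.parts a (by simp [Chor.parts, LocSet.single])
    cases h with
    | done => cases v with | done v => exact .inr ⟨_, _, _, .sendV ha hlive hm v⟩
    | _ => cases v
  | sync hℓ hρ _ _ =>
    subst hΓ
    have hlive := LocSet.live_of_setOk (Ω := Ω) hρ fun a ha =>
      hw.parts a (by simp [Chor.parts, ha])
    obtain ⟨a, rfl⟩ := hℓ.exists_const
    exact .inr ⟨_, _, _, .sync (hw.parts a (by simp [Chor.parts, LocSet.single])) hlive⟩
  | fork hℓ _ _ _ =>
    subst hΓ
    obtain ⟨a, rfl⟩ := hℓ.exists_const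
    obtain ⟨b, hb⟩ := Infinite.exists_notMem_finset Ω
    obtain ⟨v, hv⟩ := M.repLoc_exists b
    exact .inr ⟨_, _, _, .fork (hw.parts a (by simp [Chor.parts, LocSet.single])) hb hv⟩
  | @killAfter Γ C a τ h ih =>
    have ha : a ∈ Ω := hw.kills (Finset.mem_insert_self _ _)
    have hwC : C.Within Ω := by
      refine ⟨fun b hb => ?_, (Finset.subset_insert _ _).trans hw.kills⟩
      by_cases hab : b = a
      · exact hab ▸ ha
      · exact hw.parts b (Finset.mem_erase.2 ⟨by simpa using hab, hb⟩)
    rcases ih hwC hΓ with v | s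
    · exact .inr ⟨_, _, _, .kill ha v⟩
    · exact .inr (frame (.killAfter _) trivial s)

theorem Ctx.apart_empty (R : Redex M) : (Ctx.empty : Ctx M).Apart R :=
  fun _ h => absurd h List.not_mem_nil

/-- The invariant of execution: the choreography is closed and has type `τ`, it uses its threads
linearly, and all of its participants and threads are live. -/
structure Config.Sound (c : Config M) (τ : CTy M) : Prop where
  runType : RunType Ctx.empty c.1 τ
  lin : c.1.Lin
  within : c.1.Within c.2

theorem Config.Sound.step {c c' : Config M} {τ : CTy M} {R : Redex M} (h : Config.Sound c τ)
    (hs : Step c R c') : Config.Sound c' τ :=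
  have e := hs.evolves h.runType h.lin h.within
  ⟨hs.runType h.runType h.lin (Ctx.apart_empty R), e.lin, e.within h.lin h.within⟩

end Soundness

end LambdaFork

theorem mainTheorem4 {L : Type u} [DecidableEq L] [Infinite L]
    (M : LambdaFork.LocalLang.{u, v, w} L)
    (C : LambdaFork.Chor M) (τ : LambdaFork.CTy M) (ρ : LambdaFork.LocSet L)
    (hC : LambdaFork.HasType LambdaFork.Ctx.empty C τ ρ)
    (Ω : Finset L) (hΩ : LambdaFork.LocSet.NL ρ ⊆ (Ω : Set L))
    (C' : LambdaFork.Chor M) (Ω' : Finset L)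
    (hsteps : LambdaFork.Steps (C, Ω) (C', Ω')) :
    C'.Value ∨ ∃ R C'' Ω'', LambdaFork.Step (C', Ω') R (C'', Ω'') := by
  have h₀ : LambdaFork.Config.Sound (C, Ω) τ := by
    have hk := hC.kills_eq_empty
    refine ⟨hC.runType, LambdaFork.Chor.Lin.of_kills_eq_empty hk, fun a ha => ?_, ?_⟩
    · rw [hC.parts_eq] at ha
      exact hΩ ha
    · simp [hk]
  have h : LambdaFork.Config.Sound (C', Ω') τ := by
    unfold LambdaFork.Steps at hsteps
    generalize (C', Ω') = c at hsteps
    induction hsteps with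
    | refl => exact h₀
    | tail _ hs ih => exact hs.elim fun _ hs => ih.step hs
  exact h.runType.progress h.within
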